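/- Let $H\in(1/2,1)$ and $-1/2<s<H-1$. Let $B=(B(t))_{t\ge 0}$ be a fractional Brownian motion with Hurst parameter $H$ on a probability space $(\Omega,\mathcal F,\mathbb P)$, i.e. a centered Gaussian process with $\mathbb E[B(t)B(u)]=\tfrac12\left(t^{2H}+u^{2H}-|t-u|^{2H}\right)$. Let $E=B^s_{2,2}(0,1)$ be the real Besov space of the restrictions to $(0,1)$ of the elements of $B^s_{2,2}(\mathbb R)=H^s(\mathbb R)$, with the quotient norm. The fractional Gaussian noise on $(0,1)$ is the random distribution $\xi$ with $\langle\xi,\varphi\rangle=\int_0^1\varphi\,dB$ almost surely for every $\varphi\in C_c^\infty((0,1);\mathbb R)$, the integral being the Wiener integral (the limit of Riemann sums in $L^2(\Omega)$). Let $\phi=1_{[0,1)}$, $\psi=1_{[0,1/2)}-1_{[1/2,1)}$, $\psi_{j,k}(t)=2^{j/2}\psi(2^jt-k)$ for $j\ge 0$, $0\le k<2^j$. Let $(e_n)_{n\ge 0}$ be the Haar system $e_0=\phi$, $e_{2^j+k}=\psi_{j,k}$, and put $F_0=\operatorname{span}\{\phi\}$, $F_{j+1}=\operatorname{span}\{\psi_{j,k}:0\le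 k<2^j\}$, $G_n=F_0\oplus\dots\oplus F_n$, and $G^n=\overline{\operatorname{span}}\bigcup_{k>n}F_k$ (closure in $E$). Then the noise exists in $L^2(\Omega;E)$: there is such a $\xi$ with values in $E$, strongly measurable up to a null set, with $\mathbb E\|\xi\|_E^2<\infty$. The Haar system is a Schauder basis of $E$, the spaces $F_n$ are closed and mutually disjoint (that is, $F_j\cap F_k=\{0\}$ for $j\ne k$), and $E=G_n\oplus G^n$ is a topological direct sum for all $n$; let $\pi_{G_n}$ be the projection onto $G_n$ along $G^n$. Moreover, every $E$-valued version $\xi$ of the noise lies in $L^2(\Omega;E)$, and its law $\mu$ on $E$ has the following properties, where $\mu_{G_n}(A)=\mu(A+G^n)$ for Borel sets $A\subset G_n$ and $\mu_{G^n}(A)=\mu(A+G_n)$ for Borel sets $A\subset G^n$. 1. $\mu$ is decomposable along $(F_n)$: for every $n\ge 0$ there is a probability kernel $l_n:G^n\times\mathcal B(G_n)\to[0,1]$ such that, for every Borel set $A\subset E$, $$\mu(A)=\int_{G^n}l_n\big(y,\{x\in G_n: x+y\in A\}\big)\,\mu_{G^n}(dy).$$ 2. For every $n\ge 0$, $\mu_{G_n}$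 is absolutely continuous with respect to the Lebesgue measure of the finite dimensional space $G_n$. 3. There is a point $Y=\sum_{j\ge 0}y_je_j\in E$ such that (a) $\mu_{G_n}(\{x\in G_n:\|x-\pi_{G_n}Y\|_E\le\delta\})>0$ for all $n\ge 0$ and $\delta>0$; (b) for every $N\ge 0$ there is $R_N>0$ such that for all $x_0\in G_N$ with $\|x_0-\pi_{G_N}Y\|_E\le R_N$ and all $\varepsilon>0$ there is $\delta>0$ with $\mu(\{x\in E:\|x-x_0\|_E\le\varepsilon\})\ge\delta$. -/

import Mathlib

open MeasureTheory ProbabilityTheory Filter Topology Set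
open scoped ENNReal NNReal SchwartzMap Distributions

noncomputable section

namespace FracNoise

/-! ### The real Besov space `B^s_{2,2}(0,1)`

`B^s_{2,2}(ℝ)` is the Sobolev space `H^s(ℝ)` of the tempered distributions `U` with
`(1 + |ξ|²)^{s/2} Û ∈ L²(ℝ)`, and `B^s_{2,2}(0,1)` is the space of the restrictions to `(0,1)` of the
elements of `B^s_{2,2}(ℝ)`, with the quotient norm `‖u‖ = inf {‖U‖ : U = u on (0,1)}`. -/

/-- The open interval `(0,1)`. -/
def unitIoo : TopologicalSpace.Opens ℝ := ⟨Ioo 0 1, isOpen_Ioo⟩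

theorem hasCompactSupport_ofReal (φ : 𝓓(unitIoo, ℝ)) :
    HasCompactSupport (fun x : ℝ => ((φ x : ℝ) : ℂ)) :=
  φ.hasCompactSupport.comp_left (g := fun r : ℝ => (r : ℂ)) Complex.ofReal_zero

theorem contDiff_ofReal (φ : 𝓓(unitIoo, ℝ)) :
    ContDiff ℝ ((⊤ : ℕ∞) : WithTop ℕ∞) (fun x : ℝ => ((φ x : ℝ) : ℂ)) :=
  Complex.ofRealCLM.contDiff.comp φ.contDiff

/-- A real test function on `(0,1)`, extended by zero to `ℝ` and seen as a Schwartz function. -/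
def testToSchwartz (φ : 𝓓(unitIoo, ℝ)) : 𝓢(ℝ, ℂ) :=
  (hasCompactSupport_ofReal φ).toSchwartzMap (contDiff_ofReal φ)

/-- The isometry `L²(ℝ) → H^s(ℝ)`, `g ↦ 𝓕⁻¹ ((1 + |ξ|²)^{-s/2} 𝓕 g)`: every `U ∈ H^s(ℝ)` is the image
of exactly one `g`, and `‖U‖_{H^s} = ‖g‖_{L²}` (see `memSobolev_iff_exists`). -/
def sobolevOfL2 (s : ℝ) : Lp ℂ 2 (volume : Measure ℝ) →L[ℂ] 𝓢'(ℝ, ℂ) :=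
  (TemperedDistribution.besselPotential ℝ ℂ (-s)).comp
    (Lp.toTemperedDistributionCLM ℂ volume 2)

theorem memSobolev_iff_exists (s : ℝ) (U : 𝓢'(ℝ, ℂ)) :
    TemperedDistribution.MemSobolev s 2 U ↔ ∃ g, sobolevOfL2 s g = U := by
  constructor
  · rintro ⟨g, hg⟩
    exact ⟨g, (TemperedDistribution.besselPotential_neg_apply_eq_iff s _ _).2 hg⟩
  · rintro ⟨g, hg⟩
    exact ⟨g, (TemperedDistribution.besselPotential_neg_apply_eq_iff s _ _).1 hg⟩

theorem sobolevOfL2_injective (s : ℝ) : Function.Injective (sobolevOfL2 s) := by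
  intro f g h
  have h' := (TemperedDistribution.besselPotential_neg_apply_eq_iff s _ _).1 h
  have h2 : TemperedDistribution.besselPotential ℝ ℂ s (sobolevOfL2 s g)
      = Lp.toTemperedDistributionCLM ℂ volume 2 g :=
    (TemperedDistribution.besselPotential_neg_apply_eq_iff s _ _).1 rfl
  rw [h2] at h'
  exact LinearMap.ker_eq_bot.1 (Lp.ker_toTemperedDistributionCLM_eq_bot (F := ℂ)
    (μ := (volume : Measure ℝ)) (p := 2)) h'.symm

/-- The value `Re ⟨U, φ⟩` at `φ ∈ C_c^∞((0,1); ℝ)` of the distribution `U = sobolevOfL2 s g`, as a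
continuous real-linear functional of `g`. -/
def evalAt (s : ℝ) (φ : 𝓓(unitIoo, ℝ)) : Lp ℂ 2 (volume : Measure ℝ) →L[ℝ] ℝ :=
  Complex.reCLM.comp
    (((PointwiseConvergenceCLM.evalCLM (RingHom.id ℂ) ℂ (testToSchwartz φ)).comp
      (sobolevOfL2 s)).restrictScalars ℝ)

theorem evalAt_apply (s : ℝ) (φ : 𝓓(unitIoo, ℝ)) (g : Lp ℂ 2 (volume : Measure ℝ)) :
    evalAt s φ g = (sobolevOfL2 s g (testToSchwartz φ)).re := rfl

/-- The elements of `H^s(ℝ)` whose real part vanishes on `(0,1)`. -/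
def vanishing (s : ℝ) : Submodule ℝ (Lp ℂ 2 (volume : Measure ℝ)) :=
  ⨅ φ : 𝓓(unitIoo, ℝ), (evalAt s φ).ker

theorem mem_vanishing (s : ℝ) (g : Lp ℂ 2 (volume : Measure ℝ)) :
    g ∈ vanishing s ↔ ∀ φ, evalAt s φ g = 0 := by
  simp [vanishing]

instance isClosed_vanishing (s : ℝ) :
    IsClosed (vanishing s : Set (Lp ℂ 2 (volume : Measure ℝ))) := by
  have h : (vanishing s : Set (Lp ℂ 2 (volume : Measure ℝ))) =
      ⋂ φ : 𝓓(unitIoo, ℝ), {g | evalAt s φ g = 0} := by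
    ext g
    simp [mem_vanishing]
  rw [h]
  exact isClosed_iInter fun φ => isClosed_eq (evalAt s φ).continuous continuous_const

/-- The real Banach space `B^s_{2,2}(0,1)`: an element is the restriction to `(0,1)` of the real part
of an element `U` of `H^s(ℝ)`, two `U` being identified if these restrictions agree; the norm is the
smallest `‖U‖_{H^s}`.  (As `‖Re U‖_{H^s} ≤ ‖U‖_{H^s}`, these are the restrictions of the real elements
of `H^s(ℝ)`, with the usual norm.) -/
def Besov (s : ℝ) : Type := Lp ℂ 2 (volume : Measure ℝ) ⧸ vanishing s

instance (s : ℝ) : NormedAddCommGroup (Besov s) :=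
  inferInstanceAs (NormedAddCommGroup (Lp ℂ 2 (volume : Measure ℝ) ⧸ vanishing s))

instance (s : ℝ) : NormedSpace ℝ (Besov s) :=
  inferInstanceAs (NormedSpace ℝ (Lp ℂ 2 (volume : Measure ℝ) ⧸ vanishing s))

instance (s : ℝ) : CompleteSpace (Besov s) :=
  inferInstanceAs (CompleteSpace (Lp ℂ 2 (volume : Measure ℝ) ⧸ vanishing s))

instance (s : ℝ) : SecondCountableTopology (Besov s) := by
  have : Fact ((2 : ℝ≥0∞) ≠ ∞) := ⟨by simp⟩
  have h : Function.Surjective ((vanishing s).mkQ) := Submodule.mkQ_surjective _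
  have : TopologicalSpace.SeparableSpace (Besov s) :=
    h.denseRange.separableSpace (α := Lp ℂ 2 (volume : Measure ℝ)) (β := Besov s)
      (f := (vanishing s).mkQ) continuous_quot_mk
  exact UniformSpace.secondCountable_of_separable _

instance (s : ℝ) : MeasurableSpace (Besov s) := borel _

instance (s : ℝ) : BorelSpace (Besov s) := ⟨rfl⟩

/-- The pairing `⟨u, φ⟩` of a distribution `u ∈ B^s_{2,2}(0,1)` with `φ ∈ C_c^∞((0,1); ℝ)`. -/
def pairing {s : ℝ} (u : Besov s) (φ : 𝓓(unitIoo, ℝ)) : ℝ :=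
  (vanishing s).liftQ (evalAt s φ).toLinearMap
    (fun g hg => (mem_vanishing s g).1 hg φ) u

theorem pairing_ext {s : ℝ} {u v : Besov s} (h : ∀ φ, pairing u φ = pairing v φ) : u = v := by
  obtain ⟨f, rfl⟩ := Submodule.mkQ_surjective (vanishing s) u
  obtain ⟨g, rfl⟩ := Submodule.mkQ_surjective (vanishing s) v
  refine (Submodule.Quotient.eq (vanishing s)).2 ((mem_vanishing s _).2 fun φ => ?_)
  have : evalAt s φ f = evalAt s φ g := h φ
  rw [map_sub, this, sub_self]

/-- The distribution `u` on `(0,1)` is the function `f`. -/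
def Represents {s : ℝ} (u : Besov s) (f : ℝ → ℝ) : Prop :=
  ∀ φ : 𝓓(unitIoo, ℝ), pairing u φ = ∫ x in (0 : ℝ)..1, f x * φ x

/-! ### The Haar multiresolution analysis -/

/-- The scaling function `1_{[0,1)}`. -/
def haarScaling (t : ℝ) : ℝ := if 0 ≤ t ∧ t < 1 then 1 else 0

/-- The Haar mother wavelet `1_{[0,1/2)} - 1_{[1/2,1)}`. -/
def haarMother (t : ℝ) : ℝ :=
  if 0 ≤ t ∧ t < 1 / 2 then 1 else if 1 / 2 ≤ t ∧ t < 1 then -1 else 0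

/-- `ψ_{j,k}(t) = 2^{j/2} ψ(2^j t - k)`, supported in `[k 2^{-j}, (k+1) 2^{-j}]`. -/
def haarWavelet (j k : ℕ) (t : ℝ) : ℝ :=
  (2 : ℝ) ^ ((j : ℝ) / 2) * haarMother (2 ^ j * t - k)

/-- The Haar system of `(0,1)` in its usual order: first the scaling function, then `ψ_{j,k}`,
`0 ≤ k < 2^j`, at the place `2^j + k`. -/
def haar (n : ℕ) : ℝ → ℝ :=
  if n = 0 then haarScaling else haarWavelet (Nat.log 2 n) (n - 2 ^ Nat.log 2 n)

/-- The spaces `F_0 = V_0 = span {1_{[0,1)}}` and `F_{j+1} = W_j = span {ψ_{j,k} : 0 ≤ k < 2^j}` as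
subspaces of `B^s_{2,2}(0,1)`. -/
def haarSpace (s : ℝ) : ℕ → Submodule ℝ (Besov s)
  | 0 => Submodule.span ℝ {u | Represents u haarScaling}
  | j + 1 => Submodule.span ℝ {u | ∃ k < 2 ^ j, Represents u (haarWavelet j k)}

/-! ### Decomposable measures -/

section Decomposable

variable {E : Type*} [NormedAddCommGroup E] [NormedSpace ℝ E]

/-- `G_n = F_0 ⊕ ⋯ ⊕ F_n`. -/
def headSpace (F : ℕ → Submodule ℝ E) (n : ℕ) : Submodule ℝ E := ⨆ k ≤ n, F k

/-- `G^n`, the complement of `G_n` along the expansion: the closed span of the `F_k`, `k > n`. -/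
def tailSpace (F : ℕ → Submodule ℝ E) (n : ℕ) : Submodule ℝ E :=
  (⨆ k > n, F k).topologicalClosure

/-- `(F_n)` is a sequence of closed, mutually disjoint subspaces of `E` such that
`E = G_n ⊕ G^n` (a topological direct sum) for all `n`. -/
structure IsSplitting (F : ℕ → Submodule ℝ E) : Prop where
  closed : ∀ n, IsClosed (F n : Set E)
  disjoint : ∀ j k, j ≠ k → Disjoint (F j) (F k)
  topCompl : ∀ n, (headSpace F n).IsTopCompl (tailSpace F n)

variable {F : ℕ → Submodule ℝ E}

/-- The projection `π_{G_n}` of `E` onto `G_n` along `G^n`. -/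
def headProj (hF : IsSplitting F) (n : ℕ) : E →L[ℝ] headSpace F n :=
  (headSpace F n).projectionOntoL (tailSpace F n) (hF.topCompl n)

/-- The projection of `E` onto `G^n` along `G_n`. -/
def tailProj (hF : IsSplitting F) (n : ℕ) : E →L[ℝ] tailSpace F n :=
  (tailSpace F n).projectionOntoL (headSpace F n) (hF.topCompl n).symm

variable [MeasurableSpace E]

/-- The measure `μ_{G_n}(A) = μ(A + G^n)` on `G_n`. -/
def headMarginal (hF : IsSplitting F) (μ : Measure E) (n : ℕ) : Measure (headSpace F n) :=
  μ.map (headProj hF n)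

/-- The measure `μ_{G^n}(A) = μ(A + G_n)` on `G^n`. -/
def tailMarginal (hF : IsSplitting F) (μ : Measure E) (n : ℕ) : Measure (tailSpace F n) :=
  μ.map (tailProj hF n)

/-- `μ` is decomposable with decomposition `{F_n, G^n, l_n}`: the `l_n : G^n × 𝓑(G_n) → [0,1]` are
probability kernels, and `μ(A) = ∫_{G^n} l_n(y, A_n(y)) μ_{G^n}(dy)` for all Borel sets `A`, with
`A_n(y) = {x ∈ G_n : x + y ∈ A}`. -/
structure IsDecomposition (hF : IsSplitting F) (μ : Measure E)
    (l : ∀ n, Kernel (tailSpace F n) (headSpace F n)) : Prop where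
  markov : ∀ n, IsMarkovKernel (l n)
  disintegration : ∀ n, ∀ A : Set E, MeasurableSet A →
    μ A = ∫⁻ y, l n y {x | (x : E) + (y : E) ∈ A} ∂(tailMarginal hF μ n)

/-- Absolute continuity of a measure on a finite dimensional space with respect to the Lebesgue
measure, transported from `ℝ^d` by a linear isomorphism (the choice does not matter). -/
def AbsContLebesgue {V : Type*} [AddCommGroup V] [Module ℝ V] [TopologicalSpace V]
    [MeasurableSpace V] (ν : Measure V) : Prop :=
  ∃ (d : ℕ) (ι : (Fin d → ℝ) ≃L[ℝ] V), ν ≪ (volume : Measure (Fin d → ℝ)).map ι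

/-- All the finite dimensional projections `μ_{G_n}` are absolutely continuous with respect to the
Lebesgue measure of `G_n`. -/
def HasAbsContMarginals (hF : IsSplitting F) (μ : Measure E) : Prop :=
  ∀ n, AbsContLebesgue (headMarginal hF μ n)

/-- The positivity condition: there is a point `Y = ∑ y_j e_j ∈ E` such that every `μ_{G_n}` charges
every ball of `G_n` around `π_{G_n} Y`, and such that for every `N` there is a radius `R_N > 0` for
which `μ` charges every ball of `E` around every point `x₀ ∈ G_N` with `‖x₀ - π_{G_N} Y‖ ≤ R_N`. -/
def HasPositivity (e : ℕ → E) (hF : IsSplitting F) (μ : Measure E) : Prop :=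
  ∃ (y : ℕ → ℝ) (Y : E), Tendsto (fun n => ∑ j ∈ Finset.range n, y j • e j) atTop (𝓝 Y) ∧
    (∀ n, ∀ δ > (0 : ℝ), 0 < headMarginal hF μ n (Metric.closedBall (headProj hF n Y) δ)) ∧
    ∀ N, ∃ R > (0 : ℝ), ∀ x₀ ∈ Metric.closedBall (headProj hF N Y) R, ∀ ε > (0 : ℝ),
      ∃ δ > (0 : ℝ), ENNReal.ofReal δ ≤ μ (Metric.closedBall (x₀ : E) ε)

end Decomposable

/-! ### Fractional Brownian motion and fractional Gaussian noise -/

section Noise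

variable {Ω : Type*} [MeasurableSpace Ω]

/-- `B` is a fractional Brownian motion with Hurst parameter `H`: a centered Gaussian process with
covariance `(t^{2H} + u^{2H} - |t - u|^{2H}) / 2`. -/
structure IsFractionalBrownianMotion (H : ℝ) (B : ℝ≥0 → Ω → ℝ) (P : Measure Ω) : Prop where
  gaussian : IsGaussianProcess B P
  centered : ∀ t, ∫ ω, B t ω ∂P = 0
  cov : ∀ t u : ℝ≥0, cov[B t, B u; P] =
    ((t : ℝ) ^ (2 * H) + (u : ℝ) ^ (2 * H) - |(t : ℝ) - u| ^ (2 * H)) / 2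

/-- `Z = ∫_0^1 φ(t) dB(t)`: the Riemann sums over the partitions `{k/n}` converge to `Z` in `L²(Ω)`. -/
def IsWienerIntegral (B : ℝ≥0 → Ω → ℝ) (P : Measure Ω) (φ : ℝ → ℝ) (Z : Ω → ℝ) : Prop :=
  MemLp Z 2 P ∧
  Tendsto (fun n : ℕ => eLpNorm (fun ω => Z ω - ∑ k ∈ Finset.range n,
      φ ((k : ℝ) / n) * (B (((k + 1 : ℕ) : ℝ≥0) / n) ω - B ((k : ℝ≥0) / n) ω)) 2 P)
    atTop (𝓝 0)

/-- `ξ` is a random distribution with values in `B^s_{2,2}(0,1)` and `⟨ξ, φ⟩ = ∫_0^1 φ dB` almost surely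
for all test functions `φ`, i.e. the noise `dB/dt` on `(0,1)`. -/
structure IsNoise {s : ℝ} (B : ℝ≥0 → Ω → ℝ) (P : Measure Ω) (ξ : Ω → Besov s) : Prop where
  aestronglyMeasurable : AEStronglyMeasurable ξ P
  pairing_eq : ∀ φ : 𝓓(unitIoo, ℝ), IsWienerIntegral B P φ (fun ω => pairing (ξ ω) φ)

end Noise

end FracNoise

end

noncomputable section

namespace FracNoise

/-! ### The kernel `|t|^{-1-α}` -/

/-! The argument has two halves: a Haar analysis of `E` and a Gaussian analysis of the law of the
noise.

Haar analysis. By duality, the norm of `E` is controlled by the norms `‖evalAt s φ‖` of test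
functions. By Plancherel these are the `H^{-s}` norms, equivalent to the `L²` norm plus the
Gagliardo seminorm with kernel `|t|^{-1+2s}`. Write `w_n = 2^{s j}` for a Haar function of level
`j`. The claim is that the norm of `∑ c_n e_n` is equivalent to the `ℓ²` norm of `(w_n c_n)`. The
upper bound (`exists_norm_sum_haarVec_le`) holds because a Haar coefficient is controlled by the
Gagliardo integrand on the product of the two halves of its support, and these rectangles are
disjoint in the plane. The lower bound (`exists_sum_haarWeight_le_norm`) tests against smoothed Haar
sums. Since Haar functions jump, their Gagliardo seminorm is finite only for `-s < 1/2`, and the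
needed bound is `exists_gagliardo_sum_smoothHaar_le`. With density, `E` is isomorphic to `ℓ²`
through the Haar system, which gives the Schauder basis and the splitting.

The noise. Fractional Brownian motion is a curve `X` in `L²(Ω)` with `‖X t - X u‖² = |t - u|^{2H}`.
Its Haar coefficients at level `j` have squared norm of order at most `2^{j(1-2H)}`, so `∑ ⟨dX, e_n⟩
e_n` converges in `L²(Ω; E)` when `s < H - 1` (`hasSum_haarSeries`). Parseval's identity turns the
pairing of this series with a functional `L` into the limit of `2^J ∑ ΔF ΔX` over dyadic intervals,
where `F t = L(1_{[0,t)})`. For a test function this is its Wiener integral.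

The law. It is centered Gaussian, as all functionals are `L²` limits of Gaussian variables. It is
also nondegenerate: up to a constant, norms of combinations of increments of `X` are Gagliardo
seminorms, with exponent `3 - 2H`, of piecewise linear functions. If `L(ξ) = 0`, Fatou's lemma makes
`F` constant, so `L` kills every Haar function and vanishes. A nondegenerate centered Gaussian
measure has full support, which yields the positivity condition with `Y = 0`, and its finite
dimensional images have densities. The kernels `l_n` are regular conditional laws. -/

/-- The homogeneous kernel `|t|^{-1-α}`. -/
def rieszKernel (α t : ℝ) : ℝ≥0∞ := ENNReal.ofReal (|t| ^ (-1 - α))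

@[fun_prop]
theorem measurable_rieszKernel (α : ℝ) : Measurable (rieszKernel α) := by
  unfold rieszKernel
  fun_prop

theorem lintegral_comp_mul_left_real (f : ℝ → ℝ≥0∞) {x : ℝ} (hx : x ≠ 0) :
    ∫⁻ t, f (x * t) = ENNReal.ofReal |x|⁻¹ * ∫⁻ t, f t := by
  have h := lintegral_map_equiv (μ := volume) f (Homeomorph.mulLeft₀ x hx).toMeasurableEquiv
  have h2 : Measure.map (Homeomorph.mulLeft₀ x hx).toMeasurableEquiv (volume : Measure ℝ)
      = ENNReal.ofReal |x⁻¹| • volume := Real.map_volume_mul_left hx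
  rw [h2, lintegral_smul_measure, abs_inv] at h
  simpa using h.symm

/-- Homogeneity of the measure `|t|^{-1-α} dt`. It extracts the factor `|ξ|^α` of a frequency in the
Fourier formula and the factor `2^{jσ}` of a Haar level. -/
theorem lintegral_rieszKernel_comp_mul (α : ℝ) (f : ℝ → ℝ≥0∞) {x : ℝ} (hx : x ≠ 0) :
    ∫⁻ t, rieszKernel α t * f (x * t) =
      ENNReal.ofReal (|x| ^ α) * ∫⁻ t, rieszKernel α t * f t := by
  have hx' : 0 < |x| := abs_pos.2 hx
  have h1 : ∀ t, rieszKernel α t * f (x * t) =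
      ENNReal.ofReal (|x| ^ (1 + α)) * (rieszKernel α (x * t) * f (x * t)) := by
    intro t
    rw [← mul_assoc]
    congr 1
    rw [rieszKernel, rieszKernel, ← ENNReal.ofReal_mul (by positivity), abs_mul,
      Real.mul_rpow (by positivity) (by positivity), ← mul_assoc, ← Real.rpow_add hx']
    ring_nf
    simp
  simp_rw [h1]
  rw [lintegral_const_mul' _ _ ENNReal.ofReal_ne_top,
    lintegral_comp_mul_left_real (fun t => rieszKernel α t * f t) hx, ← mul_assoc,
    ← ENNReal.ofReal_mul (by positivity)]
  congr 2
  rw [Real.rpow_add hx', Real.rpow_one]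
  field_simp

/-- Integrability at `0` comes from `α < β`, at infinity from `0 < α`. It is used with `β = 2` for
characters, `β = 1/2` for Haar functions and `β = 1` for ramps. -/
theorem lintegral_rieszKernel_mul_min_lt_top {α β : ℝ} (hα : 0 < α) (hαβ : α < β) :
    ∫⁻ t, rieszKernel α t * ENNReal.ofReal (min 1 (|t| ^ β)) < ∞ := by
  have key : IntegrableOn (fun t : ℝ => |t| ^ (-1 - α) * min 1 (|t| ^ β)) (Ioi 0) := by
    rw [← Ioc_union_Ioi_eq_Ioi (zero_le_one (α := ℝ))]
    refine IntegrableOn.union ?_ ?_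
    · have h : IntegrableOn (fun t : ℝ => t ^ (-1 - α + β)) (Ioc 0 1) := by
        rw [← intervalIntegrable_iff_integrableOn_Ioc_of_le zero_le_one]
        exact intervalIntegral.intervalIntegrable_rpow' (by linarith)
      refine h.congr_fun (fun t ht => ?_) measurableSet_Ioc
      simp only
      rw [abs_of_pos ht.1, min_eq_right (Real.rpow_le_one ht.1.le ht.2 (by linarith)),
        Real.rpow_add ht.1]
    · have h : IntegrableOn (fun t : ℝ => t ^ (-1 - α)) (Ioi 1) :=
        integrableOn_Ioi_rpow_of_lt (by linarith) one_pos
      refine h.congr_fun (fun t (ht : 1 < t) => ?_) measurableSet_Ioi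
      simp only
      rw [abs_of_pos (by linarith), min_eq_left (Real.one_le_rpow ht.le (by linarith)), mul_one]
  have key2 : Integrable (fun t : ℝ => |t| ^ (-1 - α) * min 1 (|t| ^ β)) := by
    rw [← integrableOn_univ, ← Iic_union_Ioi (a := (0 : ℝ))]
    refine IntegrableOn.union ?_ key
    rw [integrableOn_Iic_iff_integrableOn_Iio]
    have := ((Measure.measurePreserving_neg (volume : Measure ℝ)).integrableOn_comp_preimage
      (Homeomorph.neg ℝ).measurableEmbedding
      (f := fun t : ℝ => |t| ^ (-1 - α) * min 1 (|t| ^ β)) (s := Ioi 0)).2 key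
    have hs : (fun x : ℝ => -x) ⁻¹' Ioi 0 = Iio 0 := by ext; simp
    rw [← hs]
    exact this.congr_fun (fun t _ => by simp) (measurableSet_Ioi.preimage measurable_neg)
  have h := key2.lintegral_lt_top
  refine lt_of_le_of_lt (lintegral_mono fun t => ?_) h
  rw [rieszKernel, ← ENNReal.ofReal_mul (by positivity)]

/-- The constant `∫ |t|^{-1-α} |e^{2πit} - 1|² dt`. -/
def gagliardoConst (α : ℝ) : ℝ≥0∞ :=
  ∫⁻ t, rieszKernel α t * ‖((Real.fourierChar t : Circle) : ℂ) - 1‖ₑ ^ 2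

theorem norm_fourierChar_sub_one_sq_le (t : ℝ) :
    ‖((Real.fourierChar t : Circle) : ℂ) - 1‖ ^ 2 ≤ 40 * min 1 (|t| ^ (2 : ℝ)) := by
  have h1 : ‖((Real.fourierChar t : Circle) : ℂ) - 1‖ ≤ 2 := by
    refine (norm_sub_le _ _).trans ?_
    rw [Circle.norm_coe]; norm_num
  have h2 : ‖((Real.fourierChar t : Circle) : ℂ) - 1‖ ≤ 2 * Real.pi * |t| := by
    have := Real.norm_exp_I_mul_ofReal_sub_one_le (x := 2 * Real.pi * t)
    rw [Real.fourierChar_apply, mul_comm _ Complex.I]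
    refine this.trans ?_
    rw [Real.norm_eq_abs, abs_mul, abs_of_pos (by positivity : 0 < 2 * Real.pi)]
  -- The constant `40` exceeds both `2²` and `(2π)² < 6.3²`.
  have hpi : Real.pi < 3.15 := Real.pi_lt_d2
  have hpi0 := Real.pi_pos
  rw [Real.rpow_two, mul_min_of_nonneg _ _ (by norm_num)]
  refine le_min ?_ ?_
  · nlinarith [norm_nonneg (((Real.fourierChar t : Circle) : ℂ) - 1)]
  · refine (pow_le_pow_left₀ (norm_nonneg _) h2 2).trans ?_
    rw [mul_pow]
    gcongr
    nlinarith

theorem gagliardoConst_lt_top {α : ℝ} (hα : 0 < α) (hα2 : α < 2) : gagliardoConst α < ∞ := by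
  refine lt_of_le_of_lt (b := ∫⁻ t, ENNReal.ofReal 40 *
    (rieszKernel α t * ENNReal.ofReal (min 1 (|t| ^ (2 : ℝ))))) (lintegral_mono fun t => ?_) ?_
  · rw [mul_left_comm, ← ENNReal.ofReal_mul (by norm_num), ← ofReal_norm,
      ← ENNReal.ofReal_pow (norm_nonneg _)]
    gcongr
    exact norm_fourierChar_sub_one_sq_le t
  · rw [lintegral_const_mul' _ _ ENNReal.ofReal_ne_top]
    exact ENNReal.mul_lt_top ENNReal.ofReal_lt_top (lintegral_rieszKernel_mul_min_lt_top hα hα2)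

theorem gagliardoConst_pos (α : ℝ) : 0 < gagliardoConst α := by
  have hm : Measurable fun t => rieszKernel α t * ‖((Real.fourierChar t : Circle) : ℂ) - 1‖ₑ ^ 2 := by
    have : Continuous fun t : ℝ => ((Real.fourierChar t : Circle) : ℂ) := by fun_prop
    have := this.measurable
    fun_prop
  rw [gagliardoConst, lintegral_pos_iff_support hm]
  refine lt_of_lt_of_le (b := volume (Ioo (0 : ℝ) 1)) (by simp) (measure_mono fun t ht => ?_)
  rw [Function.mem_support, mul_ne_zero_iff]
  refine ⟨?_, ?_⟩
  · rw [rieszKernel, Ne, ENNReal.ofReal_eq_zero, not_le]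
    have : 0 < |t| := abs_pos.2 ht.1.ne'
    positivity
  · refine pow_ne_zero _ ?_
    rw [Ne, enorm_eq_zero, sub_eq_zero, Real.fourierChar_apply, Complex.exp_eq_one_iff]
    rintro ⟨n, hn⟩
    have h2 : (t : ℂ) = n := by
      have : (2 * Real.pi * Complex.I : ℂ) ≠ 0 := Complex.two_pi_I_ne_zero
      apply mul_left_cancel₀ this
      push_cast at hn
      linear_combination hn
    have h3 : t = n := by exact_mod_cast h2
    rw [h3] at ht
    have h4 : (0 : ℤ) < n := by exact_mod_cast ht.1
    have h5 : n < (1 : ℤ) := by exact_mod_cast ht.2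
    omega

/-! ### Plancherel and the Gagliardo seminorm -/

theorem SchwartzMap.lintegral_enorm_sq_fourier (f : 𝓢(ℝ, ℂ)) :
    ∫⁻ ξ, ‖FourierTransform.fourier f ξ‖ₑ ^ 2 = ∫⁻ x, ‖f x‖ₑ ^ 2 := by
  have key : ∀ g : 𝓢(ℝ, ℂ), ∫⁻ x, ‖g x‖ₑ ^ 2 = ENNReal.ofReal (∫ x, ‖g x‖ ^ 2) := by
    intro g
    rw [ofReal_integral_eq_lintegral_ofReal]
    · refine lintegral_congr fun x => ?_
      rw [← ofReal_norm, ← ENNReal.ofReal_pow (norm_nonneg _)]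
    · exact (g.memLp 2).integrable_norm_pow (by norm_num)
    · exact ae_of_all _ fun x => by positivity
  rw [key, key, SchwartzMap.integral_norm_sq_fourier]

theorem SchwartzMap.fourier_compSubConst (f : 𝓢(ℝ, ℂ)) (t ξ : ℝ) :
    FourierTransform.fourier (f.compSubConstCLM ℂ t) ξ =
      ((Real.fourierChar (-t * ξ) : Circle) : ℂ) * FourierTransform.fourier f ξ := by
  rw [SchwartzMap.fourier_coe, SchwartzMap.fourier_coe]
  have h : ⇑(f.compSubConstCLM ℂ t) = (⇑f) ∘ (fun x => x + -t) := by
    ext x; simp [SchwartzMap.compSubConstCLM_apply, sub_eq_add_neg]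
  rw [h]
  have := congrFun (VectorFourier.fourierIntegral_comp_add_right Real.fourierChar volume
    (innerₗ ℝ) (⇑f) (-t)) ξ
  refine this.trans ?_
  rw [Circle.smul_def, smul_eq_mul]
  congr 3
  simp [mul_comm]

theorem SchwartzMap.lintegral_enorm_sub_translate_sq (f : 𝓢(ℝ, ℂ)) (t : ℝ) :
    ∫⁻ x, ‖f (x - t) - f x‖ₑ ^ 2 =
      ∫⁻ ξ, ‖((Real.fourierChar (-ξ * t) : Circle) : ℂ) - 1‖ₑ ^ 2 *
        ‖FourierTransform.fourier f ξ‖ₑ ^ 2 := by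
  have := SchwartzMap.lintegral_enorm_sq_fourier (f.compSubConstCLM ℂ t - f)
  simp only [_root_.sub_apply, SchwartzMap.compSubConstCLM_apply] at this
  rw [← this]
  refine lintegral_congr fun ξ => ?_
  have hsub : FourierTransform.fourier (f.compSubConstCLM ℂ t - f) =
      FourierTransform.fourier (f.compSubConstCLM ℂ t) - FourierTransform.fourier f :=
    map_sub (FourierTransform.fourierCLM ℂ 𝓢(ℝ, ℂ)) _ _
  rw [← mul_pow, ← enorm_mul, hsub, _root_.sub_apply, SchwartzMap.fourier_compSubConst]
  congr 2
  rw [show -t * ξ = -ξ * t by ring]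
  ring

/-- The Gagliardo seminorm in terms of the Fourier transform. -/
theorem SchwartzMap.lintegral_gagliardo (f : 𝓢(ℝ, ℂ)) (α : ℝ) :
    ∫⁻ t, rieszKernel α t * ∫⁻ x, ‖f (x - t) - f x‖ₑ ^ 2 =
      gagliardoConst α *
        ∫⁻ ξ, ENNReal.ofReal (|ξ| ^ α) * ‖FourierTransform.fourier f ξ‖ₑ ^ 2 := by
  have hc : Continuous fun p : ℝ × ℝ => ((Real.fourierChar (-p.2 * p.1) : Circle) : ℂ) := by fun_prop
  have hc := hc.measurable
  have hf : Measurable fun ξ => FourierTransform.fourier f ξ := by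
    exact (FourierTransform.fourier f).continuous.measurable
  simp_rw [SchwartzMap.lintegral_enorm_sub_translate_sq]
  calc _ = ∫⁻ t, ∫⁻ ξ, rieszKernel α t * (‖((Real.fourierChar (-ξ * t) : Circle) : ℂ) - 1‖ₑ ^ 2 *
        ‖FourierTransform.fourier f ξ‖ₑ ^ 2) := by
        refine lintegral_congr fun t => ?_
        exact (lintegral_const_mul' _ _ ENNReal.ofReal_ne_top).symm
    _ = ∫⁻ ξ, ∫⁻ t, rieszKernel α t * (‖((Real.fourierChar (-ξ * t) : Circle) : ℂ) - 1‖ₑ ^ 2 *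
        ‖FourierTransform.fourier f ξ‖ₑ ^ 2) := by
        rw [lintegral_lintegral_swap]
        refine Measurable.aemeasurable ?_
        simp only [Function.uncurry_def]
        have h1 : Measurable fun p : ℝ × ℝ => rieszKernel α p.1 :=
          (measurable_rieszKernel α).comp measurable_fst
        have h2 : Measurable fun p : ℝ × ℝ => FourierTransform.fourier f p.2 :=
          hf.comp measurable_snd
        fun_prop
    _ = _ := by
        rw [← lintegral_const_mul _ (by fun_prop)]
        refine lintegral_congr_ae ?_
        -- The scaling identity needs a nonzero factor; the frequency `0` is a null set.
        filter_upwards [compl_mem_ae_iff.2 (measure_singleton (0 : ℝ))] with ξ hξ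
        have hξ : ξ ≠ 0 := hξ
        simp_rw [← mul_assoc]
        rw [lintegral_mul_const' _ _ (by finiteness),
          lintegral_rieszKernel_comp_mul α
            (fun t => ‖((Real.fourierChar t : Circle) : ℂ) - 1‖ₑ ^ 2) (neg_ne_zero.2 hξ), abs_neg,
          gagliardoConst, mul_comm (ENNReal.ofReal _)]

/-! ### The dual norm of a test function -/

@[simp]
theorem testToSchwartz_apply (φ : 𝓓(unitIoo, ℝ)) (x : ℝ) : testToSchwartz φ x = (φ x : ℂ) := rfl

/-- The Schwartz function `𝓕 ((1 + |ξ|²)^{-s/2} 𝓕⁻¹ φ)`. -/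
def besselTest (s : ℝ) (f : 𝓢(ℝ, ℂ)) : 𝓢(ℝ, ℂ) :=
  FourierTransform.fourier (SchwartzMap.smulLeftCLM ℂ
    (fun x : ℝ => (((1 + ‖x‖ ^ 2) ^ (-s / 2) : ℝ) : ℂ)) (FourierTransformInv.fourierInv f))

theorem sobolevOfL2_apply (s : ℝ) (g : Lp ℂ 2 (volume : Measure ℝ)) (f : 𝓢(ℝ, ℂ)) :
    sobolevOfL2 s g f = ∫ x, besselTest s f x * g x := by
  change TemperedDistribution.fourierMultiplierCLM ℂ
    (fun x : ℝ => (((1 + ‖x‖ ^ 2) ^ (-s / 2) : ℝ) : ℂ)) (Lp.toTemperedDistribution g) f = _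
  rw [TemperedDistribution.fourierMultiplierCLM_apply_apply]
  exact Lp.toTemperedDistribution_apply g _

theorem norm_Lp_star (k : Lp ℂ 2 (volume : Measure ℝ)) : ‖star k‖ = ‖k‖ := by
  rw [Lp.norm_def, Lp.norm_def]
  congr 1
  refine eLpNorm_congr_norm_ae ?_
  filter_upwards [Lp.coeFn_star k] with x hx
  rw [hx, Pi.star_apply, norm_star]

/-- `evalAt s φ` is the real part of the inner product with the conjugate of `besselTest s φ`.
Cauchy–Schwarz gives one inequality, evaluation at that conjugate the other. -/
theorem norm_evalAt (s : ℝ) (φ : 𝓓(unitIoo, ℝ)) :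
    ‖evalAt s φ‖ = ‖(besselTest s (testToSchwartz φ)).toLp 2 volume‖ := by
  set k := (besselTest s (testToSchwartz φ)).toLp 2 volume with hk
  have hke : k =ᵐ[volume] besselTest s (testToSchwartz φ) := SchwartzMap.coeFn_toLp _ _ _
  have hev : ∀ g, evalAt s φ g = (inner ℂ (star k) g).re := by
    intro g
    rw [evalAt_apply, sobolevOfL2_apply, L2.inner_def]
    congr 1
    refine integral_congr_ae ?_
    filter_upwards [hke, Lp.coeFn_star k] with x hx hx2
    rw [hx2, Pi.star_apply, hx]
    simp [mul_comm]
  refine le_antisymm ?_ ?_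
  · refine ContinuousLinearMap.opNorm_le_bound _ (norm_nonneg _) fun g => ?_
    rw [hev, Real.norm_eq_abs]
    refine (Complex.abs_re_le_norm _).trans ((norm_inner_le_norm _ _).trans_eq ?_)
    rw [norm_Lp_star]
  · have h := (evalAt s φ).le_opNorm (star k)
    rw [hev, norm_Lp_star] at h
    have h2 : (inner ℂ (star k) (star k)).re = ‖k‖ ^ 2 := by
      rw [← norm_Lp_star k]
      exact_mod_cast congrArg Complex.re (inner_self_eq_norm_sq_to_K (𝕜 := ℂ) (star k))
    rw [h2, Real.norm_eq_abs, abs_of_nonneg (by positivity), pow_two] at h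
    rcases (norm_nonneg k).eq_or_lt with h0 | h0
    · rw [← h0]; exact norm_nonneg _
    · exact le_of_mul_le_mul_right h h0

theorem ofReal_norm_evalAt_sq (s : ℝ) (φ : 𝓓(unitIoo, ℝ)) :
    ENNReal.ofReal (‖evalAt s φ‖ ^ 2) = ∫⁻ ξ, ENNReal.ofReal ((1 + ξ ^ 2) ^ (-s)) *
      ‖FourierTransform.fourier (testToSchwartz φ) ξ‖ₑ ^ 2 := by
  rw [norm_evalAt, SchwartzMap.norm_toLp, ENNReal.ofReal_pow ENNReal.toReal_nonneg,
    ENNReal.ofReal_toReal (SchwartzMap.memLp _ 2 volume).eLpNorm_ne_top,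
    eLpNorm_eq_lintegral_rpow_enorm_toReal (by norm_num) (by norm_num)]
  simp only [ENNReal.toReal_ofNat, ENNReal.rpow_ofNat]
  rw [← ENNReal.rpow_two, ← ENNReal.rpow_mul]
  simp only [one_div, ne_eq, OfNat.ofNat_ne_zero, not_false_eq_true, inv_mul_cancel₀,
    ENNReal.rpow_one]
  rw [besselTest, SchwartzMap.lintegral_enorm_sq_fourier,
    ← one_mul (∫⁻ ξ, ENNReal.ofReal ((1 + ξ ^ 2) ^ (-s)) *
      ‖FourierTransform.fourier (testToSchwartz φ) ξ‖ₑ ^ 2)]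
  -- `besselTest` involves the inverse Fourier transform, which is the Fourier transform reflected
  -- at the origin; the weight is even.
  have hneg := lintegral_comp_mul_left_real (fun ξ => ENNReal.ofReal ((1 + ξ ^ 2) ^ (-s)) *
      ‖FourierTransform.fourier (testToSchwartz φ) ξ‖ₑ ^ 2) (x := -1) (by norm_num)
  simp only [abs_neg, abs_one, inv_one, ENNReal.ofReal_one] at hneg
  rw [← hneg]
  refine lintegral_congr fun ξ => ?_
  rw [SchwartzMap.smulLeftCLM_apply_apply (by fun_prop), smul_eq_mul, enorm_mul, mul_pow]
  congr 1
  · rw [← ofReal_norm, ← ENNReal.ofReal_pow (norm_nonneg _), Complex.norm_real, Real.norm_eq_abs,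
      abs_of_nonneg (by positivity), ← Real.rpow_mul_natCast (by positivity)]
    simp
  · congr 2
    rw [SchwartzMap.fourierInv_coe, SchwartzMap.fourier_coe, Real.fourierInv_eq_fourier_neg]
    simp

theorem enorm_testToSchwartz_sub (φ : 𝓓(unitIoo, ℝ)) (x y : ℝ) :
    ‖testToSchwartz φ x - testToSchwartz φ y‖ₑ = ‖φ x - φ y‖ₑ := by
  rw [testToSchwartz_apply, testToSchwartz_apply, ← Complex.ofReal_sub, ← ofReal_norm,
    ← ofReal_norm, Complex.norm_real]

/-- The square of the Gagliardo seminorm with the kernel `|t|^{-1-α}`. -/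
def gagliardo (α : ℝ) (f : ℝ → ℝ) : ℝ≥0∞ :=
  ∫⁻ t, rieszKernel α t * ∫⁻ x, ‖f (x - t) - f x‖ₑ ^ 2

theorem gagliardo_eq (α : ℝ) (φ : 𝓓(unitIoo, ℝ)) :
    gagliardo α φ = gagliardoConst α * ∫⁻ ξ, ENNReal.ofReal (|ξ| ^ α) *
      ‖FourierTransform.fourier (testToSchwartz φ) ξ‖ₑ ^ 2 := by
  rw [← SchwartzMap.lintegral_gagliardo]
  simp_rw [enorm_testToSchwartz_sub, gagliardo]

theorem lintegral_sq_eq_fourier (φ : 𝓓(unitIoo, ℝ)) :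
    ∫⁻ x, ‖φ x‖ₑ ^ 2 = ∫⁻ ξ, ‖FourierTransform.fourier (testToSchwartz φ) ξ‖ₑ ^ 2 := by
  rw [SchwartzMap.lintegral_enorm_sq_fourier]
  refine lintegral_congr fun x => ?_
  rw [testToSchwartz_apply, ← ofReal_norm, ← ofReal_norm, Complex.norm_real]

theorem lintegral_sq_le_norm_evalAt {s : ℝ} (hs : s ≤ 0) (φ : 𝓓(unitIoo, ℝ)) :
    ∫⁻ x, ‖φ x‖ₑ ^ 2 ≤ ENNReal.ofReal (‖evalAt s φ‖ ^ 2) := by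
  rw [lintegral_sq_eq_fourier, ofReal_norm_evalAt_sq]
  refine lintegral_mono fun ξ => ?_
  refine le_mul_of_one_le_left' ?_
  rw [ENNReal.one_le_ofReal]
  exact Real.one_le_rpow (by nlinarith [sq_nonneg ξ]) (by linarith)

theorem abs_rpow_two_mul (ξ r : ℝ) : |ξ| ^ (2 * r) = (ξ ^ 2) ^ r := by
  rw [Real.rpow_mul (abs_nonneg _), Real.rpow_two, sq_abs]

theorem gagliardo_le_norm_evalAt {s : ℝ} (hs : s ≤ 0) (φ : 𝓓(unitIoo, ℝ)) :
    gagliardo (2 * -s) φ ≤ gagliardoConst (2 * -s) * ENNReal.ofReal (‖evalAt s φ‖ ^ 2) := by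
  rw [gagliardo_eq, ofReal_norm_evalAt_sq]
  gcongr with ξ
  rw [abs_rpow_two_mul]
  gcongr
  · linarith
  · linarith

/-- The power `-s ≤ 1` is subadditive, so `(1 + ξ²)^{-s} ≤ 1 + |ξ|^{-2s}`. Together with the two
preceding bounds this identifies the dual norm with `L²` plus Gagliardo, up to constants. -/
theorem norm_evalAt_le {s : ℝ} (hs : s < 0) (hs1 : -1 < s) (φ : 𝓓(unitIoo, ℝ)) :
    ENNReal.ofReal (‖evalAt s φ‖ ^ 2) ≤
      (∫⁻ x, ‖φ x‖ₑ ^ 2) + (gagliardoConst (2 * -s))⁻¹ * gagliardo (2 * -s) φ := by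
  have hm : Measurable fun ξ => FourierTransform.fourier (testToSchwartz φ) ξ :=
    (FourierTransform.fourier (testToSchwartz φ)).continuous.measurable
  rw [gagliardo_eq, ofReal_norm_evalAt_sq, lintegral_sq_eq_fourier, ← mul_assoc,
    ENNReal.inv_mul_cancel (gagliardoConst_pos _).ne'
      (gagliardoConst_lt_top (by linarith) (by linarith)).ne, one_mul,
    ← lintegral_add_left (by fun_prop)]
  refine lintegral_mono fun ξ => ?_
  rw [← one_add_mul]
  gcongr
  rw [← ENNReal.ofReal_one, ← ENNReal.ofReal_add zero_le_one (by positivity), abs_rpow_two_mul]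
  refine ENNReal.ofReal_le_ofReal ?_
  have := Real.rpow_add_le_add_rpow (p := -s) zero_le_one (sq_nonneg ξ) (by linarith) (by linarith)
  simpa using this

/-! ### Duality -/

theorem evalAt_add (s : ℝ) (φ ψ : 𝓓(unitIoo, ℝ)) : evalAt s (φ + ψ) = evalAt s φ + evalAt s ψ := by
  ext g
  have h : testToSchwartz (φ + ψ) = testToSchwartz φ + testToSchwartz ψ := by
    ext x; simp
  simp [evalAt_apply, h]

theorem evalAt_smul (s : ℝ) (c : ℝ) (φ : 𝓓(unitIoo, ℝ)) : evalAt s (c • φ) = c • evalAt s φ := by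
  ext g
  have h : testToSchwartz (c • φ) = (c : ℂ) • testToSchwartz φ := by
    ext x; simp
  have h2 : sobolevOfL2 s g ((c : ℂ) • testToSchwartz φ) =
    (c : ℂ) • sobolevOfL2 s g (testToSchwartz φ) := map_smul _ _ _
  rw [evalAt_apply, h, h2]
  simp [evalAt_apply]

/-- The Riesz representative of `evalAt s φ`, as a linear map in `φ`. -/
def evalRiesz (s : ℝ) : 𝓓(unitIoo, ℝ) →ₗ[ℝ] Lp ℂ 2 (volume : Measure ℝ) where
  toFun φ := (InnerProductSpace.toDual ℝ (Lp ℂ 2 (volume : Measure ℝ))).symm (evalAt s φ)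
  map_add' φ ψ := by rw [evalAt_add, map_add]
  map_smul' c φ := by rw [evalAt_smul, LinearIsometryEquiv.map_smulₛₗ]; simp

theorem norm_evalRiesz (s : ℝ) (φ : 𝓓(unitIoo, ℝ)) : ‖evalRiesz s φ‖ = ‖evalAt s φ‖ :=
  (InnerProductSpace.toDual ℝ (Lp ℂ 2 (volume : Measure ℝ))).symm.norm_map (evalAt s φ)

theorem inner_evalRiesz (s : ℝ) (φ : 𝓓(unitIoo, ℝ)) (g : Lp ℂ 2 (volume : Measure ℝ)) :
    inner ℝ (evalRiesz s φ) g = evalAt s φ g := InnerProductSpace.toDual_symm_apply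

/-- The pairing with a test function as a continuous functional on the Besov space. -/
def pairingL {s : ℝ} (φ : 𝓓(unitIoo, ℝ)) : Besov s →L[ℝ] ℝ :=
  ⟨(vanishing s).liftQ (evalAt s φ).toLinearMap (fun g hg => (mem_vanishing s g).1 hg φ),
    (evalAt s φ).continuous.quotient_lift _⟩

@[simp]
theorem pairingL_apply {s : ℝ} (u : Besov s) (φ : 𝓓(unitIoo, ℝ)) : pairingL φ u = pairing u φ := rfl

/-- The class of `g ∈ L²(ℝ)` in the Besov space. -/
def ofL2 (s : ℝ) : Lp ℂ 2 (volume : Measure ℝ) →L[ℝ] Besov s :=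
  ⟨(vanishing s).mkQ, continuous_quot_mk⟩

theorem pairing_ofL2 (s : ℝ) (g : Lp ℂ 2 (volume : Measure ℝ)) (φ : 𝓓(unitIoo, ℝ)) :
    pairing (ofL2 s g) φ = evalAt s φ g := rfl

theorem norm_ofL2_le (s : ℝ) (g : Lp ℂ 2 (volume : Measure ℝ)) : ‖ofL2 s g‖ ≤ ‖g‖ :=
  Submodule.Quotient.norm_mk_le _ g

theorem ofL2_surjective (s : ℝ) : Function.Surjective (ofL2 s) := Submodule.mkQ_surjective _

theorem abs_pairing_le {s : ℝ} (u : Besov s) (φ : 𝓓(unitIoo, ℝ)) :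
    |pairing u φ| ≤ ‖u‖ * ‖evalAt s φ‖ := by
  refine le_of_forall_pos_le_add fun ε hε => ?_
  obtain ⟨g, hg, hgn⟩ := Submodule.Quotient.norm_mk_lt (S := vanishing s) u
    (ε := ε / (‖evalAt s φ‖ + 1)) (by positivity)
  have h1 : pairing u φ = evalAt s φ g := by rw [← hg]; rfl
  rw [h1, ← Real.norm_eq_abs]
  refine ((evalAt s φ).le_opNorm g).trans ?_
  have h2 : ‖evalAt s φ‖ * ‖g‖ ≤ ‖evalAt s φ‖ * (‖u‖ + ε / (‖evalAt s φ‖ + 1)) :=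
    mul_le_mul_of_nonneg_left hgn.le (norm_nonneg _)
  refine h2.trans ?_
  rw [mul_add, mul_comm]
  gcongr
  rw [mul_div_assoc', div_le_iff₀ (by positivity)]
  nlinarith [norm_nonneg (evalAt s φ)]

/-- A linear functional on test functions which is bounded in the dual norm is an element of the
Besov space. -/
theorem exists_pairing_eq (s : ℝ) (L : 𝓓(unitIoo, ℝ) →ₗ[ℝ] ℝ) {C : ℝ} (hC : 0 ≤ C)
    (hL : ∀ φ, |L φ| ≤ C * ‖evalAt s φ‖) :
    ∃ u : Besov s, ‖u‖ ≤ C ∧ ∀ φ, pairing u φ = L φ := by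
  -- The bound makes `L` factor through the Riesz map `evalRiesz`. It then lives on the range of
  -- that map, extends to all of `L²` by Hahn–Banach without increasing the norm, and the vector
  -- representing the extension gives `u`.
  have hwd : ∀ φ ψ, evalRiesz s φ = evalRiesz s ψ → L φ = L ψ := by
    intro φ ψ h
    rw [← sub_eq_zero, ← map_sub]
    have := hL (φ - ψ)
    have h2 : evalRiesz s (φ - ψ) = 0 := by
      have h3 : evalRiesz s (φ - ψ) = evalRiesz s φ - evalRiesz s ψ := map_sub _ _ _
      rw [h3, h, sub_self]
    rw [← norm_evalRiesz, h2, norm_zero, mul_zero] at this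
    exact abs_nonpos_iff.1 this
  have hch : ∀ y : (evalRiesz s).range, evalRiesz s y.2.choose = y := fun y => y.2.choose_spec
  let L' : (evalRiesz s).range →ₗ[ℝ] ℝ :=
    { toFun := fun y => L y.2.choose
      map_add' := fun y z => by
        rw [← map_add]
        refine hwd _ _ ?_
        rw [hch, map_add, hch, hch]
        rfl
      map_smul' := fun c y => by
        rw [RingHom.id_apply, ← map_smul]
        refine hwd _ _ ?_
        rw [hch, map_smul, hch]
        rfl }
  have hL' : ∀ φ, L' ((evalRiesz s).rangeRestrict φ) = L φ := fun φ => hwd _ _ (hch _)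
  have hbd : ∀ y, ‖L' y‖ ≤ C * ‖y‖ := by
    rintro ⟨_, φ, rfl⟩
    have h1 := hL' φ
    have h2 := hL φ
    rw [← h1, ← norm_evalRiesz] at h2
    exact h2
  obtain ⟨G, hG, hGn⟩ := exists_extension_norm_eq (𝕜 := ℝ) _ (L'.mkContinuous C hbd)
  let j := InnerProductSpace.toDual ℝ (Lp ℂ 2 (volume : Measure ℝ))
  refine ⟨ofL2 s (j.symm G), (norm_ofL2_le s _).trans ?_, fun φ => ?_⟩
  · rw [LinearIsometryEquiv.norm_map]
    exact hGn.trans_le (LinearMap.mkContinuous_norm_le _ hC _)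
  · rw [pairing_ofL2, ← inner_evalRiesz, real_inner_comm]
    have h1 : inner ℝ (j.symm G) (evalRiesz s φ) = G (evalRiesz s φ) :=
      InnerProductSpace.toDual_symm_apply
    have := hG ((evalRiesz s).rangeRestrict φ)
    exact h1.trans (this.trans (hL' φ))

/-! ### Haar coefficients of a measure given by its distribution function -/

section HaarCoef

variable {M : Type*} [AddCommGroup M] [Module ℝ M]

/-- The dyadic point `k 2^{-j}`. -/
def dyadic (j k : ℕ) : ℝ := (k : ℝ) / 2 ^ j

theorem dyadic_two_mul (j k : ℕ) : dyadic (j + 1) (2 * k) = dyadic j k := by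
  simp only [dyadic]; push_cast; rw [pow_succ]; field_simp

theorem dyadic_nonneg (j k : ℕ) : 0 ≤ dyadic j k := by unfold dyadic; positivity

theorem dyadic_mono (j : ℕ) {k l : ℕ} (h : k ≤ l) : dyadic j k ≤ dyadic j l := by
  unfold dyadic; gcongr

theorem dyadic_le_one {j k : ℕ} (h : k ≤ 2 ^ j) : dyadic j k ≤ 1 := by
  unfold dyadic
  rw [div_le_one (by positivity)]
  exact_mod_cast h

theorem dyadic_two_pow (j : ℕ) : dyadic j (2 ^ j) = 1 := by
  simp [dyadic]

@[simp]
theorem dyadic_zero_right (j : ℕ) : dyadic j 0 = 0 := by simp [dyadic]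

/-- The increment of `G` over the dyadic interval `[k 2^{-j}, (k+1) 2^{-j}]`. -/
def dyadicIncr (j k : ℕ) (G : ℝ → M) : M := G (dyadic j (k + 1)) - G (dyadic j k)

omit [Module ℝ M] in
theorem dyadicIncr_split (j k : ℕ) (G : ℝ → M) :
    dyadicIncr j k G = dyadicIncr (j + 1) (2 * k) G + dyadicIncr (j + 1) (2 * k + 1) G := by
  simp only [dyadicIncr, show 2 * k + 1 + 1 = 2 * (k + 1) by ring, dyadic_two_mul]
  abel

/-- The Haar coefficient `∫ haar n dG`. -/
def haarCoef (n : ℕ) (G : ℝ → M) : M :=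
  if n = 0 then G 1 - G 0 else
    ((2 : ℝ) ^ ((Nat.log 2 n : ℝ) / 2)) •
      (dyadicIncr (Nat.log 2 n + 1) (2 * (n - 2 ^ Nat.log 2 n)) G -
        dyadicIncr (Nat.log 2 n + 1) (2 * (n - 2 ^ Nat.log 2 n) + 1) G)

theorem log_two_pow_add {j k : ℕ} (hk : k < 2 ^ j) : Nat.log 2 (2 ^ j + k) = j := by
  rw [Nat.log_eq_iff (Or.inr ⟨by norm_num, by positivity⟩)]
  constructor
  · omega
  · rw [pow_succ]; omega

theorem exists_two_pow_add {n : ℕ} (hn : n ≠ 0) : ∃ j k, k < 2 ^ j ∧ n = 2 ^ j + k := by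
  refine ⟨Nat.log 2 n, n - 2 ^ Nat.log 2 n, ?_, ?_⟩
  · have := Nat.lt_pow_succ_log_self (b := 2) (by norm_num) n
    have h2 := Nat.pow_log_le_self 2 hn
    rw [pow_succ] at this
    omega
  · have h2 := Nat.pow_log_le_self 2 hn
    omega

@[simp]
theorem haarCoef_zero (G : ℝ → M) : haarCoef 0 G = G 1 - G 0 := by simp [haarCoef]

theorem haarCoef_two_pow_add {j k : ℕ} (hk : k < 2 ^ j) (G : ℝ → M) :
    haarCoef (2 ^ j + k) G = ((2 : ℝ) ^ ((j : ℝ) / 2)) •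
      (dyadicIncr (j + 1) (2 * k) G - dyadicIncr (j + 1) (2 * k + 1) G) := by
  have h0 : 2 ^ j + k ≠ 0 := by positivity
  rw [haarCoef, if_neg h0, log_two_pow_add hk, Nat.add_sub_cancel_left]

theorem haarCoef_map {M' : Type*} [AddCommGroup M'] [Module ℝ M'] (L : M →ₗ[ℝ] M') (n : ℕ)
    (G : ℝ → M) : haarCoef n (fun t => L (G t)) = L (haarCoef n G) := by
  unfold haarCoef dyadicIncr
  split_ifs <;> simp

theorem sum_range_two_mul {A : Type*} [AddCommMonoid A] (f : ℕ → A) (m : ℕ) :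
    ∑ i ∈ Finset.range (2 * m), f i = ∑ k ∈ Finset.range m, (f (2 * k) + f (2 * k + 1)) := by
  induction m with
  | zero => simp
  | succ m ih =>
    rw [show 2 * (m + 1) = 2 * m + 1 + 1 by ring, Finset.sum_range_succ, Finset.sum_range_succ, ih,
      Finset.sum_range_succ, add_assoc]

theorem two_rpow_half_sq (j : ℕ) : (2 : ℝ) ^ ((j : ℝ) / 2) * (2 : ℝ) ^ ((j : ℝ) / 2) = 2 ^ j := by
  rw [← Real.rpow_add (by norm_num)]
  simp

/-- Parseval's identity for the Haar system. -/
theorem sum_haarCoef_smul (J : ℕ) (F : ℝ → ℝ) (G : ℝ → M) :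
    ∑ n ∈ Finset.range (2 ^ J), haarCoef n F • haarCoef n G =
      (2 : ℝ) ^ J • ∑ k ∈ Finset.range (2 ^ J), dyadicIncr J k F • dyadicIncr J k G := by
  induction J with
  | zero => simp [dyadicIncr, dyadic]
  | succ J ih =>
    have hL : 2 ^ (J + 1) = 2 ^ J + 2 ^ J := by ring
    conv_lhs => rw [hL, Finset.sum_range_add, ih]
    rw [show 2 ^ (J + 1) = 2 * 2 ^ J by ring, sum_range_two_mul, Finset.smul_sum,
      Finset.smul_sum, ← Finset.sum_add_distrib]
    refine Finset.sum_congr rfl fun k hk => ?_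
    rw [haarCoef_two_pow_add (Finset.mem_range.1 hk), haarCoef_two_pow_add (Finset.mem_range.1 hk),
      dyadicIncr_split J k F, dyadicIncr_split J k G, smul_smul, smul_eq_mul]
    -- What remains is `(a + b)(x + y) + (a - b)(x - y) = 2(a x + b y)`: the details of level `J`
    -- refine the increments once.
    generalize dyadicIncr (J + 1) (2 * k) F = a
    generalize dyadicIncr (J + 1) (2 * k + 1) F = b
    generalize dyadicIncr (J + 1) (2 * k) G = x
    generalize dyadicIncr (J + 1) (2 * k + 1) G = y
    rw [smul_smul (_ * (a - b)), mul_right_comm, two_rpow_half_sq, pow_succ]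
    module

end HaarCoef

/-! ### The Haar functions -/

theorem haarScaling_eq : haarScaling = (Ico (0 : ℝ) 1).indicator 1 := by
  ext t; simp [haarScaling, indicator_apply]

theorem haarWavelet_eq (j k : ℕ) (t : ℝ) :
    haarWavelet j k t = (2 : ℝ) ^ ((j : ℝ) / 2) *
      ((Ico (dyadic (j + 1) (2 * k)) (dyadic (j + 1) (2 * k + 1))).indicator 1 t -
        (Ico (dyadic (j + 1) (2 * k + 1)) (dyadic (j + 1) (2 * k + 1 + 1))).indicator 1 t) := by
  have h2 : (0 : ℝ) < 2 ^ j := by positivity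
  simp only [haarWavelet, haarMother, indicator_apply, mem_Ico, dyadic, pow_succ]
  congr 1
  have d1 : ∀ x : ℝ, (x / (2 ^ j * 2) ≤ t) = (x ≤ t * (2 ^ j * 2)) := fun x =>
    propext (div_le_iff₀ (by positivity))
  have d2 : ∀ x : ℝ, (t < x / (2 ^ j * 2)) = (t * (2 ^ j * 2) < x) := fun x =>
    propext (lt_div_iff₀ (by positivity))
  simp only [d1, d2]
  push_cast
  have e1 : (0 ≤ 2 ^ j * t - (k : ℝ)) ↔ 2 * (k : ℝ) ≤ t * (2 ^ j * 2) := by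
    constructor <;> intro h <;> linarith
  have e2 : (2 ^ j * t - (k : ℝ) < 1 / 2) ↔ t * (2 ^ j * 2) < 2 * (k : ℝ) + 1 := by
    constructor <;> intro h <;> linarith
  have e3 : (1 / 2 ≤ 2 ^ j * t - (k : ℝ)) ↔ 2 * (k : ℝ) + 1 ≤ t * (2 ^ j * 2) := by
    constructor <;> intro h <;> linarith
  have e4 : (2 ^ j * t - (k : ℝ) < 1) ↔ t * (2 ^ j * 2) < 2 * (k : ℝ) + 1 + 1 := by
    constructor <;> intro h <;> linarith
  simp only [e1, e2, e3, e4]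
  by_cases h1 : 2 * (k : ℝ) ≤ t * (2 ^ j * 2) <;>
  by_cases h3 : 2 * (k : ℝ) + 1 ≤ t * (2 ^ j * 2) <;>
  by_cases h4 : t * (2 ^ j * 2) < 2 * (k : ℝ) + 1 + 1 <;>
  simp [h1, h3, h4] <;> grind

theorem haar_zero : haar 0 = haarScaling := by simp [haar]

theorem haar_two_pow_add {j k : ℕ} (hk : k < 2 ^ j) : haar (2 ^ j + k) = haarWavelet j k := by
  have h0 : 2 ^ j + k ≠ 0 := by positivity
  rw [haar, if_neg h0, log_two_pow_add hk, Nat.add_sub_cancel_left]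

theorem measurable_haar (n : ℕ) : Measurable (haar n) := by
  rcases eq_or_ne n 0 with rfl | hn
  · rw [haar_zero, haarScaling_eq]
    exact measurable_one.indicator measurableSet_Ico
  · obtain ⟨j, k, hk, rfl⟩ := exists_two_pow_add hn
    rw [haar_two_pow_add hk]
    have : haarWavelet j k = fun t => _ := funext (haarWavelet_eq j k)
    rw [this]
    exact ((measurable_one.indicator measurableSet_Ico).sub
      (measurable_one.indicator measurableSet_Ico)).const_mul _

theorem abs_haarMother_le (t : ℝ) : |haarMother t| ≤ 1 := by
  unfold haarMother; split_ifs <;> simp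

theorem abs_haarWavelet_le (j k : ℕ) (t : ℝ) : |haarWavelet j k t| ≤ (2 : ℝ) ^ ((j : ℝ) / 2) := by
  rw [haarWavelet, abs_mul, abs_of_pos (by positivity)]
  exact mul_le_of_le_one_right (by positivity) (abs_haarMother_le _)

theorem exists_abs_haar_le (n : ℕ) : ∃ C, ∀ t, |haar n t| ≤ C := by
  rcases eq_or_ne n 0 with rfl | hn
  · refine ⟨1, fun t => ?_⟩
    rw [haar_zero, haarScaling]; split_ifs <;> simp
  · obtain ⟨j, k, hk, rfl⟩ := exists_two_pow_add hn
    rw [haar_two_pow_add hk]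
    exact ⟨_, abs_haarWavelet_le j k⟩

theorem integral_indicator_Ico_mul {f : ℝ → ℝ} (hf : IntervalIntegrable f volume 0 1) {a b : ℝ}
    (ha : 0 ≤ a) (hab : a ≤ b) (hb : b ≤ 1) :
    ∫ t in (0 : ℝ)..1, (Ico a b).indicator 1 t * f t = (∫ t in (0 : ℝ)..b, f t) -
      ∫ t in (0 : ℝ)..a, f t := by
  have hI : ∀ c, 0 ≤ c → c ≤ 1 → IntervalIntegrable f volume 0 c := fun c h0 h1 =>
    hf.mono_set (by rw [uIcc_of_le h0, uIcc_of_le zero_le_one]; exact Icc_subset_Icc_right h1)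
  have h1 : ∀ t, (Ico a b).indicator 1 t * f t = (Ico a b).indicator f t := by
    intro t; by_cases h : t ∈ Ico a b <;> simp [h]
  simp_rw [h1]
  rw [intervalIntegral.integral_of_le zero_le_one, ← integral_Icc_eq_integral_Ioc,
    setIntegral_indicator measurableSet_Ico,
    inter_eq_right.2 (Ico_subset_Icc_self.trans (Icc_subset_Icc ha hb)),
    integral_Ico_eq_integral_Ioc, ← intervalIntegral.integral_of_le hab,
    intervalIntegral.integral_interval_sub_left (hI b (ha.trans hab) hb) (hI a ha (hab.trans hb))]

theorem intervalIntegrable_indicator_mul {f : ℝ → ℝ} (hf : IntervalIntegrable f volume 0 1)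
    (a b : ℝ) : IntervalIntegrable (fun t => (Ico a b).indicator 1 t * f t) volume 0 1 := by
  have h1 : (fun t => (Ico a b).indicator 1 t * f t) = (Ico a b).indicator f := by
    ext t; by_cases h : t ∈ Ico a b <;> simp [h]
  rw [h1]
  exact ⟨hf.1.indicator measurableSet_Ico, hf.2.indicator measurableSet_Ico⟩

/-- Passing to the primitive of `f` makes the algebraic Parseval identity `sum_haarCoef_smul`
available for integrals against Haar functions. -/
theorem integral_haar_mul {f : ℝ → ℝ} (hf : IntervalIntegrable f volume 0 1) (n : ℕ) :
    ∫ t in (0 : ℝ)..1, haar n t * f t = haarCoef n (fun t => ∫ x in (0 : ℝ)..t, f x) := by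
  rcases eq_or_ne n 0 with rfl | hn
  · rw [haar_zero, haarScaling_eq, integral_indicator_Ico_mul hf le_rfl zero_le_one le_rfl]
    simp
  · obtain ⟨j, k, hk, rfl⟩ := exists_two_pow_add hn
    rw [haar_two_pow_add hk, haarCoef_two_pow_add hk]
    simp_rw [haarWavelet_eq, mul_assoc, sub_mul]
    have hle : 2 * k + 1 + 1 ≤ 2 ^ (j + 1) := by rw [pow_succ]; omega
    rw [intervalIntegral.integral_const_mul, intervalIntegral.integral_sub
      (intervalIntegrable_indicator_mul hf _ _) (intervalIntegrable_indicator_mul hf _ _),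
      integral_indicator_Ico_mul hf (dyadic_nonneg _ _) (dyadic_mono _ (by omega))
        (dyadic_le_one (by omega)),
      integral_indicator_Ico_mul hf (dyadic_nonneg _ _) (dyadic_mono _ (by omega))
        (dyadic_le_one hle)]
    simp [dyadicIncr]

theorem haarMother_mul_self (t : ℝ) : haarMother t * haarMother t = (Ico (0:ℝ) 1).indicator 1 t := by
  simp only [haarMother, indicator_apply, mem_Ico, Pi.one_apply]
  by_cases h1 : 0 ≤ t <;> by_cases h2 : t < 1/2 <;> by_cases h3 : t < 1 <;>
    simp [h1, h3] <;> grind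

theorem intervalIntegrable_haar (n : ℕ) (a b : ℝ) : IntervalIntegrable (haar n) volume a b := by
  obtain ⟨C, hC⟩ := exists_abs_haar_le n
  exact (intervalIntegrable_const (c := C)).mono_fun (measurable_haar n).aestronglyMeasurable
    (ae_of_all _ fun t => by simpa using (hC t).trans (le_abs_self C))

theorem integral_haar_mul_self (n : ℕ) : ∫ t in (0 : ℝ)..1, haar n t * haar n t = 1 := by
  rcases eq_or_ne n 0 with rfl | hn
  · have : ∀ t, haar 0 t * haar 0 t = (Ico (0 : ℝ) 1).indicator 1 t * 1 := by
      intro t; rw [haar_zero, haarScaling_eq]; by_cases h : t ∈ Ico (0:ℝ) 1 <;> simp [h]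
    simp_rw [this]
    rw [integral_indicator_Ico_mul intervalIntegrable_const le_rfl zero_le_one le_rfl]
    simp
  · obtain ⟨j, k, hk, rfl⟩ := exists_two_pow_add hn
    have : ∀ t, haar (2 ^ j + k) t * haar (2 ^ j + k) t =
        (Ico (dyadic j k) (dyadic j (k + 1))).indicator 1 t * 2 ^ j := by
      intro t
      rw [haar_two_pow_add hk, haarWavelet, mul_mul_mul_comm, two_rpow_half_sq,
        haarMother_mul_self, mul_comm]
      congr 1
      simp only [indicator_apply, mem_Ico, dyadic]
      have d1 : ((k : ℝ) / 2 ^ j ≤ t) = ((0 : ℝ) ≤ 2 ^ j * t - k) := propext (by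
        rw [div_le_iff₀ (by positivity), sub_nonneg, mul_comm])
      have d2 : (t < ((k + 1 : ℕ) : ℝ) / 2 ^ j) = (2 ^ j * t - k < (1 : ℝ)) := propext (by
        rw [lt_div_iff₀ (by positivity), sub_lt_iff_lt_add, mul_comm]; push_cast; rw [add_comm])
      simp only [d1, d2, Pi.one_apply]
    simp_rw [this]
    rw [integral_indicator_Ico_mul intervalIntegrable_const (dyadic_nonneg _ _)
      (dyadic_mono _ (by omega)) (dyadic_le_one (by omega))]
    simp [dyadic]

/-- The variance of `f` on a dyadic interval is nonnegative; `2^J` times the increment is its mean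
there. -/
theorem dyadicIncr_integral_sq_le {f : ℝ → ℝ} (hf : Measurable f) {C : ℝ} (hC : ∀ t, |f t| ≤ C)
    (J k : ℕ) : (2 : ℝ) ^ J * dyadicIncr J k (fun t => ∫ x in (0 : ℝ)..t, f x) ^ 2 ≤
      dyadicIncr J k (fun t => ∫ x in (0 : ℝ)..t, f x * f x) := by
  have hI : ∀ a b, IntervalIntegrable f volume a b := fun a b =>
    (intervalIntegrable_const (c := C)).mono_fun hf.aestronglyMeasurable
      (ae_of_all _ fun t => by simpa using (hC t).trans (le_abs_self C))
  have hI2 : ∀ a b, IntervalIntegrable (fun x => f x * f x) volume a b := fun a b =>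
    (intervalIntegrable_const (c := C * C)).mono_fun (hf.mul hf).aestronglyMeasurable
      (ae_of_all _ fun t => by
        simp only [norm_mul, Real.norm_eq_abs]
        exact mul_le_mul ((hC t).trans (le_abs_self C)) ((hC t).trans (le_abs_self C))
          (abs_nonneg _) (abs_nonneg _))
  rw [dyadicIncr, dyadicIncr, intervalIntegral.integral_interval_sub_left (hI _ _) (hI _ _),
    intervalIntegral.integral_interval_sub_left (hI2 _ _) (hI2 _ _)]
  set a := dyadic J k
  set b := dyadic J (k + 1)
  have hab : a ≤ b := dyadic_mono _ (by omega)
  have hlen : b - a = (2 ^ J)⁻¹ := by simp only [a, b, dyadic]; push_cast; field_simp; ring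
  have h2 : (0 : ℝ) < 2 ^ J := by positivity
  set A := ∫ x in a..b, f x
  have hpos : 0 ≤ ∫ x in a..b, (f x - 2 ^ J * A) ^ 2 :=
    intervalIntegral.integral_nonneg hab fun x _ => sq_nonneg _
  have hexp : ∫ x in a..b, (f x - 2 ^ J * A) ^ 2 =
      (∫ x in a..b, f x * f x) - 2 ^ J * A ^ 2 := by
    have : ∀ x, (f x - 2 ^ J * A) ^ 2 = f x * f x - 2 * (2 ^ J * A) * f x + (2 ^ J * A) ^ 2 := by
      intro x; ring
    simp_rw [this]
    rw [intervalIntegral.integral_add ((hI2 _ _).sub ((hI _ _).const_mul _))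
      intervalIntegrable_const, intervalIntegral.integral_sub (hI2 _ _) ((hI _ _).const_mul _),
      intervalIntegral.integral_const_mul, intervalIntegral.integral_const, hlen]
    simp only [smul_eq_mul]
    field_simp
    ring
  linarith

theorem sum_dyadicIncr {M : Type*} [AddCommGroup M] (J : ℕ) (G : ℝ → M) (m : ℕ) :
    ∑ k ∈ Finset.range m, dyadicIncr J k G = G (dyadic J m) - G 0 := by
  simp only [dyadicIncr]
  rw [Finset.sum_range_sub (fun k => G (dyadic J k))]
  simp

/-- Orthogonality follows from Bessel's inequality without case distinctions: the squared
coefficients of `haar m` sum to at most `1`, and the `m`-th one already equals `1`. -/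
theorem integral_haar_mul_haar (n m : ℕ) :
    ∫ t in (0 : ℝ)..1, haar n t * haar m t = if n = m then 1 else 0 := by
  split_ifs with hnm
  · rw [hnm, integral_haar_mul_self]
  · obtain ⟨C, hC⟩ := exists_abs_haar_le m
    set F : ℝ → ℝ := fun t => ∫ x in (0 : ℝ)..t, haar m x with hF
    have hm1 : haarCoef m F = 1 := by
      rw [hF, ← integral_haar_mul (intervalIntegrable_haar m 0 1), integral_haar_mul_self]
    rw [integral_haar_mul (intervalIntegrable_haar m 0 1), ← hF]
    set J := max n m
    have hJ : ∀ i, i ≤ J → i ∈ Finset.range (2 ^ J) := fun i hi =>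
      Finset.mem_range.2 (hi.trans_lt Nat.lt_two_pow_self)
    have h1 := sum_haarCoef_smul J F F
    have h2 : ∑ i ∈ Finset.range (2 ^ J), haarCoef i F ^ 2 ≤ 1 := by
      simp only [smul_eq_mul, ← pow_two] at h1
      rw [h1, Finset.mul_sum]
      calc _ ≤ ∑ k ∈ Finset.range (2 ^ J),
            dyadicIncr J k (fun t => ∫ x in (0 : ℝ)..t, haar m x * haar m x) :=
            Finset.sum_le_sum fun k _ => dyadicIncr_integral_sq_le (measurable_haar m) hC J k
        _ = 1 := by rw [sum_dyadicIncr, dyadic_two_pow]; simp [integral_haar_mul_self]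
    have h3 : haarCoef n F ^ 2 + haarCoef m F ^ 2 ≤ 1 := by
      refine le_trans ?_ h2
      rw [← Finset.sum_pair (f := fun i => haarCoef i F ^ 2) hnm]
      refine Finset.sum_le_sum_of_subset_of_nonneg ?_ fun _ _ _ => sq_nonneg _
      intro i hi
      simp only [Finset.mem_insert, Finset.mem_singleton] at hi
      rcases hi with rfl | rfl
      · exact hJ _ (le_max_left _ _)
      · exact hJ _ (le_max_right _ _)
    rw [hm1] at h3
    exact pow_eq_zero_iff (two_ne_zero) |>.1 (le_antisymm (by linarith) (sq_nonneg _))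

/-! ### Square integrable functions as elements of the Besov space -/

theorem integrable_testFunction (φ : 𝓓(unitIoo, ℝ)) : Integrable φ :=
  φ.continuous.integrable_of_hasCompactSupport φ.hasCompactSupport

theorem memLp_testFunction (φ : 𝓓(unitIoo, ℝ)) : MemLp φ 2 :=
  φ.continuous.memLp_of_hasCompactSupport φ.hasCompactSupport

theorem eLpNorm_testFunction_le {s : ℝ} (hs : s ≤ 0) (φ : 𝓓(unitIoo, ℝ)) :
    eLpNorm φ 2 volume ≤ ENNReal.ofReal ‖evalAt s φ‖ := by
  have h := lintegral_sq_le_norm_evalAt hs φ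
  rw [eLpNorm_eq_lintegral_rpow_enorm_toReal (by norm_num) (by norm_num)]
  simp only [ENNReal.toReal_ofNat, ENNReal.rpow_ofNat]
  calc _ ≤ ENNReal.ofReal (‖evalAt s φ‖ ^ 2) ^ (1 / (2 : ℝ)) := by gcongr
    _ = _ := by
      rw [ENNReal.ofReal_rpow_of_nonneg (by positivity) (by norm_num), ← Real.sqrt_eq_rpow,
        Real.sqrt_sq (norm_nonneg _)]

/-- For `s ≤ 0` the dual norm dominates the `L²` norm, so pairing with `f` is bounded and
`exists_pairing_eq` applies. -/
theorem exists_represents {s : ℝ} (hs : s ≤ 0) {f : ℝ → ℝ}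
    (hf : MemLp f 2 (volume.restrict (Ioc 0 1))) :
    ∃ u : Besov s, Represents u f ∧
      ‖u‖ ≤ (eLpNorm f 2 (volume.restrict (Ioc 0 1))).toReal := by
  set μ := (volume : Measure ℝ).restrict (Ioc 0 1)
  have hφ : ∀ φ : 𝓓(unitIoo, ℝ), MemLp φ 2 μ := fun φ => (memLp_testFunction φ).restrict _
  have hmul : ∀ φ : 𝓓(unitIoo, ℝ), Integrable (fun x => f x * φ x) μ := fun φ =>
    hf.integrable_mul (hφ φ)
  let L : 𝓓(unitIoo, ℝ) →ₗ[ℝ] ℝ :=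
    { toFun := fun φ => ∫ x, f x * φ x ∂μ
      map_add' := fun φ ψ => by
        rw [← integral_add (hmul φ) (hmul ψ)]
        simp [mul_add]
      map_smul' := fun c φ => by
        rw [RingHom.id_apply, smul_eq_mul, ← integral_const_mul]
        simp [mul_left_comm] }
  obtain ⟨u, hu, hu2⟩ := exists_pairing_eq s L
    (C := (eLpNorm f 2 μ).toReal) ENNReal.toReal_nonneg (by
      intro φ
      have h1 : L φ = inner ℝ ((hφ φ).toLp φ) (hf.toLp f) := by
        rw [L2.inner_def]
        refine integral_congr_ae ?_
        filter_upwards [(hφ φ).coeFn_toLp, hf.coeFn_toLp] with x h1 h2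
        rw [h1, h2]; simp
      rw [h1, mul_comm]
      refine (abs_real_inner_le_norm _ _).trans ?_
      rw [Lp.norm_toLp, Lp.norm_toLp]
      gcongr
      refine ENNReal.toReal_le_of_le_ofReal (norm_nonneg _) ?_
      exact (eLpNorm_restrict_le _ _ _ _).trans (eLpNorm_testFunction_le hs φ))
  refine ⟨u, fun φ => ?_, hu⟩
  rw [hu2, intervalIntegral.integral_of_le zero_le_one]
  rfl

theorem Represents.unique {s : ℝ} {u v : Besov s} {f : ℝ → ℝ} (hu : Represents u f)
    (hv : Represents v f) : u = v :=
  pairing_ext fun φ => (hu φ).trans (hv φ).symm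

open Classical in
/-- The element of the Besov space represented by the function `f` (zero if there is none). -/
def ofFun (s : ℝ) (f : ℝ → ℝ) : Besov s :=
  if h : ∃ u : Besov s, Represents u f then h.choose else 0

theorem represents_ofFun {s : ℝ} (hs : s ≤ 0) {f : ℝ → ℝ}
    (hf : MemLp f 2 (volume.restrict (Ioc 0 1))) : Represents (ofFun s f) f := by
  have h : ∃ u : Besov s, Represents u f := (exists_represents hs hf).imp fun _ h => h.1
  rw [ofFun, dif_pos h]
  exact h.choose_spec

theorem norm_ofFun_le {s : ℝ} (hs : s ≤ 0) {f : ℝ → ℝ}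
    (hf : MemLp f 2 (volume.restrict (Ioc 0 1))) :
    ‖ofFun s f‖ ≤ (eLpNorm f 2 (volume.restrict (Ioc 0 1))).toReal := by
  obtain ⟨u, hu, hn⟩ := exists_represents hs hf
  rwa [(represents_ofFun hs hf).unique hu]

theorem memLp_of_abs_le {f : ℝ → ℝ} (hf : Measurable f) {C : ℝ} (hC : ∀ t, |f t| ≤ C) :
    MemLp f 2 (volume.restrict (Ioc 0 1)) :=
  MemLp.of_bound hf.aestronglyMeasurable C (ae_of_all _ hC)

theorem memLp_haar (n : ℕ) : MemLp (haar n) 2 (volume.restrict (Ioc 0 1)) :=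
  memLp_of_abs_le (measurable_haar n) (exists_abs_haar_le n).choose_spec

/-- The Haar functions as elements of the Besov space. -/
def haarVec (s : ℝ) (n : ℕ) : Besov s := ofFun s (haar n)

theorem represents_haarVec {s : ℝ} (hs : s ≤ 0) (n : ℕ) : Represents (haarVec s n) (haar n) :=
  represents_ofFun hs (memLp_haar n)

/-- The indicator functions of `[0,t)` as elements of the Besov space. -/
def stepVec (s : ℝ) (t : ℝ) : Besov s := ofFun s ((Ico 0 t).indicator 1)

theorem memLp_indicator (t : ℝ) :
    MemLp ((Ico 0 t).indicator (1 : ℝ → ℝ)) 2 (volume.restrict (Ioc 0 1)) :=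
  memLp_of_abs_le (measurable_one.indicator measurableSet_Ico) (C := 1) fun x => by
    by_cases h : x ∈ Ico 0 t <;> simp [h]

theorem pairing_stepVec {s : ℝ} (hs : s ≤ 0) {t : ℝ} (h0 : 0 ≤ t) (h1 : t ≤ 1)
    (φ : 𝓓(unitIoo, ℝ)) : pairing (stepVec s t) φ = ∫ x in (0 : ℝ)..t, φ x := by
  rw [stepVec, represents_ofFun hs (memLp_indicator t),
    integral_indicator_Ico_mul ((integrable_testFunction φ).intervalIntegrable) le_rfl h0 h1]
  simp

theorem pairing_haarVec {s : ℝ} (hs : s ≤ 0) (n : ℕ) (φ : 𝓓(unitIoo, ℝ)) :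
    pairing (haarVec s n) φ = haarCoef n (fun t => ∫ x in (0 : ℝ)..t, φ x) := by
  rw [represents_haarVec hs, integral_haar_mul ((integrable_testFunction φ).intervalIntegrable)]

theorem haarCoef_congr {M : Type*} [AddCommGroup M] [Module ℝ M] {F G : ℝ → M}
    (h : ∀ t, 0 ≤ t → t ≤ 1 → F t = G t) (n : ℕ) : haarCoef n F = haarCoef n G := by
  rcases eq_or_ne n 0 with rfl | hn
  · rw [haarCoef_zero, haarCoef_zero, h 1 zero_le_one le_rfl, h 0 le_rfl zero_le_one]
  · obtain ⟨j, k, hk, rfl⟩ := exists_two_pow_add hn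
    have hle : 2 * k + 1 + 1 ≤ 2 ^ (j + 1) := by rw [pow_succ]; omega
    have h' : ∀ m ≤ 2 * k + 1 + 1, F (dyadic (j + 1) m) = G (dyadic (j + 1) m) := fun m hm =>
      h _ (dyadic_nonneg _ _) (dyadic_le_one (hm.trans hle))
    rw [haarCoef_two_pow_add hk, haarCoef_two_pow_add hk]
    simp only [dyadicIncr]
    rw [h' _ le_rfl, h' (2 * k + 1) (by omega), h' (2 * k) (by omega)]

/-- With the curve `t ↦ 1_{[0,t)}` of vectors in place of a primitive, Parseval's identity collapses
Haar sums in `E` to dyadic step functions, and `L(e_n)` becomes a coefficient of `t ↦ L(1_{[0,t)})`.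
-/
theorem haarVec_eq_haarCoef {s : ℝ} (hs : s ≤ 0) (n : ℕ) :
    haarVec s n = haarCoef n (stepVec s) := by
  refine pairing_ext fun φ => ?_
  rw [pairing_haarVec hs, ← pairingL_apply (haarCoef n (stepVec s))]
  have := haarCoef_map (pairingL φ).toLinearMap n (stepVec s)
  simp only [ContinuousLinearMap.coe_coe] at this
  rw [← this]
  refine haarCoef_congr (fun t h0 h1 => ?_) n
  rw [pairingL_apply, pairing_stepVec hs h0 h1]

/-! ### The upper estimate -/

theorem sq_lintegral_le {α : Type*} [MeasurableSpace α] (μ : Measure α) {f : α → ℝ≥0∞}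
    (hf : AEMeasurable f μ) : (∫⁻ x, f x ∂μ) ^ 2 ≤ μ univ * ∫⁻ x, f x ^ 2 ∂μ := by
  have h := ENNReal.lintegral_mul_le_Lp_mul_Lq μ (p := 2) (q := 2) (by constructor <;> norm_num)
    (f := fun _ => 1) (g := f) aemeasurable_const hf
  simp only [Pi.mul_apply, one_mul, lintegral_const, ENNReal.rpow_ofNat, one_pow] at h
  calc _ ≤ (μ univ ^ (1 / (2 : ℝ)) * (∫⁻ x, f x ^ 2 ∂μ) ^ (1 / (2 : ℝ))) ^ 2 := by gcongr
    _ = _ := by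
      rw [mul_pow, ← ENNReal.rpow_two, ← ENNReal.rpow_mul, ← ENNReal.rpow_two, ← ENNReal.rpow_mul]
      norm_num

/-- For neighbouring intervals of the same length `h`, the double integral of `φ x - φ y` is `h`
times the difference of the integrals. Cauchy–Schwarz on the rectangle of area `h²` then produces a
factor `h²` on both sides. -/
theorem enorm_integral_sub_sq_le {φ : ℝ → ℝ} (hφ : Continuous φ) {a b c h : ℝ} (hh : 0 < h)
    (hb : b = a + h) (hc : c = b + h) :
    ‖(∫ x in a..b, φ x) - ∫ x in b..c, φ x‖ₑ ^ 2 ≤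
      ∫⁻ p in Ico a b ×ˢ Ico b c, ‖φ p.1 - φ p.2‖ₑ ^ 2 := by
  set μ := (volume : Measure ℝ).restrict (Ico a b)
  set ν := (volume : Measure ℝ).restrict (Ico b c)
  have hμν : (volume : Measure (ℝ × ℝ)).restrict (Ico a b ×ˢ Ico b c) = μ.prod ν := by
    rw [Measure.volume_eq_prod, Measure.prod_restrict]
  have hμ : μ univ = ENNReal.ofReal h := by simp [μ, hb]
  have hν : ν univ = ENNReal.ofReal h := by simp [ν, hc]
  have hiμ : Integrable φ μ := (hφ.integrableOn_Icc (a := a) (b := b)).mono_set Ico_subset_Icc_self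
  have hiν : Integrable φ ν := (hφ.integrableOn_Icc (a := b) (b := c)).mono_set Ico_subset_Icc_self
  have hA : ∫ x in a..b, φ x = ∫ x, φ x ∂μ := by
    rw [intervalIntegral.integral_of_le (by linarith), integral_Ico_eq_integral_Ioc]
  have hB : ∫ x in b..c, φ x = ∫ x, φ x ∂ν := by
    rw [intervalIntegral.integral_of_le (by linarith), integral_Ico_eq_integral_Ioc]
  have hint : ∫ p, (φ p.1 - φ p.2) ∂(μ.prod ν) =
      h * ((∫ x in a..b, φ x) - ∫ x in b..c, φ x) := by
    have e1 := integral_prod_mul (μ := μ) (ν := ν) φ (fun _ => (1 : ℝ))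
    have e2 := integral_prod_mul (μ := μ) (ν := ν) (fun _ => (1 : ℝ)) φ
    have i1 : Integrable (fun p : ℝ × ℝ => φ p.1 * 1) (μ.prod ν) :=
      hiμ.mul_prod (integrable_const (1 : ℝ))
    have i2 : Integrable (fun p : ℝ × ℝ => 1 * φ p.2) (μ.prod ν) :=
      (integrable_const (1 : ℝ)).mul_prod hiν
    have e3 := integral_sub i1 i2
    rw [e1, e2] at e3
    simp only [mul_one, one_mul] at e3
    rw [e3, hA, hB]
    simp only [integral_const, measureReal_def, hμ, hν, ENNReal.toReal_ofReal hh.le, smul_eq_mul]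
    ring
  have hm : Measurable fun p : ℝ × ℝ => ‖φ p.1 - φ p.2‖ₑ := by fun_prop
  have h1 := sq_lintegral_le (μ.prod ν) hm.aemeasurable
  have h2 : ‖h * ((∫ x in a..b, φ x) - ∫ x in b..c, φ x)‖ₑ ≤
      ∫⁻ p, ‖φ p.1 - φ p.2‖ₑ ∂(μ.prod ν) := by
    rw [← hint]; exact enorm_integral_le_lintegral_enorm _
  have h3 : ENNReal.ofReal h ^ 2 * ‖(∫ x in a..b, φ x) - ∫ x in b..c, φ x‖ₑ ^ 2 ≤
      ENNReal.ofReal h ^ 2 * ∫⁻ p, ‖φ p.1 - φ p.2‖ₑ ^ 2 ∂(μ.prod ν) := by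
    refine le_trans ?_ ((pow_le_pow_left' h2 2).trans (h1.trans_eq ?_))
    · rw [enorm_mul, mul_pow, Real.enorm_of_nonneg hh.le]
    · rw [← univ_prod_univ, Measure.prod_prod, hμ, hν, pow_two]
  rw [hμν]
  refine (ENNReal.mul_le_mul_iff_right ?_ ?_).1 h3
  · simp [hh]
  · finiteness

/-- The product of the two halves of the support of the `n`-th Haar function. -/
def haarRect (n : ℕ) : Set (ℝ × ℝ) :=
  Ico (dyadic (Nat.log 2 n + 1) (2 * (n - 2 ^ Nat.log 2 n)))
      (dyadic (Nat.log 2 n + 1) (2 * (n - 2 ^ Nat.log 2 n) + 1)) ×ˢ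
    Ico (dyadic (Nat.log 2 n + 1) (2 * (n - 2 ^ Nat.log 2 n) + 1))
      (dyadic (Nat.log 2 n + 1) (2 * (n - 2 ^ Nat.log 2 n) + 1 + 1))

theorem haarRect_two_pow_add {j k : ℕ} (hk : k < 2 ^ j) : haarRect (2 ^ j + k) =
    Ico (dyadic (j + 1) (2 * k)) (dyadic (j + 1) (2 * k + 1)) ×ˢ
      Ico (dyadic (j + 1) (2 * k + 1)) (dyadic (j + 1) (2 * k + 1 + 1)) := by
  rw [haarRect, log_two_pow_add hk, Nat.add_sub_cancel_left]

theorem measurableSet_haarRect (n : ℕ) : MeasurableSet (haarRect n) :=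
  measurableSet_Ico.prod measurableSet_Ico

theorem floor_of_mem_Ico_dyadic {a m : ℕ} {x : ℝ} (hx : x ∈ Ico (dyadic a m) (dyadic a (m + 1))) :
    ⌊2 ^ a * x⌋₊ = m := by
  have h0 : 0 ≤ x := (dyadic_nonneg a m).trans hx.1
  obtain ⟨h1, h2⟩ := hx
  rw [dyadic, div_le_iff₀ (by positivity)] at h1
  rw [dyadic, lt_div_iff₀ (by positivity)] at h2
  rw [Nat.floor_eq_iff (by positivity)]
  push_cast at h2
  constructor <;> linarith

theorem floor_two_pow_mul (a d : ℕ) (x : ℝ) : ⌊2 ^ a * x⌋₊ = ⌊2 ^ (a + d) * x⌋₊ / 2 ^ d := by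
  have := Nat.floor_div_natCast (2 ^ (a + d) * x) (2 ^ d)
  rw [← this]
  congr 1
  push_cast
  rw [pow_add]
  field_simp

/-- At scale `2^{-(j+1)}` the two coordinates of a point of the coarser rectangle lie in different
dyadic intervals, while those of a point of the finer one lie in a common interval. -/
theorem disjoint_haarRect_of_lt {j k j' k' : ℕ} (hk : k < 2 ^ j) (hk' : k' < 2 ^ j') (h : j < j') :
    Disjoint (haarRect (2 ^ j + k)) (haarRect (2 ^ j' + k')) := by
  rw [haarRect_two_pow_add hk, haarRect_two_pow_add hk', Set.disjoint_left]
  rintro ⟨x, y⟩ ⟨hx, hy⟩ ⟨hx', hy'⟩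
  have e1 := floor_of_mem_Ico_dyadic hx
  have e2 := floor_of_mem_Ico_dyadic hy
  have e3 := floor_of_mem_Ico_dyadic hx'
  have e4 := floor_of_mem_Ico_dyadic hy'
  have hd : j' + 1 = j + 1 + (j' - j) := by omega
  have hd2 : j' - j = 1 + (j' - j - 1) := by omega
  rw [floor_two_pow_mul (j + 1) (j' - j), ← hd] at e1 e2
  rw [e3, hd2, pow_add, ← Nat.div_div_eq_div_mul, pow_one] at e1
  rw [e4, hd2, pow_add, ← Nat.div_div_eq_div_mul, pow_one] at e2
  rw [show (2 * k' + 1) / 2 = k' by omega] at e2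
  rw [show (2 * k') / 2 = k' by omega] at e1
  omega

theorem disjoint_haarRect {n m : ℕ} (hn : n ≠ 0) (hm : m ≠ 0) (hnm : n ≠ m) :
    Disjoint (haarRect n) (haarRect m) := by
  obtain ⟨j, k, hk, rfl⟩ := exists_two_pow_add hn
  obtain ⟨j', k', hk', rfl⟩ := exists_two_pow_add hm
  rcases lt_trichotomy j j' with h | h | h
  · exact disjoint_haarRect_of_lt hk hk' h
  · subst h
    rw [haarRect_two_pow_add hk, haarRect_two_pow_add hk', Set.disjoint_left]
    rintro ⟨x, y⟩ ⟨hx, hy⟩ ⟨hx', hy'⟩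
    have e1 := floor_of_mem_Ico_dyadic hx
    have e3 := floor_of_mem_Ico_dyadic hx'
    omega
  · exact (disjoint_haarRect_of_lt hk' hk h).symm

/-- The weight `2^{s j}` of the Haar functions of level `j`. -/
def haarWeight (s : ℝ) (n : ℕ) : ℝ := 2 ^ (s * Nat.log 2 n)

theorem haarWeight_pos (s : ℝ) (n : ℕ) : 0 < haarWeight s n := by
  unfold haarWeight; positivity

theorem haarWeight_neg (s : ℝ) (n : ℕ) : haarWeight (-s) n = (haarWeight s n)⁻¹ := by
  rw [haarWeight, haarWeight, ← Real.rpow_neg (by norm_num), neg_mul]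

theorem gagliardo_eq_lintegral_prod (α : ℝ) {φ : ℝ → ℝ} (hφ : Continuous φ) :
    gagliardo α φ = ∫⁻ p : ℝ × ℝ, rieszKernel α (p.1 - p.2) * ‖φ p.1 - φ p.2‖ₑ ^ 2 := by
  have hm : Measurable fun p : ℝ × ℝ => rieszKernel α (p.1 - p.2) * ‖φ p.1 - φ p.2‖ₑ ^ 2 := by
    have : Measurable fun p : ℝ × ℝ => rieszKernel α (p.1 - p.2) :=
      (measurable_rieszKernel α).comp (measurable_fst.sub measurable_snd)
    fun_prop
  have hm2 : Measurable fun p : ℝ × ℝ => rieszKernel α p.1 * ‖φ (p.2 - p.1) - φ p.2‖ₑ ^ 2 := by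
    have : Measurable fun p : ℝ × ℝ => rieszKernel α p.1 :=
      (measurable_rieszKernel α).comp measurable_fst
    fun_prop
  rw [Measure.volume_eq_prod, lintegral_prod _ hm.aemeasurable, gagliardo]
  calc _ = ∫⁻ t, ∫⁻ x, rieszKernel α t * ‖φ (x - t) - φ x‖ₑ ^ 2 := by
        refine lintegral_congr fun t => ?_
        exact (lintegral_const_mul' _ _ ENNReal.ofReal_ne_top).symm
    _ = ∫⁻ x, ∫⁻ t, rieszKernel α t * ‖φ (x - t) - φ x‖ₑ ^ 2 :=
        lintegral_lintegral_swap hm2.aemeasurable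
    _ = _ := by
        refine lintegral_congr fun x => ?_
        rw [← lintegral_sub_left_eq_self (fun y => rieszKernel α (x - y) * ‖φ x - φ y‖ₑ ^ 2) x]
        refine lintegral_congr fun t => ?_
        simp only [sub_sub_cancel]
        rw [← enorm_neg, neg_sub]

/-- On the rectangle `|x - y| ≤ 2^{-j}`, so the kernel is at least `2^{j(1+2σ)}`. This is the square
of the weight times the square of the normalization `2^{j/2}`. -/
theorem haarWeight_mul_integral_sq_le {σ : ℝ} (hσ : 0 ≤ σ) {φ : ℝ → ℝ} (hφ : Continuous φ) {n : ℕ}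
    (hn : n ≠ 0) :
    ENNReal.ofReal ((haarWeight σ n * ∫ t in (0 : ℝ)..1, haar n t * φ t) ^ 2) ≤
      ∫⁻ p in haarRect n, rieszKernel (2 * σ) (p.1 - p.2) * ‖φ p.1 - φ p.2‖ₑ ^ 2 := by
  obtain ⟨j, k, hk, rfl⟩ := exists_two_pow_add hn
  rw [integral_haar_mul (hφ.intervalIntegrable _ _), haarCoef_two_pow_add hk,
    haarRect_two_pow_add hk, haarWeight, log_two_pow_add hk]
  have hI : ∀ a b, IntervalIntegrable φ volume a b := fun a b => hφ.intervalIntegrable _ _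
  simp only [dyadicIncr]
  rw [intervalIntegral.integral_interval_sub_left (hI _ _) (hI _ _),
    intervalIntegral.integral_interval_sub_left (hI _ _) (hI _ _), smul_eq_mul]
  have hstep : ∀ m, dyadic (j + 1) (m + 1) = dyadic (j + 1) m + (2 ^ (j + 1))⁻¹ := by
    intro m; simp only [dyadic]; push_cast; field_simp
  have h1 := enorm_integral_sub_sq_le hφ (by positivity) (hstep (2 * k)) (hstep (2 * k + 1))
  set D := (∫ x in (dyadic (j + 1) (2 * k))..(dyadic (j + 1) (2 * k + 1)), φ x) -
    ∫ x in (dyadic (j + 1) (2 * k + 1))..(dyadic (j + 1) (2 * k + 1 + 1)), φ x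
  have h2 : ENNReal.ofReal (((2 : ℝ) ^ (σ * j) * ((2 : ℝ) ^ ((j : ℝ) / 2) * D)) ^ 2) =
      ENNReal.ofReal ((2 : ℝ) ^ (j * (1 + 2 * σ))) * ‖D‖ₑ ^ 2 := by
    rw [← ofReal_norm, ← ENNReal.ofReal_pow (norm_nonneg _), ← ENNReal.ofReal_mul (by positivity),
      Real.norm_eq_abs, sq_abs, mul_pow, mul_pow, ← mul_assoc, ← Real.rpow_natCast, ← Real.rpow_natCast,
      ← Real.rpow_mul (by norm_num), ← Real.rpow_mul (by norm_num), ← Real.rpow_add (by norm_num)]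
    congr 3
    push_cast
    ring
  rw [h2]
  calc _ ≤ ENNReal.ofReal ((2 : ℝ) ^ (j * (1 + 2 * σ))) * _ := by gcongr
    _ = _ := (lintegral_const_mul' _ _ ENNReal.ofReal_ne_top).symm
    _ ≤ _ := by
      refine setLIntegral_mono' (measurableSet_Ico.prod measurableSet_Ico) ?_
      rintro ⟨x, y⟩ ⟨⟨hx1, hx2⟩, hy1, hy2⟩
      simp only at hx1 hx2 hy1 hy2 ⊢
      gcongr
      have hpos : 0 < |x - y| := abs_pos.2 (by linarith)
      have hle : |x - y| ≤ 2 ^ (-(j : ℝ)) := by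
        rw [abs_le, Real.rpow_neg (by norm_num), Real.rpow_natCast]
        rw [hstep] at hy2
        have h3 := hstep (2 * k)
        have h4 : ((2 : ℝ) ^ j)⁻¹ = (2 ^ (j + 1))⁻¹ + (2 ^ (j + 1))⁻¹ := by
          rw [pow_succ]; field_simp; norm_num
        constructor <;> linarith
      rw [rieszKernel]
      refine ENNReal.ofReal_le_ofReal ?_
      calc (2 : ℝ) ^ (j * (1 + 2 * σ)) = (2 ^ (-(j : ℝ))) ^ (-1 - 2 * σ) := by
            rw [← Real.rpow_mul (by norm_num)]; congr 1; ring
        _ ≤ _ := Real.rpow_le_rpow_of_nonpos hpos hle (by linarith)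

/-- Since the rectangles are disjoint, the local bounds add up inside one double integral. The
scaling function has no rectangle and is estimated by the `L²` norm. -/
theorem sum_haarWeight_mul_integral_sq_le {σ : ℝ} (hσ : 0 ≤ σ) {φ : ℝ → ℝ} (hφ : Continuous φ)
    (F : Finset ℕ) :
    ∑ n ∈ F, ENNReal.ofReal ((haarWeight σ n * ∫ t in (0 : ℝ)..1, haar n t * φ t) ^ 2) ≤
      (∫⁻ x, ‖φ x‖ₑ ^ 2) + gagliardo (2 * σ) φ := by
  have h0 : ENNReal.ofReal ((haarWeight σ 0 * ∫ t in (0 : ℝ)..1, haar 0 t * φ t) ^ 2) ≤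
      ∫⁻ x, ‖φ x‖ₑ ^ 2 := by
    rw [integral_haar_mul (hφ.intervalIntegrable _ _), haarCoef_zero]
    simp only [haarWeight, Nat.log_zero_right, CharP.cast_eq_zero, mul_zero, Real.rpow_zero, one_mul,
      intervalIntegral.integral_same, sub_zero]
    rw [← sq_abs, ENNReal.ofReal_pow (abs_nonneg _), ← Real.norm_eq_abs, ofReal_norm,
      intervalIntegral.integral_of_le zero_le_one]
    calc _ ≤ (∫⁻ x in Ioc 0 1, ‖φ x‖ₑ) ^ 2 := by
          gcongr; exact enorm_integral_le_lintegral_enorm _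
      _ ≤ _ := sq_lintegral_le _ (by fun_prop)
      _ ≤ _ := by simpa using setLIntegral_le_lintegral _ _
  have h1 : ∑ n ∈ F.erase 0,
      ENNReal.ofReal ((haarWeight σ n * ∫ t in (0 : ℝ)..1, haar n t * φ t) ^ 2) ≤
      gagliardo (2 * σ) φ := by
    rw [gagliardo_eq_lintegral_prod _ hφ]
    calc _ ≤ ∑ n ∈ F.erase 0, ∫⁻ p in haarRect n,
          rieszKernel (2 * σ) (p.1 - p.2) * ‖φ p.1 - φ p.2‖ₑ ^ 2 :=
          Finset.sum_le_sum fun n hn => haarWeight_mul_integral_sq_le hσ hφ (Finset.ne_of_mem_erase hn)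
      _ = ∫⁻ p in ⋃ n ∈ F.erase 0, haarRect n,
          rieszKernel (2 * σ) (p.1 - p.2) * ‖φ p.1 - φ p.2‖ₑ ^ 2 := by
          rw [lintegral_biUnion_finset]
          · intro n hn m hm hnm
            exact disjoint_haarRect (Finset.ne_of_mem_erase hn) (Finset.ne_of_mem_erase hm) hnm
          · exact fun n _ => measurableSet_haarRect n
      _ ≤ _ := setLIntegral_le_lintegral _ _
  calc _ ≤ ∑ n ∈ insert 0 (F.erase 0),
      ENNReal.ofReal ((haarWeight σ n * ∫ t in (0 : ℝ)..1, haar n t * φ t) ^ 2) := by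
        refine Finset.sum_le_sum_of_subset ?_
        intro n hn
        by_cases h : n = 0 <;> simp [h, hn]
    _ ≤ _ := by
        rw [Finset.sum_insert (by simp)]
        exact add_le_add h0 h1

theorem exists_sum_haarWeight_le {s : ℝ} (hs : s < 0) (hs1 : -1 < s) :
    ∃ C : ℝ, 0 ≤ C ∧ ∀ (φ : 𝓓(unitIoo, ℝ)) (F : Finset ℕ),
      ∑ n ∈ F, ((haarWeight s n)⁻¹ * ∫ t in (0 : ℝ)..1, haar n t * φ t) ^ 2 ≤
        C * ‖evalAt s φ‖ ^ 2 := by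
  refine ⟨1 + (gagliardoConst (2 * -s)).toReal, by positivity, fun φ F => ?_⟩
  have hc := gagliardoConst_lt_top (α := 2 * -s) (by linarith) (by linarith)
  have h := sum_haarWeight_mul_integral_sq_le (σ := -s) (by linarith) φ.continuous F
  simp_rw [haarWeight_neg] at h
  rw [← ENNReal.ofReal_sum_of_nonneg fun _ _ => sq_nonneg _] at h
  have h2 := h.trans (add_le_add (lintegral_sq_le_norm_evalAt hs.le φ)
    (gagliardo_le_norm_evalAt hs.le φ))
  rw [← ENNReal.ofReal_toReal hc.ne, ← ENNReal.ofReal_mul ENNReal.toReal_nonneg,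
    ← ENNReal.ofReal_add (by positivity) (by positivity)] at h2
  refine (ENNReal.ofReal_le_ofReal_iff (by positivity)).1 h2 |>.trans_eq ?_
  ring

/-- The upper estimate for the norm of a finite Haar expansion. -/
theorem exists_norm_sum_haarVec_le {s : ℝ} (hs : s < 0) (hs1 : -1 < s) :
    ∃ C : ℝ, 0 ≤ C ∧ ∀ (c : ℕ → ℝ) (F : Finset ℕ),
      ‖∑ n ∈ F, c n • haarVec s n‖ ≤ C * √(∑ n ∈ F, (haarWeight s n * c n) ^ 2) := by
  obtain ⟨C, hC0, hC⟩ := exists_sum_haarWeight_le hs hs1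
  refine ⟨√C, by positivity, fun c F => ?_⟩
  set u := ∑ n ∈ F, c n • haarVec s n
  have hpair : ∀ φ, pairing u φ = ∑ n ∈ F, c n * ∫ t in (0 : ℝ)..1, haar n t * φ t := by
    intro φ
    rw [← pairingL_apply, map_sum]
    refine Finset.sum_congr rfl fun n _ => ?_
    rw [map_smul, pairingL_apply, represents_haarVec hs.le, smul_eq_mul]
  let L : 𝓓(unitIoo, ℝ) →ₗ[ℝ] ℝ :=
    { toFun := pairing u
      map_add' := fun φ ψ => by
        obtain ⟨g, hg⟩ := ofL2_surjective s u
        rw [← hg]; simp [pairing_ofL2, evalAt_add]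
      map_smul' := fun r φ => by
        obtain ⟨g, hg⟩ := ofL2_surjective s u
        rw [← hg]; simp [pairing_ofL2, evalAt_smul] }
  -- The norm of `u` is read off from its pairings: Cauchy–Schwarz in `ℓ²`, with the weights on the
  -- coefficients and their inverses on the test side.
  obtain ⟨v, hv, hv2⟩ := exists_pairing_eq s L
    (C := √C * √(∑ n ∈ F, (haarWeight s n * c n) ^ 2)) (by positivity) (by
      intro φ
      change |pairing u φ| ≤ _
      rw [hpair]
      have h1 := Finset.sum_mul_sq_le_sq_mul_sq F (fun n => haarWeight s n * c n)
        (fun n => (haarWeight s n)⁻¹ * ∫ t in (0 : ℝ)..1, haar n t * φ t)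
      have h2 : ∀ n, haarWeight s n * c n *
          ((haarWeight s n)⁻¹ * ∫ t in (0 : ℝ)..1, haar n t * φ t) =
          c n * ∫ t in (0 : ℝ)..1, haar n t * φ t := by
        intro n
        have := (haarWeight_pos s n).ne'
        field_simp
      simp_rw [h2] at h1
      rw [← Real.sqrt_sq_eq_abs, ← Real.sqrt_mul hC0,
        ← Real.sqrt_sq (norm_nonneg (evalAt s φ)), ← Real.sqrt_mul (by positivity)]
      refine Real.sqrt_le_sqrt (h1.trans ?_)
      calc _ ≤ (∑ n ∈ F, (haarWeight s n * c n) ^ 2) * (C * ‖evalAt s φ‖ ^ 2) := by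
            gcongr
            exact hC φ F
        _ = _ := by ring)
  have : u = v := pairing_ext fun φ => (hv2 φ).symm
  rwa [this]

/-! ### Smooth approximations of the Haar functions -/

/-- A smooth monotone function which is `0` up to `ε` and `1` from `2ε` on. -/
def smoothStep (ε x : ℝ) : ℝ := Real.smoothTransition ((x - ε) / ε)

theorem smoothStep_monotone {ε : ℝ} (hε : 0 < ε) : Monotone (smoothStep ε) := fun x y h =>
  Real.smoothTransition.monotone (by gcongr)

theorem smoothStep_continuous (ε : ℝ) : Continuous (smoothStep ε) :=
  Real.smoothTransition.continuous.comp (by fun_prop)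

theorem smoothStep_nonneg (ε x : ℝ) : 0 ≤ smoothStep ε x := Real.smoothTransition.nonneg _

theorem smoothStep_le_one (ε x : ℝ) : smoothStep ε x ≤ 1 := Real.smoothTransition.le_one _

theorem smoothStep_eq_zero {ε x : ℝ} (hε : 0 < ε) (h : x ≤ ε) : smoothStep ε x = 0 :=
  Real.smoothTransition.zero_of_nonpos (div_nonpos_of_nonpos_of_nonneg (by linarith) hε.le)

theorem smoothStep_eq_one {ε x : ℝ} (hε : 0 < ε) (h : 2 * ε ≤ x) : smoothStep ε x = 1 :=
  Real.smoothTransition.one_of_one_le (by rw [le_div_iff₀ hε]; linarith)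

/-- By monotonicity the absolute value can be dropped. The integral telescopes to that of the step
over `[1, 1+u]` minus that over `[-u, 0]`, so the bound does not depend on `ε`. -/
theorem lintegral_smoothStep_sub_le {ε : ℝ} (hε : 0 < ε) (hε2 : 2 * ε ≤ 1) {u : ℝ} (hu : 0 ≤ u) :
    ∫⁻ x, ‖smoothStep ε (x - u) - smoothStep ε x‖ₑ ≤ ENNReal.ofReal u := by
  set f := smoothStep ε
  have hf : Continuous f := smoothStep_continuous ε
  have hI : ∀ a b, IntervalIntegrable f volume a b := fun a b => hf.intervalIntegrable a b
  have h1 : ∀ x, ‖f (x - u) - f x‖ₑ =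
      (Ioc 0 (1 + u)).indicator (fun x => ENNReal.ofReal (f x - f (x - u))) x := by
    intro x
    by_cases hx : x ∈ Ioc 0 (1 + u)
    · rw [indicator_of_mem hx, ← enorm_neg, neg_sub,
        Real.enorm_of_nonneg (sub_nonneg.2 (smoothStep_monotone hε (by linarith)))]
    · rw [indicator_of_notMem hx, enorm_eq_zero, sub_eq_zero]
      rw [mem_Ioc, not_and_or, not_lt, not_le] at hx
      rcases hx with hx | hx
      · simp only [f]
        rw [smoothStep_eq_zero hε (by linarith), smoothStep_eq_zero hε (by linarith)]
      · simp only [f]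
        rw [smoothStep_eq_one hε (by linarith), smoothStep_eq_one hε (by linarith)]
  simp_rw [h1]
  have hc : Continuous fun x => f x - f (x - u) := by fun_prop
  have hc' : Continuous fun x => f (x - u) := by fun_prop
  rw [lintegral_indicator measurableSet_Ioc, ← ofReal_integral_eq_lintegral_ofReal]
  · refine ENNReal.ofReal_le_ofReal ?_
    rw [← intervalIntegral.integral_of_le (by linarith), intervalIntegral.integral_sub (hI _ _)
      (hc'.intervalIntegrable _ _),
      intervalIntegral.integral_comp_sub_right (f := f), add_sub_cancel_right,
      ← intervalIntegral.integral_add_adjacent_intervals (hI 0 1) (hI 1 (1 + u)),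
      ← intervalIntegral.integral_add_adjacent_intervals (hI (0 - u) 0) (hI 0 1)]
    have e1 : ∫ x in (1 : ℝ)..(1 + u), f x = u := by
      rw [intervalIntegral.integral_congr (g := fun _ => 1)]
      · simp
      · intro x hx
        rw [uIcc_of_le (by linarith)] at hx
        exact smoothStep_eq_one hε (by linarith [hx.1])
    have e2 : 0 ≤ ∫ x in (0 - u)..0, f x :=
      intervalIntegral.integral_nonneg (by linarith) fun x _ => smoothStep_nonneg _ _
    linarith
  · exact hc.integrableOn_Ioc
  · exact ae_of_all _ fun x => sub_nonneg.2 (smoothStep_monotone hε (by linarith))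

/-- A smooth approximation of the indicator function of `(0,1)`. -/
def smoothBump (ε x : ℝ) : ℝ := smoothStep ε x * smoothStep ε (1 - x)

theorem smoothBump_contDiff (ε : ℝ) : ContDiff ℝ ((⊤ : ℕ∞) : WithTop ℕ∞) (smoothBump ε) := by
  unfold smoothBump smoothStep
  exact (Real.smoothTransition.contDiff.comp (by fun_prop)).mul
    (Real.smoothTransition.contDiff.comp (by fun_prop))

theorem smoothBump_nonneg (ε x : ℝ) : 0 ≤ smoothBump ε x :=
  mul_nonneg (smoothStep_nonneg _ _) (smoothStep_nonneg _ _)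

theorem smoothBump_le_one (ε x : ℝ) : smoothBump ε x ≤ 1 :=
  mul_le_one₀ (smoothStep_le_one _ _) (smoothStep_nonneg _ _) (smoothStep_le_one _ _)

theorem smoothBump_eq_zero {ε x : ℝ} (hε : 0 < ε) (h : x ∉ Ioo ε (1 - ε)) : smoothBump ε x = 0 := by
  rw [mem_Ioo, not_and_or, not_lt, not_lt] at h
  rcases h with h | h
  · rw [smoothBump, smoothStep_eq_zero hε h, zero_mul]
  · rw [smoothBump, smoothStep_eq_zero (x := 1 - x) hε (by linarith), mul_zero]

theorem smoothBump_eq_one {ε x : ℝ} (hε : 0 < ε) (h : x ∈ Icc (2 * ε) (1 - 2 * ε)) :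
    smoothBump ε x = 1 := by
  rw [smoothBump, smoothStep_eq_one hε h.1, smoothStep_eq_one hε (by linarith [h.2]), mul_one]

theorem smoothBump_le_indicator {ε : ℝ} (hε : 0 < ε) (x : ℝ) :
    smoothBump ε x ≤ (Ioc (0 : ℝ) 1).indicator 1 x := by
  by_cases h : x ∈ Ioc (0 : ℝ) 1
  · rw [indicator_of_mem h]; exact smoothBump_le_one _ _
  · rw [indicator_of_notMem h, smoothBump_eq_zero hε]
    exact fun h2 => h ⟨hε.trans h2.1, by linarith [h2.2]⟩

theorem smoothBump_continuous (ε : ℝ) : Continuous (smoothBump ε) := (smoothBump_contDiff ε).continuous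

theorem lintegral_smoothBump_le {ε : ℝ} (hε : 0 < ε) : ∫⁻ x, ‖smoothBump ε x‖ₑ ≤ 1 := by
  calc _ ≤ ∫⁻ x, (Ioc (0 : ℝ) 1).indicator 1 x := by
        refine lintegral_mono fun x => ?_
        rw [Real.enorm_of_nonneg (smoothBump_nonneg _ _)]
        refine (ENNReal.ofReal_le_ofReal (smoothBump_le_indicator hε x)).trans ?_
        by_cases h : x ∈ Ioc (0 : ℝ) 1 <;> simp [h]
    _ = 1 := by rw [lintegral_indicator_one measurableSet_Ioc]; simp

/-- The bound is uniform in `ε`: the mass is at most `1`, and the bump is a product of one rising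
and one falling step, each contributing at most `|u|`. -/
theorem lintegral_smoothBump_sub_le {ε : ℝ} (hε : 0 < ε) (hε2 : 2 * ε ≤ 1) (u : ℝ) :
    ∫⁻ x, ‖smoothBump ε (x - u) - smoothBump ε x‖ₑ ≤ 2 * ENNReal.ofReal (min 1 |u|) := by
  rw [ENNReal.ofReal_min, mul_min, ENNReal.ofReal_one, mul_one]
  have hc := smoothBump_continuous ε
  have hc' : Continuous fun x => smoothBump ε (x - u) := by fun_prop
  refine le_min ?_ ?_
  · calc _ ≤ ∫⁻ x, (‖smoothBump ε (x - u)‖ₑ + ‖smoothBump ε x‖ₑ) :=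
          lintegral_mono fun x => enorm_sub_le
      _ = (∫⁻ x, ‖smoothBump ε x‖ₑ) + ∫⁻ x, ‖smoothBump ε x‖ₑ := by
          rw [lintegral_add_left hc'.measurable.enorm,
            lintegral_sub_right_eq_self (fun x => ‖smoothBump ε x‖ₑ) u]
      _ ≤ 2 := by
          rw [← one_add_one_eq_two]
          exact add_le_add (lintegral_smoothBump_le hε) (lintegral_smoothBump_le hε)
  · have key : ∀ u : ℝ, 0 ≤ u →
        ∫⁻ x, ‖smoothBump ε (x - u) - smoothBump ε x‖ₑ ≤ 2 * ENNReal.ofReal u := by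
      intro u hu
      have hs := smoothStep_continuous ε
      calc _ ≤ ∫⁻ x, (‖smoothStep ε (x - u) - smoothStep ε x‖ₑ +
            ‖smoothStep ε (1 - x) - smoothStep ε (1 - x + u)‖ₑ) := by
            refine lintegral_mono fun x => ?_
            rw [← ofReal_norm, ← ofReal_norm, ← ofReal_norm, ← ENNReal.ofReal_add (norm_nonneg _)
              (norm_nonneg _)]
            refine ENNReal.ofReal_le_ofReal ?_
            simp only [smoothBump, Real.norm_eq_abs]
            rw [show 1 - (x - u) = 1 - x + u by ring]
            have e : smoothStep ε (x - u) * smoothStep ε (1 - x + u) -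
                smoothStep ε x * smoothStep ε (1 - x) =
                (smoothStep ε (x - u) - smoothStep ε x) * smoothStep ε (1 - x + u) -
                (smoothStep ε (1 - x) - smoothStep ε (1 - x + u)) * smoothStep ε x := by ring
            rw [e]
            refine (abs_sub _ _).trans ?_
            rw [abs_mul, abs_mul, abs_of_nonneg (smoothStep_nonneg _ _),
              abs_of_nonneg (smoothStep_nonneg ε x)]
            exact add_le_add (mul_le_of_le_one_right (abs_nonneg _) (smoothStep_le_one _ _))
              (mul_le_of_le_one_right (abs_nonneg _) (smoothStep_le_one _ _))
        _ = (∫⁻ x, ‖smoothStep ε (x - u) - smoothStep ε x‖ₑ) +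
            ∫⁻ x, ‖smoothStep ε (x - u) - smoothStep ε x‖ₑ := by
            rw [lintegral_add_left (by fun_prop)]
            congr 1
            rw [← lintegral_sub_left_eq_self
              (fun x => ‖smoothStep ε (x - u) - smoothStep ε x‖ₑ) (1 + u)]
            refine lintegral_congr fun x => ?_
            congr 3 <;> ring
        _ ≤ _ := by
            rw [two_mul]
            exact add_le_add (lintegral_smoothStep_sub_le hε hε2 hu)
              (lintegral_smoothStep_sub_le hε hε2 hu)
    rcases le_total 0 u with hu | hu
    · rw [abs_of_nonneg hu]; exact key u hu
    · rw [abs_of_nonpos hu]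
      refine le_trans (le_of_eq ?_) (key (-u) (by linarith))
      rw [← lintegral_sub_right_eq_self (fun x => ‖smoothBump ε (x - -u) - smoothBump ε x‖ₑ) u]
      refine lintegral_congr fun x => ?_
      rw [← enorm_neg, neg_sub]
      congr 3
      ring

/-- A smooth approximation of the Haar mother wavelet. -/
def smoothMother (ε x : ℝ) : ℝ := smoothBump ε (2 * x) - smoothBump ε (2 * x - 1)

theorem smoothMother_eq_zero {ε x : ℝ} (hε : 0 < ε) (h : x ∉ Ico (0 : ℝ) 1) :
    smoothMother ε x = 0 := by
  rw [mem_Ico, not_and_or, not_le, not_lt] at h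
  rw [smoothMother, smoothBump_eq_zero hε, smoothBump_eq_zero hε, sub_self] <;>
  · rintro ⟨h1, h2⟩
    rcases h with h | h <;> linarith

theorem abs_smoothMother_le (ε x : ℝ) : |smoothMother ε x| ≤ 1 := by
  rw [smoothMother, abs_le]
  have h1 := smoothBump_nonneg ε (2 * x)
  have h2 := smoothBump_nonneg ε (2 * x - 1)
  have h3 := smoothBump_le_one ε (2 * x)
  have h4 := smoothBump_le_one ε (2 * x - 1)
  constructor <;> linarith

theorem smoothMother_continuous (ε : ℝ) : Continuous (smoothMother ε) := by
  have := smoothBump_continuous ε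
  unfold smoothMother
  fun_prop

theorem lintegral_smoothMother_sub_le {ε : ℝ} (hε : 0 < ε) (hε2 : 2 * ε ≤ 1) (u : ℝ) :
    ∫⁻ x, ‖smoothMother ε (x - u) - smoothMother ε x‖ₑ ≤ 4 * ENNReal.ofReal (min 1 |u|) := by
  have hc := smoothBump_continuous ε
  have h2 : ∀ f : ℝ → ℝ≥0∞, ∫⁻ x, f (2 * x) = 2⁻¹ * ∫⁻ x, f x := by
    intro f
    rw [lintegral_comp_mul_left_real f two_ne_zero]
    congr 1
    rw [abs_of_pos two_pos, ENNReal.ofReal_inv_of_pos two_pos]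
    simp
  set A := ∫⁻ x, ‖smoothBump ε (x - 2 * u) - smoothBump ε x‖ₑ with hA
  have hA' : A ≤ 4 * ENNReal.ofReal (min 1 |u|) := by
    refine (lintegral_smoothBump_sub_le hε hε2 (2 * u)).trans ?_
    have h4 : (4 : ℝ≥0∞) * ENNReal.ofReal (min 1 |u|) =
        2 * (ENNReal.ofReal (2 * min 1 |u|)) := by
      rw [ENNReal.ofReal_mul two_pos.le, ← mul_assoc]
      congr 1
      simp; norm_num
    rw [h4]
    gcongr
    rw [abs_mul, abs_of_pos two_pos, mul_min_of_nonneg _ _ two_pos.le]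
    exact min_le_min (by norm_num) le_rfl
  calc _ ≤ ∫⁻ x, (‖smoothBump ε (2 * x - 2 * u) - smoothBump ε (2 * x)‖ₑ +
        ‖smoothBump ε (2 * x - 1 - 2 * u) - smoothBump ε (2 * x - 1)‖ₑ) := by
        refine lintegral_mono fun x => ?_
        have e : smoothMother ε (x - u) - smoothMother ε x =
            (smoothBump ε (2 * x - 2 * u) - smoothBump ε (2 * x)) -
            (smoothBump ε (2 * x - 1 - 2 * u) - smoothBump ε (2 * x - 1)) := by
          simp only [smoothMother]
          rw [show 2 * (x - u) = 2 * x - 2 * u by ring,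
            show 2 * x - 2 * u - 1 = 2 * x - 1 - 2 * u by ring]
          ring
        rw [e]
        exact enorm_sub_le
    _ = 2⁻¹ * A + 2⁻¹ * A := by
        rw [lintegral_add_left (by fun_prop),
          h2 (fun x => ‖smoothBump ε (x - 2 * u) - smoothBump ε x‖ₑ),
          h2 (fun x => ‖smoothBump ε (x - 1 - 2 * u) - smoothBump ε (x - 1)‖ₑ), hA,
          ← lintegral_sub_right_eq_self
            (fun x => ‖smoothBump ε (x - 2 * u) - smoothBump ε x‖ₑ) 1]
    _ = A := by rw [← add_mul, ENNReal.inv_two_add_inv_two, one_mul]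
    _ ≤ _ := hA'

/-- A smooth approximation of the `n`-th Haar function. -/
def smoothHaar (ε : ℝ) (n : ℕ) (x : ℝ) : ℝ :=
  if n = 0 then smoothBump ε x else
    (2 : ℝ) ^ ((Nat.log 2 n : ℝ) / 2) *
      smoothMother ε (2 ^ Nat.log 2 n * x - (n - 2 ^ Nat.log 2 n : ℕ))

theorem smoothHaar_zero (ε : ℝ) : smoothHaar ε 0 = smoothBump ε := by ext; simp [smoothHaar]

theorem smoothHaar_two_pow_add (ε : ℝ) {j k : ℕ} (hk : k < 2 ^ j) (x : ℝ) :
    smoothHaar ε (2 ^ j + k) x = (2 : ℝ) ^ ((j : ℝ) / 2) * smoothMother ε (2 ^ j * x - k) := by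
  have h0 : 2 ^ j + k ≠ 0 := by positivity
  rw [smoothHaar, if_neg h0, log_two_pow_add hk, Nat.add_sub_cancel_left]

theorem smoothHaar_continuous (ε : ℝ) (n : ℕ) : Continuous (smoothHaar ε n) := by
  have h1 := smoothBump_continuous ε
  have h2 := smoothMother_continuous ε
  unfold smoothHaar
  split_ifs <;> fun_prop

theorem abs_smoothHaar_le (ε : ℝ) (n : ℕ) (x : ℝ) :
    |smoothHaar ε n x| ≤ (2 : ℝ) ^ ((Nat.log 2 n : ℝ) / 2) := by
  rcases eq_or_ne n 0 with rfl | hn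
  · rw [smoothHaar_zero, abs_of_nonneg (smoothBump_nonneg _ _)]
    simpa using smoothBump_le_one ε x
  · obtain ⟨j, k, hk, rfl⟩ := exists_two_pow_add hn
    rw [smoothHaar_two_pow_add ε hk, log_two_pow_add hk, abs_mul, abs_of_pos (by positivity)]
    exact mul_le_of_le_one_right (by positivity) (abs_smoothMother_le _ _)

/-- At a given point at most one wavelet of a level is nonzero. The factor `2` is due to `Nat.log 2
0 = 0`, which puts the scaling function into level `0` together with the index `1`. -/
theorem sum_abs_smoothHaar_le {ε : ℝ} (hε : 0 < ε) (F : Finset ℕ) (j : ℕ)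
    (x : ℝ) : ∑ n ∈ F with Nat.log 2 n = j, |smoothHaar ε n x| ≤ 2 * (2 : ℝ) ^ ((j : ℝ) / 2) := by
  set G : Finset ℕ := {0, 2 ^ j + ⌊2 ^ j * x⌋₊}
  have hzero : ∀ n ∈ F.filter (fun n => Nat.log 2 n = j), n ∉ G → |smoothHaar ε n x| = 0 := by
    intro n hn hnG
    simp only [Finset.mem_filter] at hn
    simp only [G, Finset.mem_insert, Finset.mem_singleton, not_or] at hnG
    obtain ⟨j', k, hk, rfl⟩ := exists_two_pow_add hnG.1
    have hj : j' = j := by rw [← hn.2, log_two_pow_add hk]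
    subst hj
    rw [abs_eq_zero, smoothHaar_two_pow_add ε hk, smoothMother_eq_zero hε, mul_zero]
    rintro ⟨h1, h2⟩
    refine hnG.2 ?_
    congr 1
    symm
    rw [Nat.floor_eq_iff (by have : (0 : ℝ) ≤ k := by positivity
                             linarith)]
    constructor <;> linarith
  rw [← Finset.sum_filter_add_sum_filter_not _ (· ∈ G)]
  rw [Finset.sum_eq_zero (s := (F.filter (fun n => Nat.log 2 n = j)).filter (· ∉ G))
    (fun n hn => hzero n (Finset.mem_filter.1 hn).1 (Finset.mem_filter.1 hn).2), add_zero]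
  calc _ ≤ ∑ n ∈ (F.filter (fun n => Nat.log 2 n = j)).filter (· ∈ G), (2 : ℝ) ^ ((j : ℝ) / 2) := by
        refine Finset.sum_le_sum fun n hn => ?_
        simp only [Finset.mem_filter] at hn
        have := abs_smoothHaar_le ε n x
        rwa [hn.1.2] at this
    _ = ((F.filter (fun n => Nat.log 2 n = j)).filter (· ∈ G)).card * (2 : ℝ) ^ ((j : ℝ) / 2) := by
        simp
    _ ≤ _ := by
        gcongr
        have h1 : ((F.filter (fun n => Nat.log 2 n = j)).filter (· ∈ G)).card ≤ G.card :=
          Finset.card_le_card fun n hn => (Finset.mem_filter.1 hn).2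
        exact_mod_cast h1.trans Finset.card_le_two

theorem lintegral_smoothHaar_sub_le {ε : ℝ} (hε : 0 < ε) (hε2 : 2 * ε ≤ 1) (n : ℕ) (t : ℝ) :
    ∫⁻ x, ‖smoothHaar ε n (x - t) - smoothHaar ε n x‖ₑ ≤
      ENNReal.ofReal (4 * (2 : ℝ) ^ (-(Nat.log 2 n : ℝ) / 2) * min 1 (2 ^ Nat.log 2 n * |t|)) := by
  rcases eq_or_ne n 0 with rfl | hn
  · rw [smoothHaar_zero]
    refine (lintegral_smoothBump_sub_le hε hε2 t).trans ?_
    simp only [Nat.log_zero_right, CharP.cast_eq_zero, neg_zero, zero_div, Real.rpow_zero, mul_one,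
      pow_zero, one_mul]
    rw [ENNReal.ofReal_mul (by norm_num)]
    gcongr
    simp; norm_num
  · obtain ⟨j, k, hk, rfl⟩ := exists_two_pow_add hn
    rw [log_two_pow_add hk]
    simp_rw [smoothHaar_two_pow_add ε hk]
    have h1 : ∀ x, ‖(2 : ℝ) ^ ((j : ℝ) / 2) * smoothMother ε (2 ^ j * (x - t) - k) -
        (2 : ℝ) ^ ((j : ℝ) / 2) * smoothMother ε (2 ^ j * x - k)‖ₑ =
        ENNReal.ofReal ((2 : ℝ) ^ ((j : ℝ) / 2)) *
          (fun y => ‖smoothMother ε (y - k - 2 ^ j * t) - smoothMother ε (y - k)‖ₑ) (2 ^ j * x) := by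
      intro x
      rw [← mul_sub, enorm_mul, Real.enorm_of_nonneg (by positivity)]
      congr 4
      ring
    simp_rw [h1]
    rw [lintegral_const_mul' _ _ ENNReal.ofReal_ne_top,
      lintegral_comp_mul_left_real
        (fun y => ‖smoothMother ε (y - k - 2 ^ j * t) - smoothMother ε (y - k)‖ₑ)
        (by positivity : (2 : ℝ) ^ j ≠ 0),
      lintegral_sub_right_eq_self (fun y => ‖smoothMother ε (y - 2 ^ j * t) - smoothMother ε y‖ₑ) (k : ℝ)]
    calc _ ≤ ENNReal.ofReal ((2 : ℝ) ^ ((j : ℝ) / 2)) * (ENNReal.ofReal |(2 : ℝ) ^ j|⁻¹ *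
          (4 * ENNReal.ofReal (min 1 |2 ^ j * t|))) := by
          gcongr
          exact lintegral_smoothMother_sub_le hε hε2 _
      _ = _ := by
          have h4 : (4 : ℝ≥0∞) = ENNReal.ofReal 4 := by simp
          rw [h4, ← ENNReal.ofReal_mul (by positivity), ← ENNReal.ofReal_mul (by positivity),
            ← ENNReal.ofReal_mul (by positivity)]
          congr 1
          rw [abs_mul, abs_of_pos (by positivity : (0 : ℝ) < 2 ^ j)]
          have h5 : (2 : ℝ) ^ ((j : ℝ) / 2) * (2 ^ j)⁻¹ = 2 ^ (-(j : ℝ) / 2) := by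
            rw [← Real.rpow_natCast, ← Real.rpow_neg (by norm_num), ← Real.rpow_add (by norm_num)]
            congr 1; ring
          rw [← h5]
          ring

theorem lintegral_smoothHaar_le {ε : ℝ} (hε : 0 < ε) (n : ℕ) :
    ∫⁻ x, ‖smoothHaar ε n x‖ₑ ≤ ENNReal.ofReal ((2 : ℝ) ^ (-(Nat.log 2 n : ℝ) / 2)) := by
  rcases eq_or_ne n 0 with rfl | hn
  · rw [smoothHaar_zero]
    simpa using lintegral_smoothBump_le hε
  · obtain ⟨j, k, hk, rfl⟩ := exists_two_pow_add hn
    rw [log_two_pow_add hk]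
    simp_rw [smoothHaar_two_pow_add ε hk]
    have h1 : ∀ x, ‖(2 : ℝ) ^ ((j : ℝ) / 2) * smoothMother ε (2 ^ j * x - k)‖ₑ =
        ENNReal.ofReal ((2 : ℝ) ^ ((j : ℝ) / 2)) *
          (fun y => ‖smoothMother ε (y - k)‖ₑ) (2 ^ j * x) := by
      intro x
      rw [enorm_mul, Real.enorm_of_nonneg (by positivity)]
    simp_rw [h1]
    rw [lintegral_const_mul' _ _ ENNReal.ofReal_ne_top,
      lintegral_comp_mul_left_real (fun y => ‖smoothMother ε (y - k)‖ₑ)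
        (by positivity : (2 : ℝ) ^ j ≠ 0),
      lintegral_sub_right_eq_self (fun y => ‖smoothMother ε y‖ₑ) (k : ℝ)]
    have h2 : ∫⁻ y, ‖smoothMother ε y‖ₑ ≤ 1 := by
      calc _ ≤ ∫⁻ x, (Ico (0 : ℝ) 1).indicator 1 x := by
            refine lintegral_mono fun x => ?_
            by_cases h : x ∈ Ico (0 : ℝ) 1
            · rw [indicator_of_mem h, ← ofReal_norm]
              simpa using abs_smoothMother_le ε x
            · rw [smoothMother_eq_zero hε h]; simp
        _ = 1 := by rw [lintegral_indicator_one measurableSet_Ico]; simp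
    calc _ ≤ ENNReal.ofReal ((2 : ℝ) ^ ((j : ℝ) / 2)) * (ENNReal.ofReal |(2 : ℝ) ^ j|⁻¹ * 1) := by
          gcongr
      _ = _ := by
          rw [mul_one, ← ENNReal.ofReal_mul (by positivity)]
          congr 1
          rw [abs_of_pos (by positivity : (0 : ℝ) < 2 ^ j), ← Real.rpow_natCast,
            ← Real.rpow_neg (by norm_num), ← Real.rpow_add (by norm_num)]
          congr 1; ring

/-! ### The lower estimate for the Haar system -/

/-- Cauchy–Schwarz with weights `p_j` that depend only on the level; bounded overlap within a level
reduces the first factor to `∑ p_j`. The second factor is linear in `|g n|`, so only `L¹` norms are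
needed after integration. -/
theorem sq_sum_mul_le_of_level (F : Finset ℕ) (a g : ℕ → ℝ) {p b : ℕ → ℝ} (hp : ∀ j, 0 < p j)
    (hb : ∀ j, 0 < b j) (hg : ∀ j, ∑ n ∈ F with Nat.log 2 n = j, |g n| ≤ b j) :
    (∑ n ∈ F, a n * g n) ^ 2 ≤ (∑ j ∈ F.image (Nat.log 2), p j) *
      ∑ n ∈ F, b (Nat.log 2 n) / p (Nat.log 2 n) * a n ^ 2 * |g n| := by
  have h1 : (∑ n ∈ F, a n * g n) ^ 2 ≤ (∑ n ∈ F, p (Nat.log 2 n) / b (Nat.log 2 n) * |g n|) *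
      ∑ n ∈ F, b (Nat.log 2 n) / p (Nat.log 2 n) * a n ^ 2 * |g n| := by
    refine Finset.sum_sq_le_sum_mul_sum_of_sq_le_mul F
      (fun n _ => mul_nonneg (div_nonneg (hp _).le (hb _).le) (abs_nonneg _))
      (fun n _ => mul_nonneg (mul_nonneg (div_nonneg (hb _).le (hp _).le) (sq_nonneg _))
        (abs_nonneg _)) fun n _ => le_of_eq ?_
    have e1 := (hp (Nat.log 2 n)).ne'
    have e2 := (hb (Nat.log 2 n)).ne'
    field_simp
    rw [sq_abs]
  refine h1.trans (mul_le_mul_of_nonneg_right ?_ (Finset.sum_nonneg fun n _ =>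
    mul_nonneg (mul_nonneg (div_nonneg (hb _).le (hp _).le) (sq_nonneg _)) (abs_nonneg _)))
  rw [← Finset.sum_fiberwise_of_maps_to (t := F.image (Nat.log 2)) (g := Nat.log 2)
    (fun n hn => Finset.mem_image_of_mem _ hn)]
  refine Finset.sum_le_sum fun j _ => ?_
  calc _ = p j / b j * ∑ n ∈ F with Nat.log 2 n = j, |g n| := by
        rw [Finset.mul_sum]
        refine Finset.sum_congr rfl fun n hn => ?_
        rw [(Finset.mem_filter.1 hn).2]
    _ ≤ p j / b j * b j := mul_le_mul_of_nonneg_left (hg j) (div_nonneg (hp _).le (hb _).le)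
    _ = p j := div_mul_cancel₀ _ (hb j).ne'

theorem lintegral_sq_sum_le_of_level (F : Finset ℕ) (a : ℕ → ℝ) {g : ℕ → ℝ → ℝ} {p b M : ℕ → ℝ}
    (hp : ∀ j, 0 < p j) (hb : ∀ j, 0 < b j) (hgm : ∀ n, Measurable (g n))
    (hg : ∀ x j, ∑ n ∈ F with Nat.log 2 n = j, |g n x| ≤ b j)
    (hgM : ∀ n, ∫⁻ x, ‖g n x‖ₑ ≤ ENNReal.ofReal (M (Nat.log 2 n))) :
    ∫⁻ x, ‖∑ n ∈ F, a n * g n x‖ₑ ^ 2 ≤ ENNReal.ofReal (∑ j ∈ F.image (Nat.log 2), p j) *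
      ∑ n ∈ F, ENNReal.ofReal
        (b (Nat.log 2 n) / p (Nat.log 2 n) * a n ^ 2 * M (Nat.log 2 n)) := by
  have hc : ∀ n, 0 ≤ b (Nat.log 2 n) / p (Nat.log 2 n) * a n ^ 2 := fun n =>
    mul_nonneg (div_nonneg (hb _).le (hp _).le) (sq_nonneg _)
  calc _ ≤ ∫⁻ x, ENNReal.ofReal (∑ j ∈ F.image (Nat.log 2), p j) *
        ∑ n ∈ F, ENNReal.ofReal (b (Nat.log 2 n) / p (Nat.log 2 n) * a n ^ 2) * ‖g n x‖ₑ := by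
        refine lintegral_mono fun x => ?_
        have h := sq_sum_mul_le_of_level F a (fun n => g n x) hp hb (hg x)
        rw [← ofReal_norm, ← ENNReal.ofReal_pow (norm_nonneg _), Real.norm_eq_abs, sq_abs]
        refine (ENNReal.ofReal_le_ofReal h).trans (le_of_eq ?_)
        rw [ENNReal.ofReal_mul (Finset.sum_nonneg fun j _ => (hp j).le),
          ENNReal.ofReal_sum_of_nonneg fun n _ => mul_nonneg (hc n) (abs_nonneg _)]
        congr 1
        refine Finset.sum_congr rfl fun n _ => ?_
        rw [ENNReal.ofReal_mul (hc n), ← Real.norm_eq_abs, ofReal_norm]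
    _ = ENNReal.ofReal (∑ j ∈ F.image (Nat.log 2), p j) *
        ∑ n ∈ F, ENNReal.ofReal (b (Nat.log 2 n) / p (Nat.log 2 n) * a n ^ 2) *
          ∫⁻ x, ‖g n x‖ₑ := by
        rw [lintegral_const_mul' _ _ ENNReal.ofReal_ne_top,
          lintegral_finsetSum _ fun n _ => (hgm n).enorm.const_mul _]
        congr 1
        exact Finset.sum_congr rfl fun n _ => lintegral_const_mul' _ _ ENNReal.ofReal_ne_top
    _ ≤ _ := by
        gcongr with n _
        rw [ENNReal.ofReal_mul (hc n)]
        gcongr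
        exact hgM n

theorem exists_sum_pow_abs_add_le {r : ℝ} (hr : 0 < r) (hr1 : r < 1) :
    ∃ C : ℝ, ∀ (J : Finset ℕ) (m : ℤ), ∑ j ∈ J, r ^ ((j : ℤ) + m).natAbs ≤ C := by
  have hs : Summable fun k : ℤ => r ^ k.natAbs := by
    refine Summable.of_nat_of_neg ?_ ?_ <;>
    · simpa using summable_geometric_of_lt_one hr.le hr1
  refine ⟨∑' k : ℤ, r ^ k.natAbs, fun J m => ?_⟩
  have hinj : Function.Injective fun j : ℕ => (j : ℤ) + m := fun a b h => by simpa using h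
  calc _ = ∑ k ∈ J.map ⟨_, hinj⟩, r ^ k.natAbs := by simp
    _ ≤ _ := hs.sum_le_tsum _ fun k _ => by positivity

/-- With `u = 2^j t` the left side is at most `u^{-σ}` for `u ≥ 1` and `u^{1/2-σ}` for `u < 1`,
hence decays geometrically in both directions exactly because `0 < σ < 1/2`. Rounding `logb 2 t` to
an integer costs the last factor. -/
theorem min_one_sqrt_mul_rpow_le {σ : ℝ} (hσ : 0 < σ) (hσ1 : σ < 1 / 2) {j : ℕ} {t : ℝ}
    (ht : 0 < t) :
    min 1 ((2 ^ j * t) ^ (1 / 2 : ℝ)) * (2 ^ j * t) ^ (-σ) ≤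
      ((2 : ℝ) ^ (-(min σ (1 / 2 - σ)))) ^ ((j : ℤ) + ⌊Real.logb 2 t⌋).natAbs *
        (2 : ℝ) ^ (min σ (1 / 2 - σ)) := by
  set δ := min σ (1 / 2 - σ)
  have hδ1 : δ ≤ σ := min_le_left _ _
  have hδ2 : δ ≤ 1 / 2 - σ := min_le_right _ _
  have hδ : 0 < δ := lt_min hσ (by linarith)
  set τ := Real.logb 2 t
  have ht2 : (2 : ℝ) ^ j * t = 2 ^ ((j : ℝ) + τ) := by
    rw [Real.rpow_add (by norm_num), Real.rpow_natCast, Real.rpow_logb (by norm_num) (by norm_num) ht]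
  have h1 := Int.floor_le τ
  have h2 := Int.lt_floor_add_one τ
  rw [ht2, ← Real.rpow_mul (by norm_num), ← Real.rpow_mul (by norm_num), ← Real.rpow_natCast,
    ← Real.rpow_mul (by norm_num), ← Real.rpow_add (by norm_num)]
  have hcast : ((((j : ℤ) + ⌊τ⌋).natAbs : ℕ) : ℝ) = |(j : ℝ) + ⌊τ⌋| := by
    rw [Nat.cast_natAbs]; push_cast; rfl
  rw [hcast]
  rcases le_or_gt 0 ((j : ℤ) + ⌊τ⌋) with h | h
  · have h' : 0 ≤ (j : ℝ) + ⌊τ⌋ := by exact_mod_cast h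
    rw [abs_of_nonneg h']
    calc _ ≤ 1 * (2 : ℝ) ^ (((j : ℝ) + τ) * -σ) := by gcongr; exact min_le_left _ _
      _ ≤ _ := by
        rw [one_mul]
        apply Real.rpow_le_rpow_of_exponent_le (by norm_num)
        nlinarith
  · have h' : (j : ℝ) + ⌊τ⌋ ≤ -1 := by
      have : (j : ℤ) + ⌊τ⌋ ≤ -1 := by omega
      exact_mod_cast this
    rw [abs_of_nonpos (by linarith)]
    calc _ ≤ (2 : ℝ) ^ (((j : ℝ) + τ) * (1 / 2)) * (2 : ℝ) ^ (((j : ℝ) + τ) * -σ) := by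
          gcongr; exact min_le_right _ _
      _ ≤ _ := by
        rw [← Real.rpow_add (by norm_num)]
        apply Real.rpow_le_rpow_of_exponent_le (by norm_num)
        nlinarith

theorem exists_sum_min_one_sqrt_mul_rpow_le {σ : ℝ} (hσ : 0 < σ) (hσ1 : σ < 1 / 2) :
    ∃ C : ℝ, 0 ≤ C ∧ ∀ (J : Finset ℕ) (t : ℝ), 0 < t →
      ∑ j ∈ J, min 1 ((2 ^ j * t) ^ (1 / 2 : ℝ)) * (2 : ℝ) ^ (-(j * σ)) ≤ C * t ^ σ := by
  have hδ : 0 < min σ (1 / 2 - σ) := lt_min hσ (by linarith)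
  obtain ⟨C, hC⟩ := exists_sum_pow_abs_add_le (r := (2 : ℝ) ^ (-(min σ (1 / 2 - σ))))
    (by positivity) (Real.rpow_lt_one_of_one_lt_of_neg (by norm_num) (by linarith))
  have hC0 : 0 ≤ C := by simpa using hC ∅ 0
  refine ⟨C * 2 ^ (min σ (1 / 2 - σ)), by positivity, fun J t ht => ?_⟩
  calc _ = ∑ j ∈ J, min 1 ((2 ^ j * t) ^ (1 / 2 : ℝ)) * (2 ^ j * t) ^ (-σ) * t ^ σ := by
        refine Finset.sum_congr rfl fun j _ => ?_
        rw [mul_assoc, Real.mul_rpow (z := -σ) (by positivity) ht.le, mul_assoc,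
          ← Real.rpow_add ht,
          neg_add_cancel, Real.rpow_zero, mul_one, ← Real.rpow_natCast,
          ← Real.rpow_mul (by norm_num), mul_neg]
    _ ≤ (∑ j ∈ J, ((2 : ℝ) ^ (-(min σ (1 / 2 - σ)))) ^ ((j : ℤ) + ⌊Real.logb 2 t⌋).natAbs *
        (2 : ℝ) ^ (min σ (1 / 2 - σ))) * t ^ σ := by
        rw [Finset.sum_mul]
        exact Finset.sum_le_sum fun j _ => mul_le_mul_of_nonneg_right
          (min_one_sqrt_mul_rpow_le hσ hσ1 ht) (by positivity)
    _ ≤ _ := by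
        rw [← Finset.sum_mul]
        gcongr
        exact hC _ _

theorem haarWeight_neg_two (s : ℝ) (n : ℕ) :
    (haarWeight s n ^ 2)⁻¹ = (2 : ℝ) ^ (-s * Nat.log 2 n) * (2 : ℝ) ^ (-s * Nat.log 2 n) := by
  rw [haarWeight, ← Real.rpow_add (by norm_num), ← Real.rpow_natCast,
    ← Real.rpow_mul (by norm_num), ← Real.rpow_neg (by norm_num)]
  congr 1
  push_cast
  ring

theorem exists_lintegral_sq_sum_smoothHaar_le {s : ℝ} (hs : s < 0) :
    ∃ C : ℝ, 0 ≤ C ∧ ∀ ε : ℝ, 0 < ε → 2 * ε ≤ 1 → ∀ (F : Finset ℕ) (a : ℕ → ℝ),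
      ∫⁻ x, ‖∑ n ∈ F, a n * smoothHaar ε n x‖ₑ ^ 2 ≤
        ENNReal.ofReal (C * ∑ n ∈ F, (haarWeight s n ^ 2)⁻¹ * a n ^ 2) := by
  have hr : (2 : ℝ) ^ s < 1 := Real.rpow_lt_one_of_one_lt_of_neg (by norm_num) hs
  have hsum : Summable fun j : ℕ => (2 : ℝ) ^ (s * j) := by
    simp_rw [Real.rpow_mul (by norm_num : (0 : ℝ) ≤ 2), Real.rpow_natCast]
    exact summable_geometric_of_lt_one (by positivity) hr
  refine ⟨2 * ∑' j : ℕ, (2 : ℝ) ^ (s * j), mul_nonneg two_pos.le (tsum_nonneg fun j => by positivity),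
    fun ε hε hε2 F a => ?_⟩
  -- The choice `p_j = 2^{sj}` is summable as `s < 0`. The factor `2^{-sj}` it costs is absorbed by
  -- the weight `2^{-2sj}` on the right.
  refine (lintegral_sq_sum_le_of_level F a (p := fun j => (2 : ℝ) ^ (s * j))
    (b := fun j => 2 * (2 : ℝ) ^ ((j : ℝ) / 2)) (M := fun j => (2 : ℝ) ^ (-(j : ℝ) / 2))
    (fun j => by positivity) (fun j => by positivity)
    (fun n => (smoothHaar_continuous ε n).measurable)
    (fun x j => sum_abs_smoothHaar_le hε F j x) (fun n => lintegral_smoothHaar_le hε n)).trans ?_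
  rw [← ENNReal.ofReal_sum_of_nonneg fun n _ => by positivity,
    ← ENNReal.ofReal_mul (Finset.sum_nonneg fun j _ => by positivity)]
  refine ENNReal.ofReal_le_ofReal ?_
  rw [mul_comm 2, mul_assoc]
  refine mul_le_mul (hsum.sum_le_tsum _ fun j _ => by positivity) ?_
    (Finset.sum_nonneg fun n _ => by positivity) (tsum_nonneg fun j => by positivity)
  rw [Finset.mul_sum]
  refine Finset.sum_le_sum fun n _ => ?_
  rw [haarWeight_neg_two]
  set j := Nat.log 2 n
  have e1 : (2 : ℝ) ^ ((j : ℝ) / 2) * (2 : ℝ) ^ (-(j : ℝ) / 2) = 1 := by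
    rw [← Real.rpow_add (by norm_num)]; ring_nf; simp
  have e2 : ((2 : ℝ) ^ (s * j))⁻¹ = (2 : ℝ) ^ (-s * j) := by
    rw [← Real.rpow_neg (by norm_num)]; ring_nf
  have e3 : 1 ≤ (2 : ℝ) ^ (-s * j) :=
    Real.one_le_rpow (by norm_num) (mul_nonneg (by linarith) (by positivity))
  calc 2 * (2 : ℝ) ^ ((j : ℝ) / 2) / (2 : ℝ) ^ (s * j) * a n ^ 2 * (2 : ℝ) ^ (-(j : ℝ) / 2)
      = 2 * (((2 : ℝ) ^ (s * j))⁻¹ * a n ^ 2) *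
        ((2 : ℝ) ^ ((j : ℝ) / 2) * (2 : ℝ) ^ (-(j : ℝ) / 2)) := by ring
    _ = 2 * ((2 : ℝ) ^ (-s * j) * a n ^ 2) := by rw [e1, e2, mul_one]
    _ ≤ _ := by
        gcongr
        exact le_mul_of_one_le_left (by positivity) e3

theorem gagliardo_exponent {σ t : ℝ} (ht : t ≠ 0) :
    rieszKernel (2 * σ) t * ENNReal.ofReal (|t| ^ σ) = rieszKernel σ t := by
  rw [rieszKernel, rieszKernel, ← ENNReal.ofReal_mul (by positivity),
    ← Real.rpow_add (abs_pos.2 ht)]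
  congr 2
  ring

/-- The restriction `s > -1/2` enters here, with `σ = -s`. For a translation by `t` put `m_j =
min(1, (2^j|t|)^{1/2})` and use the level weights `p_j = m_j 2^{-jσ}`, whose sum is at most
`C|t|^σ`. As the `L¹` modulus of a Haar function is `4·2^{-j/2} m_j²`, each term becomes `16·2^{jσ}
m_j a_n²`. Integrating `m_j` against `|t|^{-1-σ}` gives another `2^{jσ}` by homogeneity, in total
the inverse squared weight. -/
theorem exists_gagliardo_sum_smoothHaar_le {s : ℝ} (hs : s < 0) (hs1 : -(1 / 2) < s) :
    ∃ C : ℝ, 0 ≤ C ∧ ∀ ε : ℝ, 0 < ε → 2 * ε ≤ 1 → ∀ (F : Finset ℕ) (a : ℕ → ℝ),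
      gagliardo (2 * -s) (fun x => ∑ n ∈ F, a n * smoothHaar ε n x) ≤
        ENNReal.ofReal (C * ∑ n ∈ F, (haarWeight s n ^ 2)⁻¹ * a n ^ 2) := by
  set σ := -s with hσ
  obtain ⟨C, hC0, hC⟩ := exists_sum_min_one_sqrt_mul_rpow_le (σ := σ) (by linarith) (by linarith)
  have hD := lintegral_rieszKernel_mul_min_lt_top (α := σ) (β := 1 / 2) (by linarith) (by linarith)
  set D := ∫⁻ t, rieszKernel σ t * ENNReal.ofReal (min 1 (|t| ^ (1 / 2 : ℝ))) with hDdef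
  refine ⟨C * (16 * D.toReal), by positivity, fun ε hε hε2 F a => ?_⟩
  have key : ∀ t : ℝ, t ≠ 0 →
      ∫⁻ x, ‖(∑ n ∈ F, a n * smoothHaar ε n (x - t)) - ∑ n ∈ F, a n * smoothHaar ε n x‖ₑ ^ 2 ≤
      ENNReal.ofReal (C * |t| ^ σ) * ∑ n ∈ F, ENNReal.ofReal
        (16 * (2 : ℝ) ^ (σ * Nat.log 2 n) * a n ^ 2) *
          ENNReal.ofReal (min 1 (|2 ^ Nat.log 2 n * t| ^ (1 / 2 : ℝ))) := by
    intro t ht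
    have ht' : 0 < |t| := abs_pos.2 ht
    simp_rw [← Finset.sum_sub_distrib, ← mul_sub]
    have hpos : ∀ j : ℕ, 0 < min 1 (((2 : ℝ) ^ j * |t|) ^ (1 / 2 : ℝ)) := fun j =>
      lt_min one_pos (by positivity)
    refine (lintegral_sq_sum_le_of_level F a
      (g := fun n x => smoothHaar ε n (x - t) - smoothHaar ε n x)
      (p := fun j => min 1 ((2 ^ j * |t|) ^ (1 / 2 : ℝ)) * (2 : ℝ) ^ (-(j * σ)))
      (b := fun j => 4 * (2 : ℝ) ^ ((j : ℝ) / 2))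
      (M := fun j => 4 * (2 : ℝ) ^ (-(j : ℝ) / 2) * min 1 (2 ^ j * |t|))
      (fun j => mul_pos (hpos j) (by positivity)) (fun j => by positivity)
      (fun n => by have := smoothHaar_continuous ε n; fun_prop)
      (fun x j => ?_) (fun n => lintegral_smoothHaar_sub_le hε hε2 n t)).trans ?_
    · calc _ ≤ ∑ n ∈ F with Nat.log 2 n = j, (|smoothHaar ε n (x - t)| + |smoothHaar ε n x|) :=
            Finset.sum_le_sum fun n _ => abs_sub _ _
        _ ≤ _ := by
            rw [Finset.sum_add_distrib]
            linarith [sum_abs_smoothHaar_le hε F j (x - t), sum_abs_smoothHaar_le hε F j x]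
    · refine mul_le_mul' (ENNReal.ofReal_le_ofReal (hC _ _ ht')) (Finset.sum_le_sum fun n _ => ?_)
      rw [← ENNReal.ofReal_mul (by positivity)]
      refine ENNReal.ofReal_le_ofReal (le_of_eq ?_)
      set j := Nat.log 2 n
      rw [abs_mul, abs_of_pos (by positivity : (0 : ℝ) < 2 ^ j)]
      have e1 : (2 : ℝ) ^ ((j : ℝ) / 2) * (2 : ℝ) ^ (-(j : ℝ) / 2) = 1 := by
        rw [← Real.rpow_add (by norm_num)]; ring_nf; simp
      have e2 : ((2 : ℝ) ^ (-(j * σ)))⁻¹ = (2 : ℝ) ^ (σ * j) := by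
        rw [← Real.rpow_neg (by norm_num)]; ring_nf
      -- One of the two square root factors cancels against `p_j`, the other remains for the
      -- integration in `t`.
      have e3 : min 1 (2 ^ j * |t|) = min 1 (((2 : ℝ) ^ j * |t|) ^ (1 / 2 : ℝ)) ^ 2 := by
        have h0 : 0 ≤ (2 : ℝ) ^ j * |t| := by positivity
        rw [← Real.sqrt_eq_rpow]
        rcases le_total 1 (2 ^ j * |t|) with h | h
        · rw [min_eq_left h, min_eq_left (Real.one_le_sqrt.2 h), one_pow]
        · rw [min_eq_right h, min_eq_right (Real.sqrt_le_one.2 h), Real.sq_sqrt h0]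
      rw [e3]
      have hm := (hpos j).ne'
      set m := min 1 (((2 : ℝ) ^ j * |t|) ^ (1 / 2 : ℝ))
      calc _ = 16 * ((2 : ℝ) ^ (-(j * σ)))⁻¹ * a n ^ 2 * (m ^ 2 / m) *
            ((2 : ℝ) ^ ((j : ℝ) / 2) * (2 : ℝ) ^ (-(j : ℝ) / 2)) := by
            field_simp; ring
        _ = _ := by rw [e1, e2]; field_simp
  calc gagliardo (2 * σ) (fun x => ∑ n ∈ F, a n * smoothHaar ε n x)
      ≤ ∫⁻ t, ENNReal.ofReal C * ∑ n ∈ F, ENNReal.ofReal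
        (16 * (2 : ℝ) ^ (σ * Nat.log 2 n) * a n ^ 2) *
          (rieszKernel σ t * (fun y => ENNReal.ofReal (min 1 (|y| ^ (1 / 2 : ℝ))))
            (2 ^ Nat.log 2 n * t)) := by
        refine lintegral_mono_ae ?_
        filter_upwards [show ∀ᵐ t : ℝ, t ≠ 0 by simp [ae_iff]] with t ht
        refine (mul_le_mul_right (key t ht) _).trans (le_of_eq ?_)
        rw [← gagliardo_exponent (σ := σ) ht, ENNReal.ofReal_mul hC0]
        simp only [Finset.mul_sum]
        refine Finset.sum_congr rfl fun n _ => ?_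
        ring
    _ = ENNReal.ofReal C * ∑ n ∈ F, ENNReal.ofReal
        (16 * (2 : ℝ) ^ (σ * Nat.log 2 n) * a n ^ 2) *
          (ENNReal.ofReal (|2 ^ Nat.log 2 n| ^ σ) * D) := by
        rw [lintegral_const_mul' _ _ ENNReal.ofReal_ne_top, lintegral_finsetSum]
        · congr 1
          refine Finset.sum_congr rfl fun n _ => ?_
          rw [lintegral_const_mul' _ _ ENNReal.ofReal_ne_top,
            lintegral_rieszKernel_comp_mul σ (fun y => ENNReal.ofReal (min 1 (|y| ^ (1 / 2 : ℝ))))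
            (by positivity)]
        · intro n _
          have := measurable_rieszKernel σ
          fun_prop
    _ = _ := by
        rw [← ENNReal.ofReal_toReal hD.ne, mul_assoc C, ENNReal.ofReal_mul hC0,
          Finset.mul_sum (a := 16 * _), ENNReal.ofReal_sum_of_nonneg fun n _ => by positivity]
        congr 1
        refine Finset.sum_congr rfl fun n _ => ?_
        rw [← ENNReal.ofReal_mul (by positivity), ← ENNReal.ofReal_mul (by positivity)]
        congr 1
        have e4 : ((2 : ℝ) ^ Nat.log 2 n) ^ σ = 2 ^ (σ * Nat.log 2 n) := by
          rw [← Real.rpow_natCast, ← Real.rpow_mul (by norm_num), mul_comm]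
        rw [haarWeight_neg_two, abs_of_pos (by positivity), e4,
          ENNReal.toReal_ofReal ENNReal.toReal_nonneg]
        ring

theorem smoothHaar_contDiff (ε : ℝ) (n : ℕ) :
    ContDiff ℝ ((⊤ : ℕ∞) : WithTop ℕ∞) (smoothHaar ε n) := by
  have h := smoothBump_contDiff ε
  unfold smoothHaar smoothMother
  split_ifs
  · exact h
  · exact contDiff_const.mul ((h.comp (by fun_prop)).sub (h.comp (by fun_prop)))

theorem smoothHaar_eq_zero {ε : ℝ} (hε : 0 < ε) {n : ℕ} {x : ℝ}
    (h : x ∉ Icc (ε / 2 / 2 ^ Nat.log 2 n) (1 - ε / 2 / 2 ^ Nat.log 2 n)) :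
    smoothHaar ε n x = 0 := by
  contrapose! h
  rcases eq_or_ne n 0 with rfl | hn
  · rw [smoothHaar_zero] at h
    have h' : x ∈ Ioo ε (1 - ε) := by_contra fun h2 => h (smoothBump_eq_zero hε h2)
    simp only [Nat.log_zero_right, pow_zero, div_one]
    constructor <;> linarith [h'.1, h'.2]
  · obtain ⟨j, k, hk, rfl⟩ := exists_two_pow_add hn
    rw [smoothHaar_two_pow_add ε hk] at h
    rw [log_two_pow_add hk]
    have hy : 2 ^ j * x - k ∈ Icc (ε / 2) (1 - ε / 2) := by
      by_contra h2
      refine h ?_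
      rw [smoothMother, smoothBump_eq_zero hε, smoothBump_eq_zero hε, sub_self, mul_zero] <;>
      · rintro ⟨h3, h4⟩
        exact h2 ⟨by linarith, by linarith⟩
    have hk0 : (0 : ℝ) ≤ k := by positivity
    have hk1 : (k : ℝ) + 1 ≤ 2 ^ j := by exact_mod_cast hk
    have h2j : (0 : ℝ) < 2 ^ j := by positivity
    constructor
    · rw [div_le_iff₀ h2j]; linarith [hy.1]
    · rw [le_sub_comm, div_le_iff₀ h2j]; linarith [hy.2]

theorem tsupport_smoothHaar_subset {ε : ℝ} (hε : 0 < ε) (n : ℕ) :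
    tsupport (smoothHaar ε n) ⊆
      Icc (ε / 2 / 2 ^ Nat.log 2 n) (1 - ε / 2 / 2 ^ Nat.log 2 n) :=
  closure_minimal (Function.support_subset_iff'.2 fun _ h => smoothHaar_eq_zero hε h) isClosed_Icc

/-- The smooth Haar functions as test functions. -/
def smoothHaarTest {ε : ℝ} (hε : 0 < ε) (n : ℕ) : 𝓓(unitIoo, ℝ) where
  toFun := smoothHaar ε n
  contDiff' := smoothHaar_contDiff ε n
  hasCompactSupport' :=
    isCompact_Icc.of_isClosed_subset (isClosed_tsupport _) (tsupport_smoothHaar_subset hε n)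
  tsupport_subset' := (tsupport_smoothHaar_subset hε n).trans fun x hx => by
    have : 0 < ε / 2 / 2 ^ Nat.log 2 n := by positivity
    exact ⟨by linarith [hx.1], by linarith [hx.2]⟩

theorem coe_sum_smoothHaarTest {ε : ℝ} (hε : 0 < ε) (F : Finset ℕ) (a : ℕ → ℝ) (x : ℝ) :
    (∑ n ∈ F, a n • smoothHaarTest hε n) x = ∑ n ∈ F, a n * smoothHaar ε n x := by
  induction F using Finset.cons_induction with
  | empty => simp
  | cons n F hn ih =>
    rw [Finset.sum_cons, Finset.sum_cons, FunLike.coe_add, Pi.add_apply, ih]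
    rfl

theorem smoothBump_eventuallyEq (x : ℝ) :
    ∀ᶠ ε in 𝓝[>] (0 : ℝ), smoothBump ε x = (Ioo (0 : ℝ) 1).indicator 1 x := by
  by_cases hx : x ∈ Ioo (0 : ℝ) 1
  · have h1 : ∀ᶠ ε in 𝓝[>] (0 : ℝ), ε < x / 2 :=
      nhdsWithin_le_nhds (gt_mem_nhds (by linarith [hx.1]))
    have h2 : ∀ᶠ ε in 𝓝[>] (0 : ℝ), ε < (1 - x) / 2 :=
      nhdsWithin_le_nhds (gt_mem_nhds (by linarith [hx.2]))
    filter_upwards [h1, h2, self_mem_nhdsWithin] with ε h1 h2 hε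
    rw [indicator_of_mem hx, smoothBump_eq_one hε ⟨by linarith, by linarith⟩, Pi.one_apply]
  · filter_upwards [self_mem_nhdsWithin] with ε hε
    have hε' : (0 : ℝ) < ε := hε
    rw [indicator_of_notMem hx, smoothBump_eq_zero hε]
    exact fun h => hx ⟨hε'.trans h.1, by linarith [h.2]⟩

theorem smoothMother_eventuallyEq {x : ℝ} (h0 : x ≠ 0) (h1 : x ≠ 1 / 2) :
    ∀ᶠ ε in 𝓝[>] (0 : ℝ), smoothMother ε x = haarMother x := by
  filter_upwards [smoothBump_eventuallyEq (2 * x), smoothBump_eventuallyEq (2 * x - 1)]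
    with ε e1 e2
  rw [smoothMother, e1, e2]
  simp only [haarMother, indicator_apply, mem_Ioo, Pi.one_apply]
  have h0' := lt_or_gt_of_ne h0
  have h1' := lt_or_gt_of_ne h1
  split_ifs <;> grind

theorem ae_smoothHaar_eventuallyEq (n : ℕ) :
    ∀ᵐ x : ℝ, ∀ᶠ ε in 𝓝[>] (0 : ℝ), smoothHaar ε n x = haar n x := by
  rcases eq_or_ne n 0 with rfl | hn
  · filter_upwards [show ∀ᵐ x : ℝ, x ≠ 0 by simp [ae_iff]] with x hx
    filter_upwards [smoothBump_eventuallyEq x] with ε h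
    rw [smoothHaar_zero, h, haar_zero, haarScaling_eq]
    simp only [indicator_apply, mem_Ioo, mem_Ico]
    have h0' := lt_or_gt_of_ne hx
    split_ifs <;> grind
  · obtain ⟨j, k, hk, rfl⟩ := exists_two_pow_add hn
    have h2j : (2 : ℝ) ^ j ≠ 0 := by positivity
    filter_upwards [show ∀ᵐ x : ℝ, x ≠ k / 2 ^ j by simp [ae_iff],
      show ∀ᵐ x : ℝ, x ≠ (k + 1 / 2) / 2 ^ j by simp [ae_iff]] with x hx hx'
    rw [Ne, eq_div_iff h2j] at hx hx'
    have h0 : 2 ^ j * x - k ≠ 0 := fun h => hx (by linarith)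
    have h1 : 2 ^ j * x - k ≠ 1 / 2 := fun h => hx' (by linarith)
    filter_upwards [smoothMother_eventuallyEq h0 h1] with ε h
    rw [smoothHaar_two_pow_add ε hk, haar_two_pow_add hk, h, haarWavelet]

theorem tendsto_integral_haar_mul_smoothHaar (n m : ℕ) :
    Tendsto (fun ε => ∫ x in (0 : ℝ)..1, haar n x * smoothHaar ε m x) (𝓝[>] 0)
      (𝓝 (if n = m then 1 else 0)) := by
  rw [← integral_haar_mul_haar]
  obtain ⟨C, hC⟩ := exists_abs_haar_le n
  refine intervalIntegral.tendsto_integral_filter_of_dominated_convergence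
    (fun _ => C * (2 : ℝ) ^ ((Nat.log 2 m : ℝ) / 2)) ?_ ?_ intervalIntegrable_const ?_
  · exact .of_forall fun ε =>
      ((measurable_haar n).mul (smoothHaar_continuous ε m).measurable).aestronglyMeasurable
  · refine .of_forall fun ε => ae_of_all _ fun x _ => ?_
    rw [norm_mul]
    exact mul_le_mul (hC x) (abs_smoothHaar_le ε m x) (norm_nonneg _) ((abs_nonneg _).trans (hC x))
  · filter_upwards [ae_smoothHaar_eventuallyEq m] with x hx _
    exact tendsto_const_nhds.congr' (hx.mono fun ε h => by simp [h])

theorem exists_norm_evalAt_smoothHaar_le {s : ℝ} (hs : s < 0) (hs1 : -(1 / 2) < s) :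
    ∃ C : ℝ, 0 ≤ C ∧ ∀ (ε : ℝ) (hε : 0 < ε), 2 * ε ≤ 1 → ∀ (F : Finset ℕ) (a : ℕ → ℝ),
      ‖evalAt s (∑ n ∈ F, a n • smoothHaarTest hε n)‖ ^ 2 ≤
        C * ∑ n ∈ F, (haarWeight s n ^ 2)⁻¹ * a n ^ 2 := by
  obtain ⟨C₁, h₁, hC₁⟩ := exists_lintegral_sq_sum_smoothHaar_le hs
  obtain ⟨C₂, h₂, hC₂⟩ := exists_gagliardo_sum_smoothHaar_le hs hs1
  set κ := (gagliardoConst (2 * -s))⁻¹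
  have hκ : κ ≠ ∞ := ENNReal.inv_ne_top.2 (gagliardoConst_pos _).ne'
  refine ⟨C₁ + κ.toReal * C₂, by positivity, fun ε hε hε2 F a => ?_⟩
  set Q := ∑ n ∈ F, (haarWeight s n ^ 2)⁻¹ * a n ^ 2
  have hQ : 0 ≤ Q := Finset.sum_nonneg fun n _ => by positivity
  have h := norm_evalAt_le hs (by linarith) (∑ n ∈ F, a n • smoothHaarTest hε n)
  have hcoe : ⇑(∑ n ∈ F, a n • smoothHaarTest hε n) =
    fun x => ∑ n ∈ F, a n * smoothHaar ε n x := funext (coe_sum_smoothHaarTest hε F a)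
  rw [hcoe] at h
  have h3 := h.trans (add_le_add (hC₁ ε hε hε2 F a) (mul_le_mul_right (hC₂ ε hε hε2 F a) _))
  change _ ≤ ENNReal.ofReal (C₁ * Q) + κ * ENNReal.ofReal (C₂ * Q) at h3
  rw [← ENNReal.ofReal_toReal hκ, ← ENNReal.ofReal_mul ENNReal.toReal_nonneg,
    ← ENNReal.ofReal_add (by positivity) (by positivity)] at h3
  refine ((ENNReal.ofReal_le_ofReal_iff (by positivity)).1 h3).trans (le_of_eq ?_)
  ring

/-- Haar functions are not test functions, so `u` is tested against the smoothed sum with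
coefficients `w_n² c_n`. As `ε → 0` the pairing tends to `S = ∑ (w_n c_n)²`, while the dual norm
stays below `√(C S)`; this gives `S ≤ ‖u‖ √(C S)`. -/
theorem exists_sum_haarWeight_le_norm {s : ℝ} (hs : s < 0) (hs1 : -(1 / 2) < s) :
    ∃ C : ℝ, 0 ≤ C ∧ ∀ (c : ℕ → ℝ) (F : Finset ℕ),
      √(∑ n ∈ F, (haarWeight s n * c n) ^ 2) ≤ C * ‖∑ n ∈ F, c n • haarVec s n‖ := by
  obtain ⟨C, hC0, hC⟩ := exists_norm_evalAt_smoothHaar_le hs hs1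
  refine ⟨√C, by positivity, fun c F => ?_⟩
  set u := ∑ n ∈ F, c n • haarVec s n
  set S := ∑ n ∈ F, (haarWeight s n * c n) ^ 2
  have hS : 0 ≤ S := Finset.sum_nonneg fun n _ => sq_nonneg _
  set a : ℕ → ℝ := fun n => haarWeight s n ^ 2 * c n
  have hQ : ∑ n ∈ F, (haarWeight s n ^ 2)⁻¹ * a n ^ 2 = S := by
    refine Finset.sum_congr rfl fun n _ => ?_
    have := (haarWeight_pos s n).ne'
    simp only [a]
    field_simp
  have hbound : ∀ (ε : ℝ) (hε : 0 < ε), 2 * ε ≤ 1 →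
      ∑ n ∈ F, c n * ∑ m ∈ F, a m * ∫ x in (0 : ℝ)..1, haar n x * smoothHaar ε m x ≤
        ‖u‖ * √(C * S) := by
    intro ε hε hε2
    set v := ∑ n ∈ F, a n • smoothHaarTest hε n
    have h1 : pairing u v =
        ∑ n ∈ F, c n * ∑ m ∈ F, a m * ∫ x in (0 : ℝ)..1, haar n x * smoothHaar ε m x := by
      rw [← pairingL_apply, map_sum]
      refine Finset.sum_congr rfl fun n _ => ?_
      rw [map_smul, smul_eq_mul, pairingL_apply, represents_haarVec hs.le]
      congr 1
      simp_rw [v, coe_sum_smoothHaarTest, Finset.mul_sum]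
      rw [intervalIntegral.integral_finsetSum]
      · refine Finset.sum_congr rfl fun m _ => ?_
        rw [← intervalIntegral.integral_const_mul]
        refine intervalIntegral.integral_congr fun x _ => ?_
        ring
      · intro m _
        exact (intervalIntegrable_haar n 0 1).mul_continuousOn
          (by have := smoothHaar_continuous ε m; fun_prop)
    rw [← h1]
    refine ((le_abs_self _).trans (abs_pairing_le u v)).trans ?_
    gcongr
    refine Real.le_sqrt_of_sq_le ?_
    rw [← hQ]
    exact hC ε hε hε2 F a
  have hlim : Tendsto (fun ε => ∑ n ∈ F, c n * ∑ m ∈ F, a m *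
      ∫ x in (0 : ℝ)..1, haar n x * smoothHaar ε m x) (𝓝[>] 0) (𝓝 S) := by
    have h : S = ∑ n ∈ F, c n * ∑ m ∈ F, a m * (if n = m then 1 else 0) := by
      refine Finset.sum_congr rfl fun n hn => ?_
      simp [hn, a]
      ring
    rw [h]
    exact tendsto_finsetSum _ fun n _ => Tendsto.const_mul _ (tendsto_finsetSum _ fun m _ =>
      Tendsto.const_mul _ (tendsto_integral_haar_mul_smoothHaar n m))
  have hle : S ≤ ‖u‖ * √(C * S) := by
    refine le_of_tendsto hlim ?_
    have h1 : ∀ᶠ ε in 𝓝[>] (0 : ℝ), ε < 1 / 2 := nhdsWithin_le_nhds (gt_mem_nhds (by norm_num))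
    filter_upwards [h1, self_mem_nhdsWithin] with ε h1 hε
    exact hbound ε hε (by linarith)
  rcases hS.eq_or_lt with h0 | h0
  · rw [← h0, Real.sqrt_zero]; positivity
  · have hpos : 0 < √S := Real.sqrt_pos.2 h0
    rw [Real.sqrt_mul hC0] at hle
    nth_rewrite 1 [← Real.mul_self_sqrt hS] at hle
    refine le_of_mul_le_mul_right (hle.trans (le_of_eq ?_)) hpos
    ring

/-! ### Riesz bases -/

section RieszBasis

variable {E : Type*} [NormedAddCommGroup E] [NormedSpace ℝ E] [CompleteSpace E]

theorem summable_smul_of_norm_sum_le {v : ℕ → E} {C : ℝ} (hC0 : 0 ≤ C)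
    (hC : ∀ (c : ℕ → ℝ) (F : Finset ℕ), ‖∑ n ∈ F, c n • v n‖ ≤ C * √(∑ n ∈ F, c n ^ 2))
    {c : ℕ → ℝ} (hc : Summable fun n => c n ^ 2) : Summable fun n => c n • v n := by
  rw [summable_iff_vanishing_norm]
  intro ε hε
  obtain ⟨s, hs⟩ := (summable_iff_vanishing_norm.1 hc) ((ε / (C + 1)) ^ 2) (by positivity)
  refine ⟨s, fun t ht => (hC c t).trans_lt ?_⟩
  have h1 := hs t ht
  rw [Real.norm_of_nonneg (Finset.sum_nonneg fun n _ => sq_nonneg _)] at h1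
  have h2 : √(∑ n ∈ t, c n ^ 2) < ε / (C + 1) := by
    rw [Real.sqrt_lt' (by positivity)]; exact h1
  calc _ ≤ (C + 1) * √(∑ n ∈ t, c n ^ 2) := by gcongr; linarith
    _ < (C + 1) * (ε / (C + 1)) := by gcongr
    _ = ε := by field_simp

theorem norm_lp_two (f : lp (fun _ : ℕ => ℝ) 2) : HasSum (fun n => f n ^ 2) (‖f‖ ^ 2) := by
  have h := lp.hasSum_norm (p := 2) (by norm_num) f
  simpa using h

/-- The synthesis map is bounded by the first estimate and bounded below by the second, hence
injective with closed range. Its range contains all `v n`, so density makes it onto. -/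
theorem exists_lp_equiv {v : ℕ → E} {C C' : ℝ} (hC0 : 0 ≤ C) (hC0' : 0 ≤ C')
    (hC : ∀ (c : ℕ → ℝ) (F : Finset ℕ), ‖∑ n ∈ F, c n • v n‖ ≤ C * √(∑ n ∈ F, c n ^ 2))
    (hC' : ∀ (c : ℕ → ℝ) (F : Finset ℕ), √(∑ n ∈ F, c n ^ 2) ≤ C' * ‖∑ n ∈ F, c n • v n‖)
    (hd : Dense (Submodule.span ℝ (range v) : Set E)) :
    ∃ T : lp (fun _ : ℕ => ℝ) 2 ≃L[ℝ] E, ∀ f, HasSum (fun n => f n • v n) (T f) := by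
  have hsum : ∀ f : lp (fun _ : ℕ => ℝ) 2, Summable fun n => f n • v n := fun f =>
    summable_smul_of_norm_sum_le hC0 hC (norm_lp_two f).summable
  have hsqrt : ∀ f : lp (fun _ : ℕ => ℝ) 2,
      Tendsto (fun F : Finset ℕ => √(∑ n ∈ F, f n ^ 2)) atTop (𝓝 ‖f‖) := fun f => by
    have := (norm_lp_two f).sqrt
    rwa [Real.sqrt_sq (norm_nonneg _)] at this
  let T₀ : lp (fun _ : ℕ => ℝ) 2 →ₗ[ℝ] E :=
    { toFun := fun f => ∑' n, f n • v n
      map_add' := fun f g => by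
        rw [← (hsum f).tsum_add (hsum g)]
        simp [add_smul]
      map_smul' := fun a f => by
        rw [RingHom.id_apply, ← (hsum f).tsum_const_smul]
        simp [mul_smul] }
  have hT₀ : ∀ f, HasSum (fun n => f n • v n) (T₀ f) := fun f => (hsum f).hasSum
  let T₁ : lp (fun _ : ℕ => ℝ) 2 →L[ℝ] E := T₀.mkContinuous C fun f =>
    le_of_tendsto_of_tendsto (hT₀ f).norm ((hsqrt f).const_mul C) (.of_forall fun F => hC _ F)
  have hlow : ∀ f, ‖f‖ ≤ C' * ‖T₁ f‖ := fun f =>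
    le_of_tendsto_of_tendsto (hsqrt f) ((hT₀ f).norm.const_mul C') (.of_forall fun F => hC' _ F)
  have hanti : AntilipschitzWith ⟨C', hC0'⟩ T₁ :=
    AddMonoidHomClass.antilipschitz_of_bound T₁ hlow
  have hclosed : IsClosed (range T₁) := hanti.isClosed_range T₁.uniformContinuous
  have hv : ∀ n, v n ∈ T₁.range := fun n => by
    refine ⟨lp.single 2 n 1, ?_⟩
    have h1 := hT₀ (lp.single 2 n 1)
    have h2 : HasSum (fun m => (lp.single (E := fun _ : ℕ => ℝ) 2 n 1) m • v m)
        ((lp.single (E := fun _ : ℕ => ℝ) 2 n 1) n • v n) :=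
      hasSum_single n fun m hm => by simp [hm]
    have h3 := h1.unique h2
    simp only [lp.single_apply_self, one_smul] at h3
    exact h3
  have hrange : T₁.range = ⊤ := by
    have h1 : Submodule.span ℝ (range v) ≤ T₁.range := Submodule.span_le.2 (range_subset_iff.2 hv)
    have h2 : Dense (range T₁) := hd.mono h1
    exact SetLike.coe_injective (hclosed.closure_eq.symm.trans h2.closure_eq)
  refine ⟨ContinuousLinearEquiv.ofBijective T₁ ?_ hrange, fun f => ?_⟩
  · exact LinearMap.ker_eq_bot.2 hanti.injective
  · exact hT₀ f

end RieszBasis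

/-! ### Density of the Haar functions -/

theorem dyadicIncr_sub_eq {M : Type*} [AddCommGroup M] (J k : ℕ) (G : ℝ → M) :
    dyadicIncr J k G = G (dyadic J (k + 1)) - G (dyadic J k) := rfl

theorem pairing_dyadicIncr_stepVec {s : ℝ} (hs : s ≤ 0) {J k : ℕ} (hk : k < 2 ^ J)
    (φ : 𝓓(unitIoo, ℝ)) : pairing (dyadicIncr J k (stepVec s)) φ =
      ∫ x in (0 : ℝ)..1, (Ico (dyadic J k) (dyadic J (k + 1))).indicator 1 x * φ x := by
  have hI : ∀ a b, IntervalIntegrable φ volume a b :=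
    fun a b => (integrable_testFunction φ).intervalIntegrable
  rw [dyadicIncr_sub_eq, ← pairingL_apply, map_sub, pairingL_apply, pairingL_apply,
    pairing_stepVec hs (dyadic_nonneg _ _) (dyadic_le_one hk),
    pairing_stepVec hs (dyadic_nonneg _ _) (dyadic_le_one hk.le),
    integral_indicator_Ico_mul (hI 0 1) (dyadic_nonneg _ _) (dyadic_mono _ k.le_succ)
      (dyadic_le_one hk), intervalIntegral.integral_interval_sub_left (hI _ _) (hI _ _)]

theorem abs_sub_sum_dyadicIncr_le {f : ℝ → ℝ} (hf : Continuous f) {ε δ : ℝ}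
    (hδ : ∀ x ∈ Icc (0 : ℝ) 1, ∀ y ∈ Icc (0 : ℝ) 1, |x - y| < δ → |f x - f y| ≤ ε) {J : ℕ}
    (hJ : 1 / 2 ^ J < δ) {x : ℝ} (hx : x ∈ Ico (0 : ℝ) 1) :
    |f x - 2 ^ J * ∑ k ∈ Finset.range (2 ^ J), dyadicIncr J k (fun t => ∫ y in (0 : ℝ)..t, f y) *
      (Ico (dyadic J k) (dyadic J (k + 1))).indicator 1 x| ≤ ε := by
  set k := ⌊2 ^ J * x⌋₊
  have h2J : (0 : ℝ) < 2 ^ J := by positivity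
  have hx0 : 0 ≤ 2 ^ J * x := mul_nonneg h2J.le hx.1
  have hk : k < 2 ^ J := by
    rw [Nat.floor_lt hx0]; push_cast; nlinarith [hx.2]
  have hxk : x ∈ Ico (dyadic J k) (dyadic J (k + 1)) := by
    constructor
    · rw [dyadic, div_le_iff₀ h2J, mul_comm]; exact Nat.floor_le hx0
    · rw [dyadic, lt_div_iff₀ h2J, mul_comm]; push_cast; exact Nat.lt_floor_add_one _
  have hlen : dyadic J (k + 1) - dyadic J k = 1 / 2 ^ J := by
    simp only [dyadic]; push_cast; ring
  -- Only the dyadic interval containing `x` contributes, and there the sum is the mean of `f` over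
  -- that interval.
  rw [Finset.sum_eq_single k]
  · rw [indicator_of_mem hxk, Pi.one_apply, mul_one, dyadicIncr_sub_eq,
      intervalIntegral.integral_interval_sub_left (hf.intervalIntegrable _ _)
        (hf.intervalIntegrable _ _)]
    have h1 : f x - 2 ^ J * ∫ y in dyadic J k..dyadic J (k + 1), f y =
        2 ^ J * ∫ y in dyadic J k..dyadic J (k + 1), (f x - f y) := by
      rw [intervalIntegral.integral_sub (by simp) (hf.intervalIntegrable _ _),
        intervalIntegral.integral_const, hlen, smul_eq_mul]
      field_simp
    rw [h1, abs_mul, abs_of_pos h2J]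
    have h2 : ‖∫ y in dyadic J k..dyadic J (k + 1), (f x - f y)‖ ≤
        ε * |dyadic J (k + 1) - dyadic J k| := by
      refine intervalIntegral.norm_integral_le_of_norm_le_const fun y hy => ?_
      rw [uIoc_of_le (dyadic_mono _ k.le_succ)] at hy
      refine hδ x ⟨hx.1, hx.2.le⟩ y ⟨(dyadic_nonneg _ _).trans hy.1.le,
        hy.2.trans (dyadic_le_one hk)⟩ ?_
      rw [abs_lt]
      constructor <;> linarith [hxk.1, hxk.2, hy.1, hy.2]
    rw [hlen, abs_of_pos (by positivity), Real.norm_eq_abs] at h2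
    calc _ ≤ 2 ^ J * (ε * (1 / 2 ^ J)) := by gcongr
      _ = ε := by field_simp
  · intro m _ hm
    rw [indicator_of_notMem, mul_zero]
    intro h
    exact hm (floor_of_mem_Ico_dyadic h).symm
  · intro h
    exact absurd (Finset.mem_range.2 hk) h

/-- The Haar sum over `n < 2^J` is, by Parseval, the function of dyadic averages of `f`. Uniform
continuity makes it uniformly close on `[0,1)`, and the `L²` norm controls the norm of `E`. -/
theorem ofFun_mem_closure_span {s : ℝ} (hs : s ≤ 0) {f : ℝ → ℝ} (hf : Continuous f) :
    ofFun s f ∈ closure (Submodule.span ℝ (range (haarVec s)) : Set (Besov s)) := by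
  rw [Metric.mem_closure_iff]
  intro ε hε
  have huc := isCompact_Icc.uniformContinuousOn_of_continuous (s := Icc (0 : ℝ) 1) hf.continuousOn
  rw [Metric.uniformContinuousOn_iff] at huc
  obtain ⟨δ, hδ, hδf⟩ := huc (ε / 2) (by positivity)
  obtain ⟨J, hJ⟩ := exists_pow_lt_of_lt_one hδ (by norm_num : (1 / 2 : ℝ) < 1)
  rw [one_div_pow] at hJ
  set G : ℝ → ℝ := fun t => ∫ y in (0 : ℝ)..t, f y
  set g : ℝ → ℝ := fun x => f x - 2 ^ J * ∑ k ∈ Finset.range (2 ^ J), dyadicIncr J k G *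
      (Ico (dyadic J k) (dyadic J (k + 1))).indicator 1 x
  have hg : ∀ x ∈ Ico (0 : ℝ) 1, |g x| ≤ ε / 2 := fun x hx =>
    abs_sub_sum_dyadicIncr_le hf (fun x hx y hy hxy => (hδf x hx y hy hxy).le) hJ hx
  have hgm : Measurable g := by
    refine hf.measurable.sub (measurable_const.mul (Finset.measurable_sum _ fun k _ => ?_))
    exact measurable_const.mul (measurable_one.indicator measurableSet_Ico)
  have hgae : ∀ᵐ x ∂(volume : Measure ℝ).restrict (Ioc 0 1), ‖g x‖ ≤ ε / 2 := by
    rw [ae_restrict_iff' measurableSet_Ioc]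
    filter_upwards [show ∀ᵐ x : ℝ, x ≠ 1 by simp [ae_iff]] with x hx hx'
    exact hg x ⟨hx'.1.le, lt_of_le_of_ne hx'.2 hx⟩
  have hgL : MemLp g 2 ((volume : Measure ℝ).restrict (Ioc 0 1)) :=
    MemLp.of_bound hgm.aestronglyMeasurable _ hgae
  have hfL : MemLp f 2 ((volume : Measure ℝ).restrict (Ioc 0 1)) := by
    obtain ⟨C, hC⟩ := isCompact_Icc.exists_bound_of_continuousOn (s := Icc (0 : ℝ) 1)
      hf.continuousOn
    refine MemLp.of_bound hf.aestronglyMeasurable C ?_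
    rw [ae_restrict_iff' measurableSet_Ioc]
    exact ae_of_all _ fun x hx => hC x ⟨hx.1.le, hx.2⟩
  refine ⟨∑ n ∈ Finset.range (2 ^ J), haarCoef n G • haarVec s n,
    Submodule.sum_mem _ fun n _ => Submodule.smul_mem _ _ (Submodule.subset_span ⟨n, rfl⟩), ?_⟩
  have hsplit : ofFun s f - ∑ n ∈ Finset.range (2 ^ J), haarCoef n G • haarVec s n =
      ofFun s g := by
    refine pairing_ext fun φ => ?_
    simp_rw [haarVec_eq_haarCoef hs]
    rw [sum_haarCoef_smul, represents_ofFun hs hgL, ← pairingL_apply, map_sub, map_smul, map_sum,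
      pairingL_apply, represents_ofFun hs hfL, smul_eq_mul]
    simp_rw [map_smul, pairingL_apply]
    rw [Finset.sum_congr rfl fun k hk => by
      rw [pairing_dyadicIncr_stepVec hs (Finset.mem_range.1 hk), smul_eq_mul,
        ← intervalIntegral.integral_const_mul]]
    have hint : ∀ k, IntervalIntegrable (fun x => dyadicIncr J k G *
        ((Ico (dyadic J k) (dyadic J (k + 1))).indicator 1 x * φ x)) volume 0 1 := fun k =>
      (intervalIntegrable_indicator_mul
        ((integrable_testFunction φ).intervalIntegrable) _ _).const_mul _
    rw [← intervalIntegral.integral_finsetSum fun k _ => hint k,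
      ← intervalIntegral.integral_const_mul, ← intervalIntegral.integral_sub]
    · refine intervalIntegral.integral_congr fun x _ => ?_
      simp only [g, sub_mul, Finset.sum_mul, mul_assoc]
    · have := φ.continuous
      exact (hf.mul this).intervalIntegrable _ _
    · have := (IntervalIntegrable.sum (Finset.range (2 ^ J)) fun k _ => hint k).const_mul (2 ^ J)
      simpa only [Finset.sum_apply] using this
  rw [dist_eq_norm, hsplit]
  refine (norm_ofFun_le hs hgL).trans_lt ?_
  have h1 := eLpNorm_le_of_ae_bound (p := 2) hgae
  have h2 : eLpNorm g 2 ((volume : Measure ℝ).restrict (Ioc 0 1)) ≤ ENNReal.ofReal (ε / 2) := by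
    simpa using h1
  calc _ ≤ ε / 2 := ENNReal.toReal_le_of_le_ofReal (by positivity) h2
    _ < ε := by linarith

/-- Schwartz functions are dense in `L²(ℝ)`, and the Bessel potential maps them to Schwartz
functions, so their classes in `E` are given by continuous functions. -/
theorem dense_span_haarVec {s : ℝ} (hs : s ≤ 0) :
    Dense (Submodule.span ℝ (range (haarVec s)) : Set (Besov s)) := by
  have hsch : ∀ g : 𝓢(ℝ, ℂ), ofL2 s (g.toLp 2 volume) ∈
      closure (Submodule.span ℝ (range (haarVec s)) : Set (Besov s)) := by
    intro g
    set h : 𝓢(ℝ, ℂ) := SchwartzMap.fourierMultiplierCLM ℂ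
      (fun x : ℝ => (((1 + ‖x‖ ^ 2) ^ (-s / 2) : ℝ) : ℂ)) g
    have hc : Continuous fun x => (h x).re := Complex.continuous_re.comp h.continuous
    have hL : MemLp (fun x => (h x).re) 2 ((volume : Measure ℝ).restrict (Ioc 0 1)) :=
      ((h.memLp 2 volume).re).restrict _
    have h1 : ofL2 s (g.toLp 2 volume) = ofFun s (fun x => (h x).re) := by
      refine pairing_ext fun φ => ?_
      rw [represents_ofFun hs hL, pairing_ofL2, evalAt_apply]
      have h2 : sobolevOfL2 s (g.toLp 2 volume) =
          SchwartzMap.toTemperedDistributionCLM ℝ ℂ volume h := by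
        change TemperedDistribution.fourierMultiplierCLM ℂ
          (fun x : ℝ => (((1 + ‖x‖ ^ 2) ^ (-s / 2) : ℝ) : ℂ))
          (Lp.toTemperedDistribution (g.toLp 2 volume)) = _
        rw [Lp.toTemperedDistribution_toLp_eq,
          TemperedDistribution.fourierMultiplierCLM_toTemperedDistributionCLM_eq (by fun_prop)]
      rw [h2, SchwartzMap.toTemperedDistributionCLM_apply_apply volume]
      have hint : Integrable fun x => testToSchwartz φ x • h x := by
        exact (SchwartzMap.integrable (SchwartzMap.pairing (ContinuousLinearMap.lsmul ℂ ℂ) (testToSchwartz φ) h))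
      have h3 := integral_re hint
      change ∫ x, (testToSchwartz φ x • h x).re = _ at h3
      change Complex.re _ = _
      rw [← Complex.reCLM_apply, ← Complex.reCLM.integral_comp_comm hint]
      rw [intervalIntegral.integral_of_le zero_le_one]
      rw [setIntegral_eq_integral_of_forall_compl_eq_zero]
      · refine integral_congr_ae (ae_of_all _ fun x => ?_)
        simp [mul_comm]
      · intro x hx
        have : φ x = 0 := by
          by_contra hne
          have := φ.tsupport_subset (subset_tsupport _ hne)
          exact hx ⟨this.1, this.2.le⟩
        simp [this]
    rw [h1]
    exact ofFun_mem_closure_span hs hc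
  have hdr := SchwartzMap.denseRange_toLpCLM (E := ℝ) (F := ℂ) (p := 2) (by simp)
    (μ := (volume : Measure ℝ))
  intro u
  obtain ⟨g, rfl⟩ := ofL2_surjective s u
  refine hdr.induction_on (p := fun g => ofL2 s g ∈ closure _) g ?_ fun g => hsch g
  exact isClosed_closure.preimage (ofL2 s).continuous

/-! ### The Haar basis and its splitting -/

theorem haarWeight_inv_smul_sum (s : ℝ) (c : ℕ → ℝ) (F : Finset ℕ) :
    ∑ n ∈ F, c n • (haarWeight s n)⁻¹ • haarVec s n =
      ∑ n ∈ F, ((haarWeight s n)⁻¹ * c n) • haarVec s n :=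
  Finset.sum_congr rfl fun n _ => by rw [smul_smul, mul_comm]

theorem sqrt_sum_haarWeight_mul_inv (s : ℝ) (c : ℕ → ℝ) (F : Finset ℕ) :
    ∑ n ∈ F, (haarWeight s n * ((haarWeight s n)⁻¹ * c n)) ^ 2 = ∑ n ∈ F, c n ^ 2 :=
  Finset.sum_congr rfl fun n _ => by rw [mul_inv_cancel_left₀ (haarWeight_pos s n).ne']

theorem exists_haar_schauderBasis {s : ℝ} (hs : s < 0) (hs1 : -(1 / 2) < s) :
    ∃ e : SchauderBasis ℝ (Besov s), ∀ n, e n = haarVec s n := by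
  obtain ⟨C, hC0, hC⟩ := exists_norm_sum_haarVec_le hs (by linarith)
  obtain ⟨C', hC0', hC'⟩ := exists_sum_haarWeight_le_norm hs hs1
  have hw := fun n => (haarWeight_pos s n).ne'
  -- Dividing the Haar functions by their weights turns the two-sided estimate into the unweighted
  -- one. The coordinate functionals below undo this normalization.
  obtain ⟨T, hT⟩ := exists_lp_equiv (v := fun n => (haarWeight s n)⁻¹ • haarVec s n) hC0 hC0'
    (fun c F => by
      rw [haarWeight_inv_smul_sum, ← sqrt_sum_haarWeight_mul_inv s]
      exact hC _ F)
    (fun c F => by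
      rw [haarWeight_inv_smul_sum, ← sqrt_sum_haarWeight_mul_inv s]
      exact hC' _ F) (by
      refine (dense_span_haarVec hs.le).mono ?_
      refine Submodule.span_le.2 (range_subset_iff.2 fun n => ?_)
      have h := Submodule.smul_mem (Submodule.span ℝ (range fun n =>
        (haarWeight s n)⁻¹ • haarVec s n)) (haarWeight s n) (Submodule.subset_span ⟨n, rfl⟩)
      rw [smul_smul, mul_inv_cancel₀ (hw n), one_smul] at h
      exact h)
  have hTe : ∀ n, T.symm (haarVec s n) = lp.single 2 n (haarWeight s n) := fun n => by
    rw [ContinuousLinearEquiv.symm_apply_eq]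
    have h : haarVec s n = (lp.single (E := fun _ : ℕ => ℝ) 2 n (haarWeight s n)) n •
        ((haarWeight s n)⁻¹ • haarVec s n) := by
      rw [lp.single_apply_self, smul_smul, mul_inv_cancel₀ (hw n), one_smul]
    refine h.trans (HasSum.unique ?_ (hT _))
    exact hasSum_single n fun m hm => by simp [hm]
  refine ⟨{ basis := haarVec s
            coord := fun n => (haarWeight s n)⁻¹ • ((lp.evalCLM ℝ (fun _ : ℕ => ℝ) 2 n).comp
              (T.symm : Besov s →L[ℝ] lp (fun _ : ℕ => ℝ) 2))
            ortho := fun i j => ?_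
            expansion := fun u => ?_ }, fun n => rfl⟩
  · have h : ((haarWeight s i)⁻¹ • ((lp.evalCLM ℝ (fun _ : ℕ => ℝ) 2 i).comp
        (T.symm : Besov s →L[ℝ] lp (fun _ : ℕ => ℝ) 2))) (haarVec s j) =
        (haarWeight s i)⁻¹ * (T.symm (haarVec s j)) i := rfl
    rw [h, hTe]
    rcases eq_or_ne i j with rfl | hij
    · rw [lp.single_apply_self, inv_mul_cancel₀ (hw i)]
      simp
    · rw [lp.single_apply_ne _ _ _ hij, mul_zero]
      simp [hij]
  · have h := hT (T.symm u)
    rw [T.apply_symm_apply] at h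
    have h2 : HasSum (fun n => ((haarWeight s n)⁻¹ * (T.symm u) n) • haarVec s n) u := by
      simpa only [smul_smul, mul_comm] using h
    exact Tendsto.mono_left h2 SummationFilter.LeAtTop.le_atTop

section Splitting

variable {E : Type*} [NormedAddCommGroup E] [NormedSpace ℝ E]

theorem schauderBasis_mem_tail (e : SchauderBasis ℝ E) {n : ℕ} {x : E}
    (hx : SchauderBasis.proj e n x = 0) :
    x ∈ (Submodule.span ℝ (e '' Ici n)).topologicalClosure := by
  refine mem_closure_of_tendsto (SchauderBasis.tendsto_proj e x) ?_
  filter_upwards [eventually_ge_atTop n] with m hm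
  have h1 : SchauderBasis.proj e m x = SchauderBasis.proj e m x - SchauderBasis.proj e n x := by
    rw [hx, sub_zero]
  rw [h1, SchauderBasis.proj_apply, SchauderBasis.proj_apply, ← Finset.sum_Ico_eq_sub _ hm]
  exact Submodule.sum_mem _ fun i hi => Submodule.smul_mem _ _
    (Submodule.subset_span ⟨i, (Finset.mem_Ico.1 hi).1, rfl⟩)

theorem coord_eq_zero_of_mem_span (e : SchauderBasis ℝ E) {S : Set ℕ} {x : E}
    (hx : x ∈ Submodule.span ℝ (e '' S)) {i : ℕ} (hi : i ∉ S) : e.coord i x = 0 := by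
  have h : Submodule.span ℝ (e '' S) ≤ (e.coord i).ker := by
    rw [Submodule.span_le]
    rintro _ ⟨j, hj, rfl⟩
    have hij : i ≠ j := fun h => hi (h ▸ hj)
    simpa [hij] using e.ortho i j
  exact h hx

/-- If the blocks are consecutive, `G_n` is the range and `G^n` the kernel of the partial sum
projection of length `N n`. A continuous idempotent splits the space topologically. -/
theorem isSplitting_of_schauderBasis (e : SchauderBasis ℝ E) {F : ℕ → Submodule ℝ E} {l N : ℕ → ℕ}
    (hF : ∀ n, F n = Submodule.span ℝ (e '' {i | l i = n})) (hl : ∀ i n, l i ≤ n ↔ i < N n) :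
    IsSplitting F := by
  have hhead : ∀ n, headSpace F n = (SchauderBasis.proj e (N n)).range := fun n => by
    rw [SchauderBasis.range_proj_eq_span, headSpace]
    simp_rw [hF, ← Submodule.span_iUnion, ← image_iUnion]
    congr 2
    ext i
    simp [← hl]
  have htail : ∀ n, tailSpace F n = (SchauderBasis.proj e (N n)).ker := fun n => by
    have h1 : (⨆ k > n, F k) = Submodule.span ℝ (e '' Ici (N n)) := by
      simp_rw [hF, ← Submodule.span_iUnion, ← image_iUnion]
      congr 2
      ext i
      simp only [mem_iUnion, mem_ofPred_eq, mem_Ici, exists_prop, exists_eq_right', gt_iff_lt]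
      rw [← not_lt, ← hl, not_le]
    rw [tailSpace, h1]
    refine le_antisymm ?_ fun x hx => schauderBasis_mem_tail e hx
    refine Submodule.topologicalClosure_minimal _ ?_ (SchauderBasis.proj e (N n)).isClosed_ker
    rw [Submodule.span_le]
    rintro _ ⟨i, hi, rfl⟩
    change SchauderBasis.proj e (N n) (e i) = 0
    rw [SchauderBasis.proj_apply_basis_mem, if_neg (not_lt.2 hi)]
  refine ⟨fun n => ?_, fun j k hjk => ?_, fun n => ?_⟩
  · rw [hF]
    have hfin : {i | l i = n}.Finite := (finite_Iio (N n)).subset fun i hi => (hl i n).1 (le_of_eq hi)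
    have : FiniteDimensional ℝ (Submodule.span ℝ (e '' {i | l i = n})) :=
      FiniteDimensional.span_of_finite ℝ (hfin.image _)
    exact Submodule.closed_of_finiteDimensional _
  · rw [Submodule.disjoint_def]
    intro x hxj hxk
    rw [hF] at hxj hxk
    have h0 : ∀ i, e.coord i x = 0 := fun i => by
      by_cases hi : l i = j
      · exact coord_eq_zero_of_mem_span e hxk fun h => hjk (hi.symm.trans h)
      · exact coord_eq_zero_of_mem_span e hxj hi
    have h := SchauderBasis.tendsto_proj e x
    simp only [SchauderBasis.proj_apply, h0, zero_smul, Finset.sum_const_zero] at h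
    exact tendsto_nhds_unique h tendsto_const_nhds
  · rw [hhead, htail]
    refine ContinuousLinearMap.IsIdempotentElem.isTopCompl ?_
    ext x
    exact (SchauderBasis.proj_comp e _ _ x).trans (by rw [min_self])

end Splitting

/-- The number of binary digits is the right block index: it is `0` at `0` and `j + 1` on `[2^j,
2^{j+1})`, whereas `Nat.log` would merge the indices `0` and `1`. -/
theorem haarSpace_eq_span {s : ℝ} (hs : s ≤ 0) (n : ℕ) :
    haarSpace s n = Submodule.span ℝ (haarVec s '' {i | i.size = n}) := by
  have key : ∀ (i : ℕ) (u : Besov s), Represents u (haar i) ↔ u = haarVec s i := fun i u =>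
    ⟨fun h => h.unique (represents_haarVec hs i), fun h => h ▸ represents_haarVec hs i⟩
  cases n with
  | zero =>
    rw [haarSpace]
    congr 1
    ext u
    rw [mem_ofPred_eq, ← haar_zero, key]
    simp [Nat.size_eq_zero]
  | succ j =>
    rw [haarSpace]
    congr 1
    ext u
    simp only [mem_ofPred_eq, mem_image]
    constructor
    · rintro ⟨k, hk, hu⟩
      refine ⟨2 ^ j + k, ?_, ?_⟩
      · refine le_antisymm (Nat.size_le.2 (by rw [pow_succ]; omega)) (Nat.lt_size.2 (by omega))
      · rw [← haar_two_pow_add hk, key] at hu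
        exact hu.symm
    · rintro ⟨i, hi, rfl⟩
      have h1 : 2 ^ j ≤ i := Nat.lt_size.1 (by omega)
      have h2 : i < 2 ^ (j + 1) := Nat.size_le.1 hi.le
      rw [pow_succ] at h2
      refine ⟨i - 2 ^ j, by omega, ?_⟩
      rw [← haar_two_pow_add (by omega), key]
      congr 1
      omega

theorem isSplitting_haarSpace {s : ℝ} (hs : s ≤ 0) (e : SchauderBasis ℝ (Besov s))
    (he : ∀ n, e n = haarVec s n) : IsSplitting (haarSpace s) :=
  isSplitting_of_schauderBasis e (l := Nat.size) (N := fun n => 2 ^ n)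
    (fun n => by rw [haarSpace_eq_span hs, ← funext he]) fun _ _ => Nat.size_le

/-! ### Hilbert space curves with the increments of a fractional Brownian motion -/

section Curve

variable {V : Type*} [NormedAddCommGroup V] [InnerProductSpace ℝ V]

/-- `X` is a curve on `[0,∞)` in a Hilbert space with `‖X t - X u‖² = |t - u|^p`. -/
def IsFractionalCurve (p : ℝ) (X : ℝ → V) : Prop :=
  ∀ t u, 0 ≤ t → 0 ≤ u → ‖X t - X u‖ ^ 2 = |t - u| ^ p

/-- Polarization: Gram matrices of increments are determined by mutual distances, so curves with
proportional squared distances have proportional Gram matrices. -/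
theorem inner_sub_sub_eq (x y z w : V) : inner ℝ (x - y) (z - w) =
    (‖x - w‖ ^ 2 + ‖y - z‖ ^ 2 - ‖x - z‖ ^ 2 - ‖y - w‖ ^ 2) / 2 := by
  simp only [norm_sub_sq_real, inner_sub_left, inner_sub_right]
  ring

theorem two_mul_abs_rpow_le {p : ℝ} (hp : 1 ≤ p) (d : ℝ) :
    2 * |d| ^ p ≤ |d + 1| ^ p + |d - 1| ^ p := by
  obtain ⟨-, h⟩ := convexOn_rpow hp
  replace h := h (mem_Ici.2 (abs_nonneg (d + 1))) (mem_Ici.2 (abs_nonneg (d - 1)))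
    (by norm_num : (0 : ℝ) ≤ 1 / 2) (by norm_num : (0 : ℝ) ≤ 1 / 2) (by norm_num)
  simp only [smul_eq_mul] at h
  have h2 : |d| ≤ 1 / 2 * |d + 1| + 1 / 2 * |d - 1| := by
    have := abs_add_le (d + 1) (d - 1)
    rw [show d + 1 + (d - 1) = 2 * d by ring, abs_mul, abs_of_pos two_pos] at this
    linarith
  have h3 : |d| ^ p ≤ (1 / 2 * |d + 1| + 1 / 2 * |d - 1|) ^ p :=
    Real.rpow_le_rpow (abs_nonneg _) h2 (by linarith)
  linarith

namespace IsFractionalCurve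

variable {p : ℝ} {X : ℝ → V} (hX : IsFractionalCurve p X)
include hX

/-- Up to a positive factor the inner product is a second difference of `|d|^p`, which is
nonnegative by convexity. -/
theorem inner_grid_nonneg (hp : 1 ≤ p) (N m l : ℕ) :
    0 ≤ inner ℝ (X ((m + 1 : ℕ) / N) - X (m / N)) (X ((l + 1 : ℕ) / N) - X (l / N)) := by
  have h0 : ∀ a : ℕ, (0 : ℝ) ≤ a / N := fun a => by positivity
  rw [inner_sub_sub_eq, hX _ _ (h0 _) (h0 _), hX _ _ (h0 _) (h0 _), hX _ _ (h0 _) (h0 _),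
    hX _ _ (h0 _) (h0 _)]
  have e : ∀ a b : ℝ, |a / N - b / N| ^ p = |a - b| ^ p / (N : ℝ) ^ p := fun a b => by
    rw [← sub_div, abs_div, Nat.abs_cast, Real.div_rpow (abs_nonneg _) (Nat.cast_nonneg _)]
  rw [e, e, e, e, ← add_div, ← sub_div, ← sub_div]
  refine div_nonneg (div_nonneg ?_ (by positivity)) two_pos.le
  have := two_mul_abs_rpow_le hp ((m : ℝ) - l)
  push_cast
  rw [show (m : ℝ) + 1 - l = m - l + 1 by ring, show (m : ℝ) - (l + 1) = m - l - 1 by ring,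
    show (m : ℝ) + 1 - (l + 1) = m - l by ring]
  linarith

/-- As increments are nonnegatively correlated, replacing every coefficient by the bound `c` can
only increase the norm. The increments then telescope to `X 1 - X 0`, of norm `1`. -/
theorem norm_sum_smul_incr_le (hp : 1 ≤ p) {N : ℕ} {g : ℕ → ℝ} {c : ℝ} (hc : 0 ≤ c)
    (hg : ∀ m < N, |g m| ≤ c) :
    ‖∑ m ∈ Finset.range N, g m • (X ((m + 1 : ℕ) / N) - X (m / N))‖ ≤ c := by
  rcases N.eq_zero_or_pos with rfl | hN
  · simpa
  set D : ℕ → V := fun m => X ((m + 1 : ℕ) / N) - X (m / N)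
  have h1 : ‖∑ m ∈ Finset.range N, D m‖ ^ 2 = 1 := by
    have h2 : ∑ m ∈ Finset.range N, D m = X ((N : ℕ) / N) - X ((0 : ℕ) / N) :=
      Finset.sum_range_sub (fun m : ℕ => X (m / N)) N
    have hN' : (N : ℝ) ≠ 0 := by positivity
    rw [h2, hX _ _ (by positivity) (by positivity), div_self hN']
    simp
  have h3 : ‖∑ m ∈ Finset.range N, g m • D m‖ ^ 2 ≤ c ^ 2 * ‖∑ m ∈ Finset.range N, D m‖ ^ 2 := by
    rw [← real_inner_self_eq_norm_sq, ← real_inner_self_eq_norm_sq, sum_inner, sum_inner,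
      Finset.mul_sum]
    refine Finset.sum_le_sum fun m hm => ?_
    rw [inner_sum, inner_sum, Finset.mul_sum]
    refine Finset.sum_le_sum fun l hl => ?_
    rw [real_inner_smul_left, real_inner_smul_right, ← mul_assoc]
    refine mul_le_mul_of_nonneg_right ?_ (hX.inner_grid_nonneg hp N m l)
    calc g m * g l ≤ |g m| * |g l| := by rw [← abs_mul]; exact le_abs_self _
      _ ≤ c * c := by
        gcongr
        · exact hg m (Finset.mem_range.1 hm)
        · exact hg l (Finset.mem_range.1 hl)
      _ = c ^ 2 := (sq c).symm
  rw [h1, mul_one] at h3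
  exact le_of_sq_le_sq h3 hc

theorem norm_haarCoef_sq_le (hp0 : 0 ≤ p) (n : ℕ) :
    ‖haarCoef n X‖ ^ 2 ≤ 4 * 2 ^ Nat.log 2 n * (1 / 2 ^ Nat.log 2 n) ^ p := by
  rcases eq_or_ne n 0 with rfl | hn
  · rw [haarCoef_zero, hX _ _ zero_le_one le_rfl]
    simp
  · obtain ⟨j, k, hk, rfl⟩ := exists_two_pow_add hn
    rw [log_two_pow_add hk, haarCoef_two_pow_add hk, norm_smul, mul_pow, Real.norm_eq_abs, sq_abs,
      sq, two_rpow_half_sq]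
    have hinc : ∀ m : ℕ, ‖X (dyadic (j + 1) (m + 1)) - X (dyadic (j + 1) m)‖ ^ 2 ≤
        (1 / 2 ^ j) ^ p := fun m => by
      rw [hX _ _ (dyadic_nonneg _ _) (dyadic_nonneg _ _)]
      refine Real.rpow_le_rpow (abs_nonneg _) ?_ hp0
      have : dyadic (j + 1) (m + 1) - dyadic (j + 1) m = 1 / 2 ^ (j + 1) := by
        simp only [dyadic]; push_cast; ring
      rw [this, abs_of_pos (by positivity)]
      exact one_div_le_one_div_of_le (by positivity) (pow_le_pow_right₀ (by norm_num) j.le_succ)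
    have h1 := hinc (2 * k)
    have h2 := hinc (2 * k + 1)
    simp only [dyadicIncr]
    set a := X (dyadic (j + 1) (2 * k + 1)) - X (dyadic (j + 1) (2 * k))
    set b := X (dyadic (j + 1) (2 * k + 1 + 1)) - X (dyadic (j + 1) (2 * k + 1))
    have h3 : ‖a - b‖ ^ 2 ≤ 4 * (1 / 2 ^ j) ^ p := by
      have := norm_sub_le a b
      nlinarith [norm_nonneg (a - b), norm_nonneg a, norm_nonneg b, sq_nonneg (‖a‖ - ‖b‖)]
    calc _ ≤ (2 : ℝ) ^ j * (4 * (1 / 2 ^ j) ^ p) := by gcongr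
      _ = _ := by ring

end IsFractionalCurve

theorem sum_range_mul_eq {A : Type*} [AddCommMonoid A] (f : ℕ → A) (n M : ℕ) :
    ∑ m ∈ Finset.range (n * M), f m =
      ∑ k ∈ Finset.range n, ∑ i ∈ Finset.range M, f (k * M + i) := by
  induction n with
  | zero => simp
  | succ n ih => rw [Nat.succ_mul, Finset.sum_range_add, ih, Finset.sum_range_succ]

/-- Sums on two different grids become comparable on a common refinement; `m / M` in the coefficient
is division of natural numbers and finds the coarse cell. -/
theorem sum_smul_incr_refine (g : ℕ → ℝ) (X : ℝ → V) (n : ℕ) {M : ℕ} (hM : 0 < M) :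
    ∑ k ∈ Finset.range n, g k • (X ((k + 1 : ℕ) / n) - X (k / n)) =
      ∑ m ∈ Finset.range (n * M), g (m / M) •
        (X ((m + 1 : ℕ) / (n * M : ℕ)) - X (m / (n * M : ℕ))) := by
  rw [sum_range_mul_eq]
  refine Finset.sum_congr rfl fun k _ => ?_
  have hM' : (M : ℝ) ≠ 0 := by positivity
  rw [Finset.sum_congr rfl fun i hi => by
    rw [show (k * M + i) / M = k by
      rw [mul_comm, Nat.mul_add_div hM, Nat.div_eq_of_lt (Finset.mem_range.1 hi), add_zero]],
    ← Finset.smul_sum]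
  congr 1
  have h := Finset.sum_range_sub (fun i : ℕ => X ((k * M + i : ℕ) / (n * M : ℕ))) M
  rw [show ∑ i ∈ Finset.range M, (X ((k * M + i + 1 : ℕ) / (n * M : ℕ)) -
    X ((k * M + i : ℕ) / (n * M : ℕ))) = _ from h]
  congr 2
  · push_cast
    rw [show (k : ℝ) * M + M = (k + 1) * M by ring, mul_div_mul_right _ _ hM']
  · push_cast
    rw [add_zero, mul_div_mul_right _ _ hM']

end Curve

/-! ### Riemann sums along a fractional curve -/

section Riemann

variable {V : Type*} [NormedAddCommGroup V] [InnerProductSpace ℝ V]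

theorem abs_sub_two_pow_mul_dyadicIncr_le {f : ℝ → ℝ} (hf : Continuous f) {ε : ℝ} {J k : ℕ} {x : ℝ}
    (h : ∀ y ∈ Icc (dyadic J k) (dyadic J (k + 1)), |f x - f y| ≤ ε) :
    |f x - 2 ^ J * dyadicIncr J k (fun t => ∫ y in (0 : ℝ)..t, f y)| ≤ ε := by
  have h2J : (0 : ℝ) < 2 ^ J := by positivity
  have hlen : dyadic J (k + 1) - dyadic J k = 1 / 2 ^ J := by
    simp only [dyadic]; push_cast; ring
  have h1 : f x - 2 ^ J * dyadicIncr J k (fun t => ∫ y in (0 : ℝ)..t, f y) =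
      2 ^ J * ∫ y in dyadic J k..dyadic J (k + 1), (f x - f y) := by
    rw [dyadicIncr_sub_eq, intervalIntegral.integral_interval_sub_left (hf.intervalIntegrable _ _)
        (hf.intervalIntegrable _ _), intervalIntegral.integral_sub (by simp)
        (hf.intervalIntegrable _ _), intervalIntegral.integral_const, hlen, smul_eq_mul]
    field_simp
  rw [h1, abs_mul, abs_of_pos h2J]
  have h2 : ‖∫ y in dyadic J k..dyadic J (k + 1), (f x - f y)‖ ≤
      ε * |dyadic J (k + 1) - dyadic J k| := by
    refine intervalIntegral.norm_integral_le_of_norm_le_const fun y hy => ?_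
    rw [uIoc_of_le (dyadic_mono _ k.le_succ)] at hy
    exact h y ⟨hy.1.le, hy.2⟩
  rw [hlen, abs_of_pos (by positivity), Real.norm_eq_abs] at h2
  calc _ ≤ 2 ^ J * (ε * (1 / 2 ^ J)) := by gcongr
    _ = ε := by field_simp

theorem abs_natCast_div_sub_le {m n M : ℕ} (hn : 0 < n) (hM : 0 < M) :
    ((m / M : ℕ) : ℝ) / n ≤ m / (n * M : ℕ) ∧
      (m : ℝ) / (n * M : ℕ) ≤ ((m / M + 1 : ℕ) : ℝ) / n := by
  have hn' : (0 : ℝ) < n := by positivity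
  have hM' : (0 : ℝ) < M := by positivity
  have h1 : (m / M) * M ≤ m := Nat.div_mul_le_self m M
  have h2 : m < M * (m / M + 1) := by
    have := Nat.lt_mul_div_succ m hM
    simpa using this
  have h1' : ((m / M : ℕ) : ℝ) * M ≤ m := by exact_mod_cast h1
  have h2' : (m : ℝ) ≤ M * ((m / M + 1 : ℕ) : ℝ) := by exact_mod_cast h2.le
  push_cast at h1' h2' ⊢
  constructor
  · rw [div_le_div_iff₀ hn' (by positivity)]
    nlinarith
  · rw [div_le_div_iff₀ (by positivity) hn']
    nlinarith

/-- On the grid of mesh `1/(n 2^J)` both sums have coefficients close to the value of `f` at the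
grid point: dyadic means up to `ε`, Riemann values up to `ε'`. The estimate `norm_sum_smul_incr_le`
turns this into a norm bound. -/
theorem IsFractionalCurve.norm_dyadic_sub_riemann_le {p : ℝ} {X : ℝ → V}
    (hX : IsFractionalCurve p X) (hp : 1 ≤ p) {f : ℝ → ℝ} (hf : Continuous f) {J n : ℕ} (hn : 0 < n)
    {ε ε' : ℝ} (hε : 0 ≤ ε) (hε' : 0 ≤ ε') (hJ : ∀ x y : ℝ, |x - y| ≤ 1 / 2 ^ J → |f x - f y| ≤ ε)
    (hfn : ∀ x y : ℝ, |x - y| ≤ 1 / n → |f x - f y| ≤ ε') :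
    ‖(2 : ℝ) ^ J • ∑ k ∈ Finset.range (2 ^ J),
        dyadicIncr J k (fun t => ∫ y in (0 : ℝ)..t, f y) • dyadicIncr J k X -
      ∑ i ∈ Finset.range n, f (i / n) • (X ((i + 1 : ℕ) / n) - X (i / n))‖ ≤ ε + ε' := by
  set G : ℝ → ℝ := fun t => ∫ y in (0 : ℝ)..t, f y
  have h2J : 0 < 2 ^ J := by positivity
  have e1 : (2 : ℝ) ^ J • ∑ k ∈ Finset.range (2 ^ J), dyadicIncr J k G • dyadicIncr J k X =
      ∑ m ∈ Finset.range (n * 2 ^ J), (2 ^ J * dyadicIncr J (m / n) G) •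
        (X ((m + 1 : ℕ) / (n * 2 ^ J : ℕ)) - X (m / (n * 2 ^ J : ℕ))) := by
    have := sum_smul_incr_refine (fun k => 2 ^ J * dyadicIncr J k G) X (2 ^ J) hn
    rw [mul_comm (2 ^ J) n] at this
    rw [← this, Finset.smul_sum]
    refine Finset.sum_congr rfl fun k _ => ?_
    rw [smul_smul]
    simp only [dyadicIncr, dyadic]
    push_cast
    rfl
  have e2 := sum_smul_incr_refine (fun i => f (i / n)) X n h2J
  rw [e1, e2, ← Finset.sum_sub_distrib]
  simp_rw [← sub_smul]
  refine hX.norm_sum_smul_incr_le hp (by positivity) fun m _ => ?_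
  set x : ℝ := m / (n * 2 ^ J : ℕ)
  have b1 := abs_natCast_div_sub_le (m := m) hn h2J
  have b2 := abs_natCast_div_sub_le (m := m) h2J hn
  rw [mul_comm (2 ^ J) n] at b2
  have h1 : |f x - 2 ^ J * dyadicIncr J (m / n) G| ≤ ε := by
    refine abs_sub_two_pow_mul_dyadicIncr_le hf fun y hy => hJ x y ?_
    simp only [dyadic] at hy
    push_cast at b2 hy
    have hlen : ((m / n : ℕ) + 1 : ℝ) / 2 ^ J = (m / n : ℕ) / 2 ^ J + 1 / 2 ^ J := by ring
    rw [hlen] at hy b2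
    have b2' : ((m / n : ℕ) : ℝ) / 2 ^ J ≤ x ∧ x ≤ (m / n : ℕ) / 2 ^ J + 1 / 2 ^ J := by
      simpa [x] using b2
    rw [abs_le]
    constructor <;> linarith [hy.1, hy.2, b2'.1, b2'.2]
  have h2 : |f x - f ((m / 2 ^ J : ℕ) / n)| ≤ ε' := by
    refine hfn _ _ ?_
    have hlen : ((m / 2 ^ J + 1 : ℕ) : ℝ) / n = (m / 2 ^ J : ℕ) / n + 1 / n := by
      push_cast; ring
    rw [hlen] at b1
    rw [abs_le]
    constructor <;> linarith [b1.1, b1.2]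
  calc |2 ^ J * dyadicIncr J (m / n) G - f ((m / 2 ^ J : ℕ) / n)| =
        |(f x - f ((m / 2 ^ J : ℕ) / n)) - (f x - 2 ^ J * dyadicIncr J (m / n) G)| := by
        congr 1; ring
    _ ≤ _ := by
        refine (abs_sub _ _).trans ?_
        linarith

end Riemann

/-! ### Nondegeneracy -/

/-- The function `z ↦ |[0,z] ∩ [0,t]|`. -/
def ramp (t z : ℝ) : ℝ := max 0 (min z t)

theorem ramp_continuous (t : ℝ) : Continuous (ramp t) := by unfold ramp; fun_prop

theorem abs_ramp_sub_le (t x y : ℝ) : |ramp t x - ramp t y| ≤ |x - y| := by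
  refine (abs_max_sub_max_le_max _ _ _ _).trans ?_
  simp only [sub_self, abs_zero]
  refine max_le (abs_nonneg _) ((abs_min_sub_min_le_max _ _ _ _).trans ?_)
  simp

theorem ramp_sub_ramp {u t : ℝ} (hu : 0 ≤ u) (hut : u < t) (z : ℝ) :
    ramp t z - ramp u z = (t - u) * ramp 1 ((z - u) / (t - u)) := by
  have hc : 0 < t - u := sub_pos.2 hut
  have h : (t - u) * ramp 1 ((z - u) / (t - u)) = max 0 (min (z - u) (t - u)) := by
    rw [ramp, mul_max_of_nonneg _ _ hc.le, mul_min_of_nonneg _ _ hc.le, mul_zero, mul_one,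
      mul_div_cancel₀ _ hc.ne']
  rw [h, ramp, ramp]
  rcases le_total z u with h1 | h1 <;> rcases le_total z t with h2 | h2 <;>
    rcases le_total z 0 with h3 | h3 <;> grind

/-- The exponent collects `2` from the squared amplitude, `1` from the integration in space and `-α`
from the kernel. -/
theorem gagliardo_scale (α : ℝ) (f : ℝ → ℝ) {c : ℝ} (hc : 0 < c) (u : ℝ) :
    gagliardo α (fun z => c * f ((z - u) / c)) = ENNReal.ofReal (c ^ (3 - α)) * gagliardo α f := by
  set A : ℝ → ℝ≥0∞ := fun r => ∫⁻ x, ‖f (x - r) - f x‖ₑ ^ 2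
  have h1 : ∀ r, ∫⁻ x, ‖c * f ((x - r - u) / c) - c * f ((x - u) / c)‖ₑ ^ 2 =
      ENNReal.ofReal (c ^ 3) * A (c⁻¹ * r) := by
    intro r
    have h2 : ∀ x, ‖c * f ((x - r - u) / c) - c * f ((x - u) / c)‖ₑ ^ 2 =
        ENNReal.ofReal (c ^ 2) *
          (fun y => ‖f (y - c⁻¹ * u - c⁻¹ * r) - f (y - c⁻¹ * u)‖ₑ ^ 2) (c⁻¹ * x) := by
      intro x
      rw [← mul_sub, enorm_mul, mul_pow, Real.enorm_of_nonneg hc.le, ENNReal.ofReal_pow hc.le]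
      congr 5 <;> field_simp
      ring
    simp_rw [h2]
    rw [lintegral_const_mul' _ _ ENNReal.ofReal_ne_top,
      lintegral_comp_mul_left_real
        (fun y => ‖f (y - c⁻¹ * u - c⁻¹ * r) - f (y - c⁻¹ * u)‖ₑ ^ 2) (inv_ne_zero hc.ne'),
      lintegral_sub_right_eq_self (fun y => ‖f (y - c⁻¹ * r) - f y‖ₑ ^ 2), ← mul_assoc,
      ← ENNReal.ofReal_mul (by positivity)]
    congr 2
    rw [abs_of_pos (by positivity), inv_inv]
    ring
  rw [gagliardo]
  simp_rw [h1, mul_left_comm _ (ENNReal.ofReal (c ^ 3))]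
  rw [lintegral_const_mul' _ _ ENNReal.ofReal_ne_top,
    lintegral_rieszKernel_comp_mul α A (inv_ne_zero hc.ne'), ← mul_assoc,
    ← ENNReal.ofReal_mul (by positivity), gagliardo]
  congr 2
  rw [abs_of_pos (by positivity), Real.inv_rpow hc.le, ← Real.rpow_neg hc.le, ← Real.rpow_natCast,
    ← Real.rpow_add hc]
  congr 1

theorem lintegral_ramp_sub_sq_le (r : ℝ) :
    ∫⁻ x, ‖ramp 1 (x - r) - ramp 1 x‖ₑ ^ 2 ≤ ENNReal.ofReal (3 * (|r| * min 1 |r|)) := by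
  have h1 : ∀ x, ‖ramp 1 (x - r) - ramp 1 x‖ₑ ^ 2 ≤
      (Icc (-|r|) (1 + |r|)).indicator (fun _ => ENNReal.ofReal ((min 1 |r|) ^ 2)) x := by
    intro x
    by_cases hx : x ∈ Icc (-|r|) (1 + |r|)
    · rw [indicator_of_mem hx, ← ofReal_norm, ← ENNReal.ofReal_pow (norm_nonneg _)]
      refine ENNReal.ofReal_le_ofReal ?_
      gcongr
      refine le_min ?_ ?_
      · rw [Real.norm_eq_abs, abs_le]
        have h0 : ∀ y, 0 ≤ ramp 1 y := fun y => le_max_left _ _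
        have h1 : ∀ y, ramp 1 y ≤ 1 := fun y => max_le zero_le_one (min_le_right _ _)
        constructor <;> linarith [h0 (x - r), h0 x, h1 (x - r), h1 x]
      · have := abs_ramp_sub_le 1 (x - r) x
        rwa [show x - r - x = -r by ring, abs_neg] at this
    · rw [indicator_of_notMem hx]
      rw [mem_Icc, not_and_or, not_le, not_le] at hx
      have hr1 := le_abs_self r
      have hr2 := neg_abs_le r
      have : ramp 1 (x - r) = ramp 1 x := by
        unfold ramp
        have := abs_nonneg r
        rcases hx with hx | hx
        · rw [max_eq_left (by rw [min_le_iff]; left; linarith),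
            max_eq_left (by rw [min_le_iff]; left; linarith)]
        · rw [min_eq_right (by linarith), min_eq_right (by linarith)]
      simp [this]
  refine (lintegral_mono h1).trans ?_
  rw [lintegral_indicator_const measurableSet_Icc, Real.volume_Icc,
    ← ENNReal.ofReal_mul (by positivity)]
  refine ENNReal.ofReal_le_ofReal ?_
  have h0 := abs_nonneg r
  rcases le_total 1 |r| with h | h
  · rw [min_eq_left h]; nlinarith
  · rw [min_eq_right h]; nlinarith

/-- A ramp does not return to zero, so its squared translation difference grows like `|r|`; hence `α
> 1` is needed at infinity, while `α < 2` suffices near `0`. -/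
theorem gagliardo_ramp_lt_top {α : ℝ} (hα : 1 < α) (hα2 : α < 2) : gagliardo α (ramp 1) < ∞ := by
  have h := lintegral_rieszKernel_mul_min_lt_top (α := α - 1) (β := 1) (by linarith) (by linarith)
  calc gagliardo α (ramp 1) ≤ ∫⁻ t, 3 * (rieszKernel (α - 1) t * ENNReal.ofReal (min 1 (|t| ^ (1 : ℝ)))) := by
        refine lintegral_mono_ae ?_
        filter_upwards [show ∀ᵐ t : ℝ, t ≠ 0 by simp [ae_iff]] with t ht
        refine (mul_le_mul_right (lintegral_ramp_sub_sq_le t) _).trans (le_of_eq ?_)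
        have h3 : (3 : ℝ≥0∞) = ENNReal.ofReal 3 := by simp
        rw [h3, rieszKernel, rieszKernel, ← ENNReal.ofReal_mul (by positivity),
          ← ENNReal.ofReal_mul (by positivity), ← ENNReal.ofReal_mul (by positivity), Real.rpow_one]
        congr 1
        rw [show -1 - (α - 1) = -1 - α + 1 by ring, Real.rpow_add_one (abs_pos.2 ht).ne']
        ring
    _ < ∞ := by
        rw [lintegral_const_mul' _ _ (by simp)]
        exact ENNReal.mul_lt_top (by simp) h

/-- A difference of two ramps is a translated and dilated copy of one ramp. With `α = 3 - p`, ramps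
therefore model a curve with squared distances `|t - u|^p`, up to a constant. -/
theorem gagliardo_ramp_sub {α : ℝ} (hα : α < 3) {t u : ℝ} (ht : 0 ≤ t) (hu : 0 ≤ u) :
    gagliardo α (fun z => ramp t z - ramp u z) =
      ENNReal.ofReal (|t - u| ^ (3 - α)) * gagliardo α (ramp 1) := by
  have key : ∀ {t u : ℝ}, 0 ≤ u → u < t → gagliardo α (fun z => ramp t z - ramp u z) =
      ENNReal.ofReal (|t - u| ^ (3 - α)) * gagliardo α (ramp 1) := by
    intro t u hu hut
    simp_rw [ramp_sub_ramp hu hut]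
    rw [gagliardo_scale α (ramp 1) (sub_pos.2 hut) u, abs_of_pos (sub_pos.2 hut)]
  rcases lt_trichotomy u t with h | rfl | h
  · exact key hu h
  · simp [gagliardo, Real.zero_rpow (by linarith : 3 - α ≠ 0)]
  · rw [abs_sub_comm, ← key ht h, gagliardo, gagliardo]
    simp only [← enorm_neg (_ - _ - (ramp t _ - ramp u _))]
    congr! 7
    ring

/-- The measure on `ℝ × ℝ` with the density `(r, z) ↦ |r|^{-1-α}`. -/
def rieszMeasure (α : ℝ) : Measure (ℝ × ℝ) :=
  (volume : Measure (ℝ × ℝ)).withDensity fun q => rieszKernel α q.1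

theorem lintegral_rieszMeasure (α : ℝ) {f : ℝ → ℝ} (hf : Measurable f) :
    ∫⁻ q, ‖f (q.2 - q.1) - f q.2‖ₑ ^ 2 ∂rieszMeasure α = gagliardo α f := by
  have hm : Measurable fun q : ℝ × ℝ => rieszKernel α q.1 :=
    (measurable_rieszKernel α).comp measurable_fst
  have hm2 : Measurable fun q : ℝ × ℝ => ‖f (q.2 - q.1) - f q.2‖ₑ ^ 2 := by fun_prop
  rw [rieszMeasure, lintegral_withDensity_eq_lintegral_mul _ hm hm2, Measure.volume_eq_prod,
    lintegral_prod _ (hm.mul hm2).aemeasurable, gagliardo]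
  refine lintegral_congr fun r => ?_
  simp only [Pi.mul_apply]
  rw [lintegral_const_mul _ (by fun_prop)]

theorem memLp_rieszMeasure {α : ℝ} {f : ℝ → ℝ} (hf : Measurable f) (h : gagliardo α f < ∞) :
    MemLp (fun q : ℝ × ℝ => f (q.2 - q.1) - f q.2) 2 (rieszMeasure α) := by
  have hm : Measurable fun q : ℝ × ℝ => f (q.2 - q.1) - f q.2 := by fun_prop
  refine ⟨hm.aestronglyMeasurable, ?_⟩
  rw [eLpNorm_lt_top_iff_lintegral_rpow_enorm_lt_top (by norm_num) (by norm_num)]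
  simpa [lintegral_rieszMeasure α hf] using h

theorem norm_toLp_sq {Ω E : Type*} [MeasurableSpace Ω] [NormedAddCommGroup E] {μ : Measure Ω}
    {f : Ω → E}
    (hf : MemLp f 2 μ) : ENNReal.ofReal (‖hf.toLp f‖ ^ 2) = ∫⁻ x, ‖f x‖ₑ ^ 2 ∂μ := by
  rw [Lp.norm_toLp, ENNReal.ofReal_pow ENNReal.toReal_nonneg,
    ENNReal.ofReal_toReal hf.eLpNorm_ne_top,
    eLpNorm_eq_lintegral_rpow_enorm_toReal (by norm_num) (by norm_num)]
  simp only [ENNReal.toReal_ofNat, ENNReal.rpow_ofNat]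
  rw [← ENNReal.rpow_natCast, ← ENNReal.rpow_mul]
  simp

section Nondegenerate

variable {V : Type*} [NormedAddCommGroup V] [InnerProductSpace ℝ V] {p : ℝ} {X : ℝ → V}

theorem gagliardo_ramp_lt_top' {α : ℝ} (hα : 1 < α) (hα2 : α < 2) {t : ℝ} (ht : 0 ≤ t) :
    gagliardo α (ramp t) < ∞ := by
  have h := gagliardo_ramp_sub (α := α) (by linarith) ht le_rfl
  have h0 : ∀ z, ramp 0 z = 0 := fun z => by simp [ramp]
  simp only [h0, sub_zero] at h
  change gagliardo α (ramp t) = _ at h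
  rw [h]
  exact ENNReal.mul_lt_top (by simp) (gagliardo_ramp_lt_top hα hα2)

/-- Up to a constant factor, the norms of the linear combinations of increments of a fractional
curve are Gagliardo seminorms of piecewise linear functions. -/
theorem IsFractionalCurve.gagliardo_sum_ramp (hX : IsFractionalCurve p X) (hp : 1 < p) (hp2 : p < 2)
    (J : ℕ) (b : ℕ → ℝ) :
    gagliardo (3 - p) (fun z => ∑ k ∈ Finset.range (2 ^ J), b k * dyadicIncr J k (ramp · z)) =
      gagliardo (3 - p) (ramp 1) *
        ENNReal.ofReal (‖∑ k ∈ Finset.range (2 ^ J), b k • dyadicIncr J k X‖ ^ 2) := by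
  set α := 3 - p with hαdef
  set κ := gagliardo α (ramp 1)
  have hκ : κ < ∞ := gagliardo_ramp_lt_top (by linarith) (by linarith)
  have hL : ∀ t : ℝ, 0 ≤ t → MemLp (fun q : ℝ × ℝ => ramp t (q.2 - q.1) - ramp t q.2) 2
      (rieszMeasure α) := fun t ht => memLp_rieszMeasure (ramp_continuous t).measurable
    (gagliardo_ramp_lt_top' (by linarith) (by linarith) ht)
  -- Truncating at `0` defines the comparison curve `h` for all real `t`; only its values for `t ≥
  -- 0` are used.
  have hL' : ∀ t : ℝ, MemLp (fun q : ℝ × ℝ => ramp (max t 0) (q.2 - q.1) - ramp (max t 0) q.2) 2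
      (rieszMeasure α) := fun t => hL _ (le_max_right _ _)
  set h : ℝ → Lp ℝ 2 (rieszMeasure α) := fun t => (hL' t).toLp _
  have hnorm : ∀ t u, 0 ≤ t → 0 ≤ u → ‖h t - h u‖ ^ 2 = κ.toReal * ‖X t - X u‖ ^ 2 := by
    intro t u ht hu
    have h1 : h t - h u = ((hL' t).sub (hL' u)).toLp _ := (MemLp.toLp_sub _ _).symm
    have h2 := norm_toLp_sq ((hL' t).sub (hL' u))
    rw [← h1] at h2
    have h3 : ∫⁻ q, ‖((fun q : ℝ × ℝ => ramp (max t 0) (q.2 - q.1) - ramp (max t 0) q.2) -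
        fun q : ℝ × ℝ => ramp (max u 0) (q.2 - q.1) - ramp (max u 0) q.2) q‖ₑ ^ 2 ∂rieszMeasure α =
        gagliardo α (fun z => ramp t z - ramp u z) := by
      have hm : Measurable fun z => ramp t z - ramp u z :=
        (ramp_continuous t).measurable.sub (ramp_continuous u).measurable
      rw [← lintegral_rieszMeasure α hm, max_eq_left ht, max_eq_left hu]
      refine lintegral_congr fun q => ?_
      congr 2
      simp only [Pi.sub_apply]
      ring
    rw [h3, gagliardo_ramp_sub (by linarith) ht hu, show 3 - α = p by ring, ← hX t u ht hu] at h2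
    change _ = _ * κ at h2
    rw [← ENNReal.ofReal_toReal hκ.ne, ← ENNReal.ofReal_mul (by positivity)] at h2
    have h4 := (ENNReal.ofReal_eq_ofReal_iff (by positivity) (by positivity)).1 h2
    rw [h4, mul_comm]
  -- By polarization, proportional squared distances of `h` and `X` give proportional Gram matrices
  -- of their increments.
  have hinner : ∀ k l, inner ℝ (dyadicIncr J k h) (dyadicIncr J l h) =
      κ.toReal * inner ℝ (dyadicIncr J k X) (dyadicIncr J l X) := by
    intro k l
    have h0 := fun m => dyadic_nonneg J m
    simp only [dyadicIncr]
    rw [inner_sub_sub_eq, inner_sub_sub_eq, hnorm _ _ (h0 _) (h0 _), hnorm _ _ (h0 _) (h0 _),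
      hnorm _ _ (h0 _) (h0 _), hnorm _ _ (h0 _) (h0 _)]
    ring
  have hsum : ‖∑ k ∈ Finset.range (2 ^ J), b k • dyadicIncr J k h‖ ^ 2 =
      κ.toReal * ‖∑ k ∈ Finset.range (2 ^ J), b k • dyadicIncr J k X‖ ^ 2 := by
    simp only [← real_inner_self_eq_norm_sq, sum_inner, inner_sum, real_inner_smul_left,
      real_inner_smul_right, hinner, Finset.mul_sum]
    refine Finset.sum_congr rfl fun k _ => Finset.sum_congr rfl fun l _ => ?_
    ring
  set S : ℝ → ℝ := fun z => ∑ k ∈ Finset.range (2 ^ J), b k * dyadicIncr J k (ramp · z)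
  have hSm : Continuous S := by
    refine continuous_finsetSum _ fun k _ => continuous_const.mul ?_
    exact (ramp_continuous _).sub (ramp_continuous _)
  have hSLp : MemLp (fun q : ℝ × ℝ => S (q.2 - q.1) - S q.2) 2 (rieszMeasure α) ∧
      ∀ hS : MemLp (fun q : ℝ × ℝ => S (q.2 - q.1) - S q.2) 2 (rieszMeasure α),
      hS.toLp _ = ∑ k ∈ Finset.range (2 ^ J), b k • dyadicIncr J k h := by
    have e1 : (∑ k ∈ Finset.range (2 ^ J), b k • dyadicIncr J k h : Lp ℝ 2 (rieszMeasure α)) =ᵐ[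
        rieszMeasure α] fun q => S (q.2 - q.1) - S q.2 := by
      have hk : ∀ k, (b k • dyadicIncr J k h : Lp ℝ 2 (rieszMeasure α)) =ᵐ[rieszMeasure α]
          fun q => b k * (dyadicIncr J k (ramp · (q.2 - q.1)) - dyadicIncr J k (ramp · q.2)) := by
        intro k
        simp only [dyadicIncr]
        filter_upwards [Lp.coeFn_smul (b k) (h (dyadic J (k + 1)) - h (dyadic J k)),
          Lp.coeFn_sub (h (dyadic J (k + 1))) (h (dyadic J k)),
          (hL' (dyadic J (k + 1))).coeFn_toLp, (hL' (dyadic J k)).coeFn_toLp] with q q1 q2 q3 q4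
        rw [q1, Pi.smul_apply, q2, Pi.sub_apply, q3, q4, max_eq_left (dyadic_nonneg _ _),
          max_eq_left (dyadic_nonneg _ _), smul_eq_mul]
        ring
      filter_upwards [Lp.coeFn_finsetSum (Finset.range (2 ^ J)) (fun k => b k • dyadicIncr J k h),
        ae_all_iff.2 hk] with q q1 q2
      rw [q1, Finset.sum_apply]
      simp only [q2, S, ← Finset.sum_sub_distrib, mul_sub]
    refine ⟨(memLp_congr_ae e1).1 (Lp.memLp _), fun hS => ?_⟩
    exact Lp.ext (hS.coeFn_toLp.trans e1.symm)
  have h5 := norm_toLp_sq hSLp.1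
  rw [hSLp.2, hsum, lintegral_rieszMeasure α hSm.measurable] at h5
  rw [← h5, ENNReal.ofReal_mul ENNReal.toReal_nonneg, ENNReal.ofReal_toReal hκ.ne]

/-- The sum telescopes to the linear interpolation of `F - F 0` between neighbouring dyadic points:
full cells to the left contribute their whole increment, the cell of `z` a fraction of it. -/
theorem sum_dyadicIncr_ramp_of_mem {F : ℝ → ℝ} {J m : ℕ} (hm : m < 2 ^ J) {z : ℝ}
    (hz : z ∈ Ico (dyadic J m) (dyadic J (m + 1))) :
    2 ^ J * ∑ k ∈ Finset.range (2 ^ J), dyadicIncr J k F * dyadicIncr J k (ramp · z) =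
      F (dyadic J m) - F 0 + 2 ^ J * (z - dyadic J m) * (F (dyadic J (m + 1)) - F (dyadic J m)) := by
  have h0 := dyadic_nonneg J
  have hz0 : 0 ≤ z := (h0 m).trans hz.1
  have hlt : ∀ k < m, dyadicIncr J k (ramp · z) = (1 / 2 ^ J : ℝ) := fun k hk => by
    have h1 : dyadic J (k + 1) ≤ z := (dyadic_mono J hk).trans hz.1
    have h2 : dyadic J k ≤ z := (dyadic_mono J hk.le).trans hz.1
    simp only [dyadicIncr, ramp]
    rw [min_eq_right h1, min_eq_right h2, max_eq_right (h0 _), max_eq_right (h0 _)]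
    simp only [dyadic]
    push_cast
    ring
  have hm' : dyadicIncr J m (ramp · z) = z - dyadic J m := by
    simp only [dyadicIncr, ramp]
    rw [min_eq_left hz.2.le, min_eq_right hz.1, max_eq_right hz0, max_eq_right (h0 _)]
  have hgt : ∀ k, m < k → dyadicIncr J k (ramp · z) = 0 := fun k hk => by
    have h1 : z ≤ dyadic J k := hz.2.le.trans (dyadic_mono J hk)
    have h2 : z ≤ dyadic J (k + 1) := h1.trans (dyadic_mono J k.le_succ)
    simp only [dyadicIncr, ramp]
    rw [min_eq_left h1, min_eq_left h2, sub_self]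
  have hsplit : ∑ k ∈ Finset.range (2 ^ J), dyadicIncr J k F * dyadicIncr J k (ramp · z) =
      ∑ k ∈ Finset.range (m + 1), dyadicIncr J k F * dyadicIncr J k (ramp · z) := by
    symm
    refine Finset.sum_subset (Finset.range_subset_range.2 hm) fun k _ hk => ?_
    rw [hgt k (by simpa using hk), mul_zero]
  rw [hsplit, Finset.sum_range_succ, hm', Finset.sum_congr rfl fun k hk => by
    rw [hlt k (Finset.mem_range.1 hk)], ← Finset.sum_mul, sum_dyadicIncr, dyadicIncr_sub_eq]
  field_simp

theorem tendsto_sum_dyadicIncr_ramp {F : ℝ → ℝ} (hF : Continuous F) {z : ℝ} (hz : z ∈ Ico (0 : ℝ) 1) :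
    Tendsto (fun J : ℕ => 2 ^ J * ∑ k ∈ Finset.range (2 ^ J),
      dyadicIncr J k F * dyadicIncr J k (ramp · z)) atTop (𝓝 (F z - F 0)) := by
  rw [Metric.tendsto_atTop]
  intro ε hε
  obtain ⟨δ, hδ, hδF⟩ := Metric.continuousAt_iff.1 hF.continuousAt (ε / 3) (by positivity)
  obtain ⟨J₀, hJ₀⟩ := exists_pow_lt_of_lt_one hδ (by norm_num : (1 / 2 : ℝ) < 1)
  refine ⟨J₀, fun J hJ => ?_⟩
  have h2J : (0 : ℝ) < 2 ^ J := by positivity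
  have hJ' : 1 / 2 ^ J < δ := by
    rw [← one_div_pow]
    exact (pow_le_pow_of_le_one (by norm_num) (by norm_num) hJ).trans_lt hJ₀
  set m := ⌊2 ^ J * z⌋₊
  have hx0 : 0 ≤ 2 ^ J * z := mul_nonneg h2J.le hz.1
  have hm : m < 2 ^ J := by
    rw [Nat.floor_lt hx0]; push_cast; nlinarith [hz.2]
  have hzm : z ∈ Ico (dyadic J m) (dyadic J (m + 1)) := by
    constructor
    · rw [dyadic, div_le_iff₀ h2J, mul_comm]; exact Nat.floor_le hx0
    · rw [dyadic, lt_div_iff₀ h2J, mul_comm]; push_cast; exact Nat.lt_floor_add_one _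
  have hlen : dyadic J (m + 1) = dyadic J m + 1 / 2 ^ J := by
    simp only [dyadic]; push_cast; ring
  rw [sum_dyadicIncr_ramp_of_mem hm hzm, Real.dist_eq]
  have h1 : |F (dyadic J m) - F z| < ε / 3 := hδF (by
    rw [Real.dist_eq, abs_lt]; constructor <;> linarith [hzm.1, hzm.2])
  have h2 : |F (dyadic J (m + 1)) - F z| < ε / 3 := hδF (by
    rw [Real.dist_eq, abs_lt]; constructor <;> linarith [hzm.1, hzm.2])
  have h3 : |2 ^ J * (z - dyadic J m)| ≤ 1 := by
    rw [abs_of_nonneg (mul_nonneg h2J.le (by linarith [hzm.1])), ← le_div_iff₀' h2J]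
    linarith [hzm.2]
  calc _ = |(F (dyadic J m) - F z) + 2 ^ J * (z - dyadic J m) *
        ((F (dyadic J (m + 1)) - F z) - (F (dyadic J m) - F z))| := by congr 1; ring
    _ ≤ |F (dyadic J m) - F z| + |2 ^ J * (z - dyadic J m)| *
        (|F (dyadic J (m + 1)) - F z| + |F (dyadic J m) - F z|) := by
        refine (abs_add_le _ _).trans ?_
        rw [abs_mul]
        gcongr
        exact abs_sub _ _
    _ ≤ |F (dyadic J m) - F z| + 1 *
        (|F (dyadic J (m + 1)) - F z| + |F (dyadic J m) - F z|) := by gcongr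
    _ < ε := by linarith

/-- The vanishing norms are, up to a constant, Gagliardo seminorms of interpolants that converge to
`F - F 0` on `[0,1)`. Fatou's lemma gives `F x = F y` for almost all pairs in `(0,1)`, and
continuity extends this to `[0,1]`. -/
theorem IsFractionalCurve.eq_of_tendsto_zero (hX : IsFractionalCurve p X) (hp : 1 < p) (hp2 : p < 2)
    {F : ℝ → ℝ} (hF : Continuous F)
    (hlim : Tendsto (fun J : ℕ => (2 : ℝ) ^ J • ∑ k ∈ Finset.range (2 ^ J),
      dyadicIncr J k F • dyadicIncr J k X) atTop (𝓝 0)) {t : ℝ} (ht : t ∈ Icc (0 : ℝ) 1) :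
    F t = F 0 := by
  set α := 3 - p with hαdef
  set S : ℕ → ℝ → ℝ := fun J z => ∑ k ∈ Finset.range (2 ^ J),
    (2 ^ J * dyadicIncr J k F) * dyadicIncr J k (ramp · z)
  have hSc : ∀ J, Continuous (S J) := fun J =>
    continuous_finsetSum _ fun k _ => continuous_const.mul
      ((ramp_continuous _).sub (ramp_continuous _))
  have hS : ∀ z ∈ Ico (0 : ℝ) 1, Tendsto (fun J => S J z) atTop (𝓝 (F z - F 0)) := fun z hz => by
    have := tendsto_sum_dyadicIncr_ramp hF hz
    simpa only [S, Finset.mul_sum, mul_assoc] using this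
  have hg : Tendsto (fun J => gagliardo α (S J)) atTop (𝓝 0) := by
    have h1 : ∀ J, gagliardo α (S J) = gagliardo α (ramp 1) *
        ENNReal.ofReal (‖(2 : ℝ) ^ J • ∑ k ∈ Finset.range (2 ^ J),
          dyadicIncr J k F • dyadicIncr J k X‖ ^ 2) := fun J => by
      rw [hX.gagliardo_sum_ramp hp hp2 J, Finset.smul_sum]
      simp_rw [smul_smul]
      rfl
    simp_rw [h1]
    have h2 : Tendsto (fun J : ℕ => ENNReal.ofReal (‖(2 : ℝ) ^ J • ∑ k ∈ Finset.range (2 ^ J),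
        dyadicIncr J k F • dyadicIncr J k X‖ ^ 2)) atTop (𝓝 0) := by
      have := ENNReal.tendsto_ofReal ((hlim.norm).pow 2)
      simpa using this
    have h3 := ENNReal.Tendsto.const_mul h2
      (Or.inr (gagliardo_ramp_lt_top (α := α) (by linarith) (by linarith)).ne)
    simpa using h3
  have hK : Measurable fun q : ℝ × ℝ => rieszKernel α q.1 :=
    (measurable_rieszKernel α).comp measurable_fst
  have hiter : ∀ J, ∫⁻ q : ℝ × ℝ, rieszKernel α q.1 * ‖S J (q.2 - q.1) - S J q.2‖ₑ ^ 2 =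
      gagliardo α (S J) := fun J => by
    have hm : Measurable fun q : ℝ × ℝ => ‖S J (q.2 - q.1) - S J q.2‖ₑ ^ 2 := by
      have := (hSc J).measurable
      fun_prop
    rw [← lintegral_rieszMeasure α (hSc J).measurable, rieszMeasure,
      lintegral_withDensity_eq_lintegral_mul _ hK hm]
    rfl
  have hmeas : ∀ J, Measurable fun q : ℝ × ℝ =>
      rieszKernel α q.1 * ‖S J (q.2 - q.1) - S J q.2‖ₑ ^ 2 := fun J => by
    have := (hSc J).measurable
    fun_prop
  have hfatou := lintegral_liminf_le (μ := (volume : Measure (ℝ × ℝ))) (u := atTop) hmeas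
  simp_rw [hiter] at hfatou
  have hlm : Measurable fun q : ℝ × ℝ => liminf (fun J =>
      rieszKernel α q.1 * ‖S J (q.2 - q.1) - S J q.2‖ₑ ^ 2) atTop := Measurable.liminf hmeas
  rw [hg.liminf_eq, nonpos_iff_eq_zero, lintegral_eq_zero_iff hlm] at hfatou
  have hae : ∀ᵐ q : ℝ × ℝ, q.2 ∈ Ioo (0 : ℝ) 1 → q.2 - q.1 ∈ Ioo (0 : ℝ) 1 →
      F (q.2 - q.1) = F q.2 := by
    filter_upwards [hfatou] with q hq h1 h2
    by_contra hne
    have hr : q.1 ≠ 0 := fun h => hne (by rw [h, sub_zero])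
    have h3 : Tendsto (fun J => rieszKernel α q.1 * ‖S J (q.2 - q.1) - S J q.2‖ₑ ^ 2) atTop
        (𝓝 (rieszKernel α q.1 * ‖(F (q.2 - q.1) - F 0) - (F q.2 - F 0)‖ₑ ^ 2)) := by
      refine ENNReal.Tendsto.const_mul ?_ (Or.inr ENNReal.ofReal_ne_top)
      exact ENNReal.Tendsto.pow
        ((hS _ (Ioo_subset_Ico_self h2)).sub (hS _ (Ioo_subset_Ico_self h1))).enorm
    rw [h3.liminf_eq, Pi.zero_apply, mul_eq_zero] at hq
    rcases hq with hq | hq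
    · rw [rieszKernel, ENNReal.ofReal_eq_zero] at hq
      exact absurd hq (not_le.2 (Real.rpow_pos_of_pos (abs_pos.2 hr) _))
    · simp only [pow_eq_zero_iff, ne_eq, OfNat.ofNat_ne_zero, not_false_eq_true, enorm_eq_zero] at hq
      exact hne (by linarith)
  -- The exceptional set is open because `F` is continuous; being null, it is empty.
  have hopen : IsOpen {q : ℝ × ℝ | q.2 ∈ Ioo (0 : ℝ) 1 ∧ q.2 - q.1 ∈ Ioo (0 : ℝ) 1 ∧
      F (q.2 - q.1) ≠ F q.2} := by
    refine (isOpen_Ioo.preimage continuous_snd).inter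
      ((isOpen_Ioo.preimage (continuous_snd.sub continuous_fst)).inter ?_)
    exact isOpen_ne_fun (hF.comp (continuous_snd.sub continuous_fst)) (hF.comp continuous_snd)
  have hempty := hopen.eq_empty_of_measure_zero (μ := (volume : Measure (ℝ × ℝ))) (by
    refine measure_mono_null (fun q hq => ?_) (ae_iff.1 hae)
    simp only [mem_ofPred_eq, Classical.not_imp]
    exact hq)
  have hconst : ∀ x ∈ Ioo (0 : ℝ) 1, ∀ y ∈ Ioo (0 : ℝ) 1, F x = F y := fun x hx y hy => by
    by_contra hne
    have : ((y - x, y) : ℝ × ℝ) ∈ (∅ : Set (ℝ × ℝ)) := by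
      rw [← hempty]
      simp only [mem_ofPred_eq, sub_sub_cancel]
      exact ⟨hy, hx, hne⟩
    exact this
  have hhalf : ∀ x ∈ Icc (0 : ℝ) 1, F x = F (1 / 2) := by
    have hcl : closure (Ioo (0 : ℝ) 1) = Icc 0 1 := closure_Ioo zero_ne_one
    intro x hx
    rw [← hcl] at hx
    exact closure_minimal (fun y hy => hconst y hy _ (by norm_num))
      (isClosed_eq hF continuous_const) hx
  rw [hhalf t ht, hhalf 0 (by norm_num)]

end Nondegenerate

/-! ### The support of a centered Gaussian measure -/

section Support

theorem map_mem_support {X Y : Type*} [TopologicalSpace X] [MeasurableSpace X] [BorelSpace X]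
    [TopologicalSpace Y] [MeasurableSpace Y] [BorelSpace Y] {μ : Measure X} {f : X → Y}
    (hf : Continuous f) {x : X} (hx : x ∈ μ.support) : f x ∈ (μ.map f).support := by
  rw [Measure.mem_support_iff_forall] at hx ⊢
  intro U hU
  exact (hx _ (hf.continuousAt hU)).trans_le (Measure.le_map_apply hf.measurable.aemeasurable U)

theorem mk_mem_support_prod {X Y : Type*} [TopologicalSpace X] [MeasurableSpace X]
    [TopologicalSpace Y] [MeasurableSpace Y] {μ : Measure X} {ν : Measure Y} [SFinite ν]
    {x : X} {y : Y} (hx : x ∈ μ.support) (hy : y ∈ ν.support) : (x, y) ∈ (μ.prod ν).support := by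
  rw [Measure.mem_support_iff_forall] at hx hy ⊢
  intro U hU
  obtain ⟨u, hu, v, hv, huv⟩ := mem_nhds_prod_iff.1 hU
  refine lt_of_lt_of_le ?_ (measure_mono huv)
  rw [Measure.prod_prod]
  exact ENNReal.mul_pos (hx u hu).ne' (hy v hv).ne'

variable {E : Type*} [NormedAddCommGroup E] [NormedSpace ℝ E] [MeasurableSpace E] [BorelSpace E]
  [SecondCountableTopology E] [CompleteSpace E] {μ : Measure E} [IsGaussian μ]

/-- For a centered Gaussian measure the product `μ ⊗ μ` is invariant under rotations. Rotating the
point `(x, y)` of its support and projecting to the first factor stays in the support of `μ`. -/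
theorem cos_smul_add_sin_smul_mem_support (h0 : ∀ ℓ : StrongDual ℝ E, μ[ℓ] = 0) {x y : E}
    (hx : x ∈ μ.support) (hy : y ∈ μ.support) (θ : ℝ) :
    Real.cos θ • x + Real.sin θ • y ∈ μ.support := by
  have h := map_mem_support (ContinuousLinearMap.rotation (E := E) θ).continuous
    (mk_mem_support_prod hx hy)
  rw [IsGaussian.map_rotation_eq_self_of_forall_strongDual_eq_zero h0] at h
  have h2 := map_mem_support continuous_fst h
  rw [Measure.map_fst_prod] at h2
  simpa [ContinuousLinearMap.rotation_apply] using h2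

theorem zero_mem_support (h0 : ∀ ℓ : StrongDual ℝ E, μ[ℓ] = 0) : (0 : E) ∈ μ.support := by
  obtain ⟨x, hx⟩ := Measure.nonempty_support (IsProbabilityMeasure.ne_zero μ)
  -- Rotation by `π` reflects `x`; rotation by `π/4` then cancels `x` against `-x`.
  have hx' : -x ∈ μ.support := by
    simpa using cos_smul_add_sin_smul_mem_support h0 hx hx Real.pi
  simpa using cos_smul_add_sin_smul_mem_support h0 hx hx' (Real.pi / 4)

theorem add_mem_support (h0 : ∀ ℓ : StrongDual ℝ E, μ[ℓ] = 0) {x y : E}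
    (hx : x ∈ μ.support) (hy : y ∈ μ.support) : x + y ∈ μ.support := by
  have h := cos_smul_add_sin_smul_mem_support h0 hx hy (Real.pi / 4)
  -- The first rotation yields `(√2/2)(x + y)`; rotating this point with itself multiplies it by
  -- `√2`.
  have h' := cos_smul_add_sin_smul_mem_support h0 h h (Real.pi / 4)
  have h2 : √2 / 2 * (√2 / 2) = (1 / 2 : ℝ) := by
    have := Real.mul_self_sqrt (show (0 : ℝ) ≤ 2 by norm_num)
    linarith
  rw [Real.cos_pi_div_four, Real.sin_pi_div_four, smul_add, smul_smul, smul_smul, h2] at h'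
  convert h' using 1
  module

theorem smul_mem_support (h0 : ∀ ℓ : StrongDual ℝ E, μ[ℓ] = 0) {x : E}
    (hx : x ∈ μ.support) (c : ℝ) : c • x ∈ μ.support := by
  -- A factor in `[-1,1]` is a cosine, used with `y = 0`; larger factors are reached by adding `n`
  -- copies of `(c/n) • x`.
  have h1 : ∀ c : ℝ, |c| ≤ 1 → c • x ∈ μ.support := fun c hc => by
    have := cos_smul_add_sin_smul_mem_support h0 hx (zero_mem_support h0) (Real.arccos c)
    rwa [Real.cos_arccos (abs_le.1 hc).1 (abs_le.1 hc).2, smul_zero, add_zero] at this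
  obtain ⟨n, hn⟩ := exists_nat_gt |c|
  have hn0 : (0 : ℝ) < n := (abs_nonneg c).trans_lt hn
  have hm : ∀ m : ℕ, (m : ℝ) • ((c / n) • x) ∈ μ.support := fun m => by
    induction m with
    | zero => simpa using zero_mem_support h0
    | succ m ih =>
      push_cast
      rw [add_smul, one_smul]
      refine add_mem_support h0 ih (h1 _ ?_)
      rw [abs_div, Nat.abs_cast, div_le_one hn0]
      exact hn.le
  have := hm n
  rwa [smul_smul, mul_div_cancel₀ _ hn0.ne'] at this

/-- The support is a closed linear subspace. If it were proper, Hahn–Banach in the quotient would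
give a nonzero functional that vanishes on it, hence almost everywhere. -/
theorem support_eq_univ_of_nondegenerate (h0 : ∀ ℓ : StrongDual ℝ E, μ[ℓ] = 0)
    (hnd : ∀ ℓ : StrongDual ℝ E, ℓ =ᵐ[μ] 0 → ℓ = 0) : μ.support = univ := by
  let S : Submodule ℝ E :=
    { carrier := μ.support
      add_mem' := add_mem_support h0
      zero_mem' := zero_mem_support h0
      smul_mem' := fun c _ hx => smul_mem_support h0 hx c }
  have hS : IsClosed (S : Set E) := Measure.isClosed_support
  by_contra hne
  obtain ⟨x, hx⟩ := (ne_univ_iff_exists_notMem _).1 hne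
  have := hS
  have hx0 : S.mkQL x ≠ 0 := fun h => hx ((Submodule.Quotient.mk_eq_zero S).1 h)
  obtain ⟨f, hf⟩ := SeparatingDual.exists_ne_zero (R := ℝ) hx0
  have hz := hnd (f.comp S.mkQL) (by
    filter_upwards [Measure.support_mem_ae (μ := μ)] with y hy
    have : S.mkQL y = 0 := (Submodule.Quotient.mk_eq_zero S).2 hy
    simp [this])
  exact hf (by simpa using DFunLike.congr_fun hz x)

theorem measure_closedBall_pos_of_nondegenerate (h0 : ∀ ℓ : StrongDual ℝ E, μ[ℓ] = 0)
    (hnd : ∀ ℓ : StrongDual ℝ E, ℓ =ᵐ[μ] 0 → ℓ = 0) (x : E) {ε : ℝ} (hε : 0 < ε) :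
    0 < μ (Metric.closedBall x ε) := by
  have hx : x ∈ μ.support := by rw [support_eq_univ_of_nondegenerate h0 hnd]; trivial
  exact (Measure.mem_support_iff_forall x).1 hx _ (Metric.closedBall_mem_nhds x hε)

end Support

/-! ### Absolute continuity of nondegenerate Gaussian measures in finite dimension -/

section AbsCont

theorem pi_absolutelyContinuous : ∀ {d : ℕ} {μ ν : Fin d → Measure ℝ} [∀ i, SigmaFinite (μ i)]
    [∀ i, SigmaFinite (ν i)], (∀ i, μ i ≪ ν i) → Measure.pi μ ≪ Measure.pi ν
  | 0, μ, ν, _, _, _ => by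
    rw [Measure.pi_of_empty μ finZeroElim, Measure.pi_of_empty ν finZeroElim]
  | d + 1, μ, ν, _, _, h => by
    have e1 := (measurePreserving_piFinSuccAbove μ 0).symm
    have e2 := (measurePreserving_piFinSuccAbove ν 0).symm
    rw [← e1.map_eq, ← e2.map_eq]
    exact ((h 0).prod (pi_absolutelyContinuous fun i => h _)).map (MeasurableEquiv.measurable _)

variable {V : Type*} [NormedAddCommGroup V] [NormedSpace ℝ V] [FiniteDimensional ℝ V]
  [MeasurableSpace V] [BorelSpace V] {μ : Measure V} [IsGaussian μ]

/-- In a basis of the dual that is orthogonal for the covariance form, the coordinates are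
uncorrelated and jointly Gaussian, hence independent. Nondegeneracy makes all variances positive, so
the law is a product of Gaussians with densities. -/
theorem absContLebesgue_of_nondegenerate (h0 : ∀ ℓ : StrongDual ℝ V, μ[ℓ] = 0)
    (hnd : ∀ ℓ : StrongDual ℝ V, ℓ =ᵐ[μ] 0 → ℓ = 0) : AbsContLebesgue μ := by
  have := FiniteDimensional.proper ℝ V
  have := FiniteDimensional.complete ℝ V
  have hid : MemLp id 2 μ := IsGaussian.memLp_two_id
  have hfr : Module.finrank ℝ (StrongDual ℝ V) = Module.finrank ℝ V := by
    rw [← (LinearMap.toContinuousLinearMap (𝕜 := ℝ) (E := V) (F' := ℝ)).finrank_eq]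
    exact Subspace.dual_finrank_eq
  have : FiniteDimensional ℝ (StrongDual ℝ V) :=
    (LinearMap.toContinuousLinearMap (𝕜 := ℝ) (E := V) (F' := ℝ)).finiteDimensional
  obtain ⟨b, hb⟩ := LinearMap.BilinForm.exists_orthogonal_basis
    (B := (covarianceBilinDual μ).toBilinForm) ⟨covarianceBilinDual_comm⟩
  have hcov : ∀ i j, i ≠ j → cov[b i, b j; μ] = 0 := fun i j hij => by
    rw [← covarianceBilinDual_eq_covariance hid]
    exact hb hij
  have hvar : ∀ i, Var[b i; μ] ≠ 0 := fun i h => by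
    refine b.ne_zero i (hnd _ ?_)
    have := ae_eq_integral_of_variance_eq_zero (IsGaussian.memLp_dual μ (b i) 2 (by simp)) h
    rwa [h0] at this
  let T : V →ₗ[ℝ] (Fin (Module.finrank ℝ (StrongDual ℝ V)) → ℝ) :=
    LinearMap.pi fun i => (b i : V →ₗ[ℝ] ℝ)
  have hT : Function.Injective T := by
    rw [← LinearMap.ker_eq_bot, LinearMap.ker_eq_bot']
    intro x hx
    by_contra hx0
    obtain ⟨f, hf⟩ := SeparatingDual.exists_ne_zero (R := ℝ) hx0
    refine hf ?_
    have hxi : ∀ i, b i x = 0 := fun i => congrFun hx i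
    have : f = ∑ i, b.repr f i • b i := (b.sum_repr f).symm
    rw [this, sum_apply]
    exact Finset.sum_eq_zero fun i _ => by rw [smul_apply, hxi, smul_zero]
  let e : V ≃L[ℝ] (Fin (Module.finrank ℝ (StrongDual ℝ V)) → ℝ) :=
    (LinearEquiv.ofInjectiveOfFinrankEq T hT (by simp [hfr])).toContinuousLinearEquiv
  have he : ∀ x i, e x i = b i x := fun x i => rfl
  have hlaw : HasGaussianLaw (fun x i => b i x) μ :=
    (IsGaussian.hasGaussianLaw_id (μ := μ)).map_equiv e
  have hmap : μ.map e = Measure.pi fun i => μ.map (b i) :=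
    (iIndepFun_iff_map_fun_eq_pi_map fun i => (b i).continuous.aemeasurable).1
      (hlaw.iIndepFun_of_covariance_eq_zero hcov)
  have hac : μ.map e ≪ volume := by
    rw [hmap]
    have : ∀ i, IsProbabilityMeasure (μ.map (b i)) := fun i =>
      Measure.isProbabilityMeasure_map (b i).continuous.aemeasurable
    refine pi_absolutelyContinuous fun i => ?_
    rw [IsGaussian.map_eq_gaussianReal (b i)]
    refine gaussianReal_absolutelyContinuous _ ?_
    simpa using lt_of_le_of_ne (variance_nonneg _ _) (hvar i).symm
  refine ⟨_, e.symm, ?_⟩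
  have := hac.map e.symm.continuous.measurable
  rwa [Measure.map_map e.symm.continuous.measurable e.continuous.measurable,
    show (e.symm ∘ e : V → V) = id by ext; simp, Measure.map_id] at this

end AbsCont

/-! ### Decomposable measures -/

section Decomposable

variable {E : Type*} [NormedAddCommGroup E] [NormedSpace ℝ E] {F : ℕ → Submodule ℝ E}

theorem coe_headProj_add_coe_tailProj (hF : IsSplitting F) (n : ℕ) (x : E) :
    (headProj hF n x : E) + (tailProj hF n x : E) = x :=
  Submodule.projectionL_add_projectionL_eq_self (hF.topCompl n) x

theorem headProj_coe (hF : IsSplitting F) (n : ℕ) (x : headSpace F n) :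
    headProj hF n x = x :=
  Submodule.projectionOntoL_apply_left (hF.topCompl n) x

theorem finiteDimensional_headSpace [∀ n, FiniteDimensional ℝ (F n)] (n : ℕ) :
    FiniteDimensional ℝ (headSpace F n) := by
  have : headSpace F n = ⨆ k : Fin (n + 1), F k :=
    le_antisymm (iSup₂_le fun k hk => le_iSup (fun k : Fin (n + 1) => F k) ⟨k, by omega⟩)
      (iSup_le fun k => le_iSup₂ (f := fun k (_ : k ≤ n) => F k) (k : ℕ) (by omega))
  rw [this]
  infer_instance

variable [MeasurableSpace E] [BorelSpace E]

theorem hasPositivity_of_measure_closedBall_pos (e : ℕ → E) (hF : IsSplitting F) (μ : Measure E)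
    [IsFiniteMeasure μ] (h : ∀ x : E, ∀ ε > (0 : ℝ), 0 < μ (Metric.closedBall x ε)) :
    HasPositivity e hF μ := by
  -- Full support makes the positivity condition hold around every point, so `Y = 0` and `R_N = 1`
  -- suffice.
  refine ⟨0, 0, by simp, fun n δ hδ => ?_, fun N => ⟨1, one_pos, fun x₀ _ ε hε => ?_⟩⟩
  · have hU : headProj hF n ⁻¹' Metric.closedBall (headProj hF n 0) δ ∈ 𝓝 (0 : E) :=
      (headProj hF n).continuous.continuousAt (Metric.closedBall_mem_nhds _ hδ)
    obtain ⟨ε, hε, hsub⟩ := Metric.nhds_basis_closedBall.mem_iff.1 hU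
    exact ((h 0 ε hε).trans_le (measure_mono hsub)).trans_le
      (Measure.le_map_apply (headProj hF n).continuous.aemeasurable _)
  · refine ⟨(μ (Metric.closedBall (x₀ : E) ε)).toReal,
      ENNReal.toReal_pos (h _ _ hε).ne' (measure_ne_top _ _), ?_⟩
    rw [ENNReal.ofReal_toReal (measure_ne_top _ _)]

theorem exists_isDecomposition [SecondCountableTopology E] (hF : IsSplitting F) [∀ n, FiniteDimensional ℝ (F n)]
    (μ : Measure E) [IsProbabilityMeasure μ] : ∃ l, IsDecomposition hF μ l := by
  have hfd := finiteDimensional_headSpace (F := F)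
  have : ∀ n, StandardBorelSpace (headSpace F n) := fun n => by
    have := FiniteDimensional.proper ℝ (headSpace F n)
    infer_instance
  have hm : ∀ n, Measurable fun x => (tailProj hF n x, headProj hF n x) := fun n =>
    (tailProj hF n).continuous.measurable.prodMk (headProj hF n).continuous.measurable
  let ρ n := μ.map fun x => (tailProj hF n x, headProj hF n x)
  have : ∀ n, IsProbabilityMeasure (ρ n) := fun n =>
    Measure.isProbabilityMeasure_map (hm n).aemeasurable
  -- The kernel is the regular conditional law of the `G_n`-component given the `G^n`-component. It
  -- exists because `G_n` is finite dimensional and thus standard Borel.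
  refine ⟨fun n => (ρ n).condKernel, fun n => inferInstance, fun n A hA => ?_⟩
  have hfst : (ρ n).fst = tailMarginal hF μ n := by
    rw [Measure.fst, Measure.map_map measurable_fst (hm n)]
    rfl
  have hadd : Measurable fun p : tailSpace F n × headSpace F n => (p.2 : E) + (p.1 : E) :=
    (measurable_subtype_coe.comp measurable_snd).add (measurable_subtype_coe.comp measurable_fst)
  have h1 : μ A = ρ n ((fun p => (p.2 : E) + (p.1 : E)) ⁻¹' A) := by
    rw [Measure.map_apply (hm n) (hadd hA)]
    congr 1
    ext x
    simp [coe_headProj_add_coe_tailProj]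
  have h2 : ρ n ((fun p => (p.2 : E) + (p.1 : E)) ⁻¹' A) =
      ((ρ n).fst ⊗ₘ (ρ n).condKernel) ((fun p => (p.2 : E) + (p.1 : E)) ⁻¹' A) := by
    rw [(ρ n).disintegrate (ρ n).condKernel]
  rw [h1, h2, Measure.compProd_apply (hadd hA), hfst]
  rfl

/-- Nondegeneracy passes to the marginals: a functional on `G_n` pulls back along the projection,
which is the identity on `G_n`. -/
theorem hasAbsContMarginals_of_nondegenerate (hF : IsSplitting F) [∀ n, FiniteDimensional ℝ (F n)]
    {μ : Measure E} [IsGaussian μ] (h0 : ∀ ℓ : StrongDual ℝ E, μ[ℓ] = 0)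
    (hnd : ∀ ℓ : StrongDual ℝ E, ℓ =ᵐ[μ] 0 → ℓ = 0) : HasAbsContMarginals hF μ := by
  intro n
  have : FiniteDimensional ℝ (headSpace F n) := finiteDimensional_headSpace n
  have hm := (headProj hF n).continuous.measurable
  have hG : IsGaussian (headMarginal hF μ n) := isGaussian_map (headProj hF n)
  refine absContLebesgue_of_nondegenerate (fun ℓ => ?_) fun ℓ hℓ => ?_
  · rw [headMarginal, integral_map hm.aemeasurable ℓ.continuous.aestronglyMeasurable]
    exact h0 (ℓ.comp (headProj hF n))
  · have h := hnd (ℓ.comp (headProj hF n)) (ae_of_ae_map hm.aemeasurable hℓ)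
    ext x
    have := DFunLike.congr_fun h (x : E)
    simpa [headProj_coe] using this

end Decomposable

/-! ### Random series in `L²` -/

section LpSeries

variable {Ω : Type*} [MeasurableSpace Ω] {P : Measure Ω}

theorem ofReal_norm_sq_eq_lintegral {E : Type*} [NormedAddCommGroup E] (f : Lp E 2 P) :
    ENNReal.ofReal (‖f‖ ^ 2) = ∫⁻ ω, ‖f ω‖ₑ ^ 2 ∂P := by
  rw [← norm_toLp_sq (Lp.memLp f), Lp.toLp_coeFn]

variable {E : Type*} [NormedAddCommGroup E] [NormedSpace ℝ E]

/-- The element `ω ↦ f ω • v` of `L²(Ω; E)`, for a real `f ∈ L²(Ω)` and a vector `v`. -/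
def lpSMul (v : E) : Lp ℝ 2 P →L[ℝ] Lp E 2 P :=
  (ContinuousLinearMap.toSpanSingleton ℝ v).compLpL 2 P

theorem coeFn_lpSMul (v : E) (f : Lp ℝ 2 P) : lpSMul v f =ᵐ[P] fun ω => f ω • v :=
  ContinuousLinearMap.coeFn_compLpL _ _

theorem compLpL_lpSMul (L : E →L[ℝ] ℝ) (v : E) (f : Lp ℝ 2 P) :
    L.compLpL 2 P (lpSMul v f) = L v • f := by
  refine Lp.ext ?_
  filter_upwards [L.coeFn_compLpL (p := 2) (μ := P) (lpSMul v f), coeFn_lpSMul v f,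
    Lp.coeFn_smul (L v) f] with ω h1 h2 h3
  rw [h1, h2, h3, map_smul, Pi.smul_apply, smul_eq_mul, smul_eq_mul, mul_comm]

/-- The deterministic estimate is applied for almost every `ω` and then integrated. -/
theorem norm_sum_lpSMul_sq_le {v : ℕ → E} {w : ℕ → ℝ} {C : ℝ}
    (hC : ∀ (c : ℕ → ℝ) (F : Finset ℕ), ‖∑ n ∈ F, c n • v n‖ ≤ C * √(∑ n ∈ F, (w n * c n) ^ 2))
    (f : ℕ → Lp ℝ 2 P) (F : Finset ℕ) :
    ‖∑ n ∈ F, lpSMul (v n) (f n)‖ ^ 2 ≤ C ^ 2 * ∑ n ∈ F, (w n * ‖f n‖) ^ 2 := by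
  rw [← ENNReal.ofReal_le_ofReal_iff (by positivity), ofReal_norm_sq_eq_lintegral,
    ENNReal.ofReal_mul (by positivity), ENNReal.ofReal_sum_of_nonneg fun _ _ => sq_nonneg _]
  have h1 : ∀ᵐ ω ∂P, ‖(∑ n ∈ F, lpSMul (v n) (f n) : Lp E 2 P) ω‖ₑ ^ 2 ≤
      ENNReal.ofReal (C ^ 2) * ∑ n ∈ F, ENNReal.ofReal (w n ^ 2) * ‖f n ω‖ₑ ^ 2 := by
    have hall : ∀ᵐ ω ∂P, ∀ n, lpSMul (v n) (f n) ω = f n ω • v n :=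
      ae_all_iff.2 fun n => coeFn_lpSMul (v n) (f n)
    filter_upwards [Lp.coeFn_finsetSum F fun n => lpSMul (v n) (f n), hall] with ω hω hn
    rw [hω, Finset.sum_apply, Finset.sum_congr rfl fun n _ => hn n]
    have h := pow_le_pow_left₀ (norm_nonneg _) (hC (fun n => f n ω) F) 2
    rw [mul_pow, Real.sq_sqrt (Finset.sum_nonneg fun _ _ => sq_nonneg _)] at h
    calc _ = ENNReal.ofReal (‖∑ n ∈ F, f n ω • v n‖ ^ 2) := by
          rw [ENNReal.ofReal_pow (norm_nonneg _), ofReal_norm]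
      _ ≤ _ := ENNReal.ofReal_le_ofReal h
      _ = _ := by
          rw [ENNReal.ofReal_mul (by positivity),
            ENNReal.ofReal_sum_of_nonneg fun _ _ => sq_nonneg _]
          congr 1
          refine Finset.sum_congr rfl fun n _ => ?_
          rw [mul_pow, ENNReal.ofReal_mul (sq_nonneg _), ← sq_abs (f n ω), ← Real.norm_eq_abs,
            ENNReal.ofReal_pow (norm_nonneg _), ofReal_norm]
  refine (lintegral_mono_ae h1).trans ?_
  have hmeas : ∀ n, AEMeasurable (fun ω => ‖f n ω‖ₑ ^ 2) P := fun n =>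
    (Lp.aestronglyMeasurable (f n)).enorm.pow_const 2
  rw [lintegral_const_mul'' _ (Finset.aemeasurable_fun_sum F fun n _ => (hmeas n).const_mul _),
    lintegral_finsetSum' F fun n _ => (hmeas n).const_mul _]
  gcongr with n
  rw [lintegral_const_mul'' _ (hmeas n), ← ofReal_norm_sq_eq_lintegral, mul_pow,
    ENNReal.ofReal_mul (sq_nonneg _)]

theorem summable_lpSMul [CompleteSpace E] {v : ℕ → E} {w : ℕ → ℝ} {C : ℝ}
    (hC : ∀ (c : ℕ → ℝ) (F : Finset ℕ), ‖∑ n ∈ F, c n • v n‖ ≤ C * √(∑ n ∈ F, (w n * c n) ^ 2))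
    {f : ℕ → Lp ℝ 2 P} (hf : Summable fun n => (w n * ‖f n‖) ^ 2) :
    Summable fun n => lpSMul (v n) (f n) := by
  rw [summable_iff_vanishing_norm] at hf ⊢
  intro ε hε
  obtain ⟨S, hS⟩ := hf (ε ^ 2 / (C ^ 2 + 1)) (by positivity)
  refine ⟨S, fun F hF => ?_⟩
  have h1 := norm_sum_lpSMul_sq_le hC f F
  have h2 := hS F hF
  rw [Real.norm_of_nonneg (Finset.sum_nonneg fun _ _ => sq_nonneg _),
    lt_div_iff₀ (by positivity)] at h2
  have h3 : 0 ≤ ∑ n ∈ F, (w n * ‖f n‖) ^ 2 := Finset.sum_nonneg fun _ _ => sq_nonneg _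
  exact lt_of_pow_lt_pow_left₀ 2 hε.le (by nlinarith)

end LpSeries

/-! ### Gaussian subspaces of `L²` -/

section GaussianSpace

variable {Ω : Type*} [MeasurableSpace Ω] {P : Measure Ω}

/-- An `L²` limit is an almost sure limit along a subsequence, so characteristic functions converge;
the variances `‖f‖²` converge with the norms. -/
theorem isClosed_setOf_map_eq_gaussianReal [IsProbabilityMeasure P] :
    IsClosed {f : Lp ℝ 2 P | P.map f = gaussianReal 0 (‖f‖₊ ^ 2)} := by
  refine IsSeqClosed.isClosed fun f g hf hg => ?_
  obtain ⟨u, hu, hae⟩ := (tendstoInMeasure_of_tendsto_Lp hg).exists_seq_tendsto_ae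
  have hgm : AEMeasurable g P := (Lp.aestronglyMeasurable g).aemeasurable
  have hfm : ∀ n, AEMeasurable (f n) P := fun n => (Lp.aestronglyMeasurable (f n)).aemeasurable
  have := Measure.isProbabilityMeasure_map hgm
  refine Measure.ext_of_charFun ?_
  ext t
  have h1 : Tendsto (fun n => charFun (P.map (f (u n))) t) atTop (𝓝 (charFun (P.map g) t)) := by
    simp_rw [charFun_apply_real]
    rw [integral_map hgm (by fun_prop)]
    refine (tendsto_integral_of_dominated_convergence (fun _ => (1 : ℝ))
      (F := fun n ω => Complex.exp (t * f (u n) ω * Complex.I)) (fun n => ?_)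
      (integrable_const _) (fun n => ?_) ?_).congr fun n => ?_
    · exact ((by fun_prop : Continuous fun x : ℝ => Complex.exp (t * x * Complex.I)).measurable.comp_aemeasurable
        (hfm (u n))).aestronglyMeasurable
    · refine ae_of_all _ fun ω => ?_
      rw [← Complex.ofReal_mul, Complex.norm_exp_ofReal_mul_I]
    · filter_upwards [hae] with ω hω
      exact ((by fun_prop : Continuous fun x : ℝ => Complex.exp (t * x * Complex.I)).tendsto _).comp hω
    · rw [integral_map (hfm (u n)) (by fun_prop)]
  have h2 : Tendsto (fun n => charFun (P.map (f (u n))) t) atTop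
      (𝓝 (charFun (gaussianReal 0 (‖g‖₊ ^ 2)) t)) := by
    have hn : Tendsto (fun n => ‖f (u n)‖₊ ^ 2) atTop (𝓝 (‖g‖₊ ^ 2)) :=
      ((hg.comp hu.tendsto_atTop).nnnorm).pow 2
    have he : ∀ n, P.map (f (u n)) = gaussianReal 0 (‖f (u n)‖₊ ^ 2) := fun n => hf (u n)
    simp_rw [he, charFun_gaussianReal]
    have hc : Continuous fun v : ℝ≥0 =>
        Complex.exp (t * (0 : ℝ) * Complex.I - (v : ℝ) * t ^ 2 / 2) := by fun_prop
    exact (hc.tendsto _).comp hn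
  exact tendsto_nhds_unique h1 h2

theorem map_eq_gaussianReal_of_mem_span {ι : Type*} {B : ι → Ω → ℝ} (hB : IsGaussianProcess B P)
    (h0 : ∀ t, ∫ ω, B t ω ∂P = 0) {X : ι → Lp ℝ 2 P} (hX : ∀ t, X t =ᵐ[P] B t) {f : Lp ℝ 2 P}
    (hf : f ∈ Submodule.span ℝ (range X)) : P.map f = gaussianReal 0 (‖f‖₊ ^ 2) := by
  obtain ⟨c, rfl⟩ := (Finsupp.mem_span_range_iff_exists_finsupp).1 hf
  set f : Lp ℝ 2 P := c.sum fun i a => a • X i with hfdef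
  have hae : f =ᵐ[P] fun ω => ∑ i ∈ c.support, c i • B i ω := by
    have hall : ∀ᵐ ω ∂P, ∀ i ∈ c.support, (c i • X i : Lp ℝ 2 P) ω = c i • B i ω := by
      refine (ae_ball_iff c.support.countable_toSet).2 fun i _ => ?_
      filter_upwards [Lp.coeFn_smul (c i) (X i), hX i] with ω h1 h2
      rw [h1, Pi.smul_apply, h2]
    filter_upwards [Lp.coeFn_finsetSum c.support fun i => c i • X i, hall] with ω h1 h2
    rw [hfdef, Finsupp.sum, h1, Finset.sum_apply]
    exact Finset.sum_congr rfl h2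
  have hg : HasGaussianLaw f P := (hB.smul c).hasGaussianLaw_fun_sum.congr hae.symm
  have hint : ∫ ω, f ω ∂P = 0 := by
    rw [integral_congr_ae hae, integral_finsetSum _ fun i _ =>
      show Integrable (fun ω => c i • B i ω) P from (hB.hasGaussianLaw_eval i).integrable.smul (c i)]
    exact Finset.sum_eq_zero fun i _ => by rw [integral_smul, h0, smul_zero]
  have hvar : Var[f; P] = ‖f‖ ^ 2 := by
    rw [variance_of_integral_eq_zero hg.aemeasurable hint, ← real_inner_self_eq_norm_sq,
      L2.inner_def]
    refine integral_congr_ae (ae_of_all _ fun ω => ?_)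
    simp [sq]
  rw [hg.map_eq_gaussianReal, hint, hvar]
  congr 1
  ext
  simp

end GaussianSpace


/-! ### Fractional Brownian motion as a curve in `L²` -/

section Curve

variable {Ω : Type*} [MeasurableSpace Ω] {P : Measure Ω} {H : ℝ}
  {B : ℝ≥0 → Ω → ℝ}

theorem IsFractionalBrownianMotion.memLp (hB : IsFractionalBrownianMotion H B P) (t : ℝ≥0) :
    MemLp (B t) 2 P :=
  (hB.gaussian.hasGaussianLaw_eval t).memLp_two

/-- Fractional Brownian motion as a curve in `L²(Ω)`. -/
def IsFractionalBrownianMotion.curve (hB : IsFractionalBrownianMotion H B P) (t : ℝ) : Lp ℝ 2 P :=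
  (hB.memLp t.toNNReal).toLp (B t.toNNReal)

theorem IsFractionalBrownianMotion.coeFn_curve (hB : IsFractionalBrownianMotion H B P) (t : ℝ) :
    hB.curve t =ᵐ[P] B t.toNNReal :=
  MemLp.coeFn_toLp _

theorem IsFractionalBrownianMotion.inner_curve (hB : IsFractionalBrownianMotion H B P) {t u : ℝ}
    (ht : 0 ≤ t) (hu : 0 ≤ u) :
    inner ℝ (hB.curve t) (hB.curve u) =
      (t ^ (2 * H) + u ^ (2 * H) - |t - u| ^ (2 * H)) / 2 := by
  have h := hB.cov t.toNNReal u.toNNReal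
  rw [covariance, hB.centered, hB.centered, Real.coe_toNNReal t ht, Real.coe_toNNReal u hu] at h
  rw [← h, L2.inner_def]
  refine integral_congr_ae ?_
  filter_upwards [hB.coeFn_curve t, hB.coeFn_curve u] with ω h1 h2
  simp [h1, h2, mul_comm]

theorem IsFractionalBrownianMotion.isFractionalCurve (hB : IsFractionalBrownianMotion H B P)
    (hH : 0 < H) : IsFractionalCurve (2 * H) hB.curve := by
  intro t u ht hu
  rw [norm_sub_sq_real, ← real_inner_self_eq_norm_sq, ← real_inner_self_eq_norm_sq,
    hB.inner_curve ht ht, hB.inner_curve hu hu, hB.inner_curve ht hu, sub_self, sub_self, abs_zero,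
    Real.zero_rpow (by linarith)]
  ring

end Curve

/-! ### The step functions form a continuous curve -/

theorem ofFun_sub {s : ℝ} (hs : s ≤ 0) {f g : ℝ → ℝ} (hf : MemLp f 2 (volume.restrict (Ioc 0 1)))
    (hg : MemLp g 2 (volume.restrict (Ioc 0 1))) : ofFun s f - ofFun s g = ofFun s (f - g) := by
  refine pairing_ext fun φ => ?_
  have hφ : MemLp φ 2 (volume.restrict (Ioc (0 : ℝ) 1)) := (memLp_testFunction φ).restrict _
  have hint : ∀ {h : ℝ → ℝ}, MemLp h 2 (volume.restrict (Ioc 0 1)) →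
      IntervalIntegrable (fun x => h x * φ x) volume 0 1 := fun hh =>
    (intervalIntegrable_iff_integrableOn_Ioc_of_le zero_le_one).2 (hh.integrable_mul hφ)
  rw [← pairingL_apply, map_sub, pairingL_apply, pairingL_apply, represents_ofFun hs hf,
    represents_ofFun hs hg, represents_ofFun hs (hf.sub hg),
    ← intervalIntegral.integral_sub (hint hf) (hint hg)]
  simp only [Pi.sub_apply, sub_mul]

theorem norm_stepVec_sub_le {s : ℝ} (hs : s ≤ 0) {t u : ℝ} (htu : t ≤ u) :
    ‖stepVec s u - stepVec s t‖ ≤ √(u - t) := by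
  have hm : MemLp ((Ico 0 u).indicator (1 : ℝ → ℝ) - (Ico 0 t).indicator 1) 2
      (volume.restrict (Ioc 0 1)) := (memLp_indicator u).sub (memLp_indicator t)
  rw [stepVec, stepVec, ofFun_sub hs (memLp_indicator u) (memLp_indicator t)]
  refine (norm_ofFun_le hs hm).trans (Real.le_sqrt_of_sq_le ?_)
  have hle : ∫⁻ x in Ioc (0 : ℝ) 1,
      ‖((Ico 0 u).indicator (1 : ℝ → ℝ) - (Ico 0 t).indicator (1 : ℝ → ℝ) : ℝ → ℝ) x‖ₑ ^ 2 ≤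
      ENNReal.ofReal (u - t) := by
    calc _ ≤ ∫⁻ x, (Ico t u).indicator 1 x := by
          refine (setLIntegral_le_lintegral _ _).trans (lintegral_mono fun x => ?_)
          by_cases h1 : x ∈ Ico 0 u <;> by_cases h2 : x ∈ Ico 0 t
          · simp [h1, h2]
          · have : x ∈ Ico t u := ⟨not_lt.1 fun h => h2 ⟨h1.1, h⟩, h1.2⟩
            simp [h1, h2, this]
          · exact absurd ⟨h2.1, h2.2.trans_le htu⟩ h1
          · simp [h1, h2]
      _ = _ := by rw [lintegral_indicator_one measurableSet_Ico, Real.volume_Ico]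
  rw [← norm_toLp_sq hm, ENNReal.ofReal_le_ofReal_iff (sub_nonneg.2 htu), Lp.norm_toLp] at hle
  exact hle

theorem continuous_stepVec {s : ℝ} (hs : s ≤ 0) : Continuous (stepVec s) := by
  have key : ∀ t u, ‖stepVec s u - stepVec s t‖ ≤ √|u - t| := fun t u => by
    rcases le_total t u with h | h
    · rw [abs_of_nonneg (sub_nonneg.2 h)]
      exact norm_stepVec_sub_le hs h
    · rw [norm_sub_rev, abs_sub_comm, abs_of_nonneg (sub_nonneg.2 h)]
      exact norm_stepVec_sub_le hs h
  refine continuous_iff_continuousAt.2 fun t => tendsto_iff_norm_sub_tendsto_zero.2 ?_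
  refine squeeze_zero (fun _ => norm_nonneg _) (key t) ?_
  have : Continuous fun u => √|u - t| := by fun_prop
  simpa using this.tendsto t

/-! ### The Haar series of the fractional noise -/

theorem haarCoef_const {M : Type*} [AddCommGroup M] [Module ℝ M] (a : M) (n : ℕ) :
    haarCoef n (fun _ => a) = 0 := by
  simp [haarCoef, dyadicIncr]

theorem haarCoef_mem {M : Type*} [AddCommGroup M] [Module ℝ M] {S : Submodule ℝ M} {G : ℝ → M}
    (hG : ∀ t, G t ∈ S) (n : ℕ) : haarCoef n G ∈ S := by
  unfold haarCoef dyadicIncr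
  split_ifs
  · exact S.sub_mem (hG _) (hG _)
  · exact S.smul_mem _ (S.sub_mem (S.sub_mem (hG _) (hG _)) (S.sub_mem (hG _) (hG _)))

/-- A term of level `l` is at most `4·2^{l(1+2s-p)}`, and there are about `2^l` of them. As `2^l ≥
(n+1)/2`, comparison with `(n+1)^a`, `a = 1 + 2s - p < -1`, suffices. For `p = 2H` the condition
reads `s < H - 1`. -/
theorem IsFractionalCurve.summable_haarWeight_mul_norm_haarCoef_sq {V : Type*}
    [NormedAddCommGroup V] [InnerProductSpace ℝ V] {p s : ℝ} {X : ℝ → V}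
    (hX : IsFractionalCurve p X) (hp : 0 ≤ p) (hs : 2 + 2 * s < p) :
    Summable fun n => (haarWeight s n * ‖haarCoef n X‖) ^ 2 := by
  set a : ℝ := 1 + 2 * s - p with ha
  have hsum : Summable fun n : ℕ => 4 * (2 : ℝ) ^ (-a) * ((n + 1 : ℕ) : ℝ) ^ a :=
    ((summable_nat_add_iff 1).2 (Real.summable_nat_rpow.2 (by linarith))).mul_left _
  refine Summable.of_nonneg_of_le (fun _ => sq_nonneg _) (fun n => ?_) hsum
  set l := Nat.log 2 n
  have h2 : (0 : ℝ) < 2 := two_pos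
  have hw : haarWeight s n ^ 2 = (2 : ℝ) ^ (2 * s * l) := by
    rw [haarWeight, ← Real.rpow_natCast, ← Real.rpow_mul h2.le]
    congr 1
    push_cast
    ring
  have hl : (1 / (2 : ℝ) ^ l) ^ p = (2 : ℝ) ^ (-p * l) := by
    rw [one_div, ← Real.rpow_natCast, ← Real.rpow_neg h2.le, ← Real.rpow_mul h2.le]
    congr 1
    ring
  have hn : ((n + 1 : ℕ) : ℝ) / 2 ≤ (2 : ℝ) ^ (l : ℝ) := by
    have h := Nat.lt_pow_succ_log_self (b := 2) one_lt_two n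
    rw [div_le_iff₀ h2, Real.rpow_natCast]
    exact_mod_cast (show n + 1 ≤ 2 ^ l * 2 by rw [← pow_succ]; exact h)
  calc (haarWeight s n * ‖haarCoef n X‖) ^ 2
      ≤ (2 : ℝ) ^ (2 * s * l) * (4 * 2 ^ l * (1 / 2 ^ l) ^ p) := by
        rw [mul_pow, hw]
        gcongr
        exact hX.norm_haarCoef_sq_le hp n
    _ = 4 * ((2 : ℝ) ^ (l : ℝ)) ^ a := by
        rw [hl, ← Real.rpow_natCast 2 l, ← Real.rpow_mul h2.le, show (l : ℝ) * a =
          2 * s * l + (l + -p * l) by rw [ha]; ring, Real.rpow_add h2, Real.rpow_add h2]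
        ring
    _ ≤ 4 * (((n + 1 : ℕ) : ℝ) / 2) ^ a := by
        refine mul_le_mul_of_nonneg_left ?_ (by norm_num)
        exact Real.rpow_le_rpow_of_nonpos (by positivity) hn (by linarith)
    _ = _ := by
        rw [Real.div_rpow (by positivity) h2.le, Real.rpow_neg h2.le]
        ring

section Series

variable {Ω : Type*} [MeasurableSpace Ω] {P : Measure Ω} {s p : ℝ} {X : ℝ → Lp ℝ 2 P}

/-- The Haar series `∑ ⟨dX, e_n⟩ e_n` of the derivative of a curve `X` in `L²(Ω)`, as an element of
`L²(Ω; B^s_{2,2})`. -/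
def haarSeries (s : ℝ) (X : ℝ → Lp ℝ 2 P) : Lp (Besov s) 2 P :=
  ∑' n, lpSMul (haarVec s n) (haarCoef n X)

theorem hasSum_haarSeries (hs : s < 0) (hs1 : -1 < s) (hX : IsFractionalCurve p X) (hp : 0 ≤ p)
    (hsp : 2 + 2 * s < p) :
    HasSum (fun n => lpSMul (haarVec s n) (haarCoef n X)) (haarSeries s X) := by
  obtain ⟨C, _, hC⟩ := exists_norm_sum_haarVec_le hs hs1
  exact (summable_lpSMul hC (hX.summable_haarWeight_mul_norm_haarCoef_sq hp hsp)).hasSum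

theorem hasSum_compLpL_haarSeries (hs : s < 0) (hs1 : -1 < s) (hX : IsFractionalCurve p X)
    (hp : 0 ≤ p) (hsp : 2 + 2 * s < p) (L : Besov s →L[ℝ] ℝ) :
    HasSum (fun n => L (haarVec s n) • haarCoef n X) (L.compLpL 2 P (haarSeries s X)) := by
  have h := (hasSum_haarSeries hs hs1 hX hp hsp).mapL (L.compLpL 2 P)
  simpa only [compLpL_lpSMul] using h

/-- Along the partial sums of length `2^J`, Parseval's identity rewrites the series for `L` as
dyadic sums of products of increments. -/
theorem tendsto_compLpL_haarSeries (hs : s < 0) (hs1 : -1 < s) (hX : IsFractionalCurve p X)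
    (hp : 0 ≤ p) (hsp : 2 + 2 * s < p) (L : Besov s →L[ℝ] ℝ) {F : ℝ → ℝ}
    (hF : ∀ n, L (haarVec s n) = haarCoef n F) :
    Tendsto (fun J : ℕ => (2 : ℝ) ^ J • ∑ k ∈ Finset.range (2 ^ J),
      dyadicIncr J k F • dyadicIncr J k X) atTop (𝓝 (L.compLpL 2 P (haarSeries s X))) := by
  have h := (hasSum_compLpL_haarSeries hs hs1 hX hp hsp L).tendsto_sum_nat.comp
    (tendsto_pow_atTop_atTop_of_one_lt one_lt_two)
  refine h.congr fun J => ?_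
  rw [Function.comp_apply, ← sum_haarCoef_smul]
  simp only [hF]

/-- With `F t = L(1_{[0,t)})`, `eq_of_tendsto_zero` makes `F` constant. Its Haar coefficients
`L(e_n)` then vanish, and the Haar functions span a dense subspace. -/
theorem eq_zero_of_compLpL_haarSeries_eq_zero (hs : s < 0) (hs1 : -1 < s)
    (hX : IsFractionalCurve p X) (hp : 1 < p) (hp2 : p < 2) (hsp : 2 + 2 * s < p)
    {L : Besov s →L[ℝ] ℝ} (hL : L.compLpL 2 P (haarSeries s X) = 0) : L = 0 := by
  have hcoef : ∀ n, L (haarVec s n) = haarCoef n fun t => L (stepVec s t) := fun n => by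
    rw [haarVec_eq_haarCoef hs.le]
    exact (haarCoef_map L.toLinearMap n (stepVec s)).symm
  have hlim := tendsto_compLpL_haarSeries hs hs1 hX (by linarith) hsp L hcoef
  rw [hL] at hlim
  have hconst : ∀ t ∈ Icc (0 : ℝ) 1, L (stepVec s t) = L (stepVec s 0) := fun t ht => hX.eq_of_tendsto_zero hp hp2
    (L.continuous.comp (continuous_stepVec hs.le)) hlim ht
  have hz : ∀ n, L (haarVec s n) = 0 := fun n => by
    rw [hcoef, haarCoef_congr (G := fun _ => L (stepVec s 0)) fun t h0 h1 => hconst t ⟨h0, h1⟩]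
    exact haarCoef_const _ n
  refine ContinuousLinearMap.ext_on (dense_span_haarVec hs.le) ?_
  rintro _ ⟨n, rfl⟩
  exact hz n

theorem tendsto_riemann_haarSeries (hs : s < 0) (hs1 : -1 < s) (hX : IsFractionalCurve p X)
    (hp : 1 ≤ p) (hsp : 2 + 2 * s < p) (φ : 𝓓(unitIoo, ℝ)) :
    Tendsto (fun n : ℕ => ∑ i ∈ Finset.range n, φ (i / n) • (X ((i + 1 : ℕ) / n) - X (i / n)))
      atTop (𝓝 ((pairingL φ).compLpL 2 P (haarSeries s X))) := by
  have hlim := tendsto_compLpL_haarSeries hs hs1 hX (by linarith) hsp (pairingL φ)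
    (fun n => pairing_haarVec hs.le n φ)
  have hφc : Continuous φ := φ.contDiff.continuous
  have huc : UniformContinuous φ := φ.hasCompactSupport.uniformContinuous_of_continuous hφc
  rw [Metric.tendsto_atTop]
  intro ε hε
  obtain ⟨δ, hδ, hδφ⟩ := Metric.uniformContinuous_iff.1 huc (ε / 3) (by positivity)
  have hmod : ∀ r < δ, ∀ x y : ℝ, |x - y| ≤ r → |φ x - φ y| ≤ ε / 3 := fun r hr x y hxy =>
    (hδφ (hxy.trans_lt hr)).le
  obtain ⟨N, hN⟩ := exists_nat_one_div_lt hδ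
  refine ⟨N + 1, fun n hn => ?_⟩
  have hn0 : 0 < n := by omega
  have hnδ : 1 / (n : ℝ) < δ := by
    refine lt_of_le_of_lt (one_div_le_one_div_of_le (by positivity) ?_) hN
    exact_mod_cast hn
  have h2 : ∀ᶠ J : ℕ in atTop, 1 / (2 : ℝ) ^ J < δ := by
    have := tendsto_pow_atTop_nhds_zero_of_lt_one (r := (1 / 2 : ℝ)) (by norm_num) (by norm_num)
    filter_upwards [this.eventually_lt_const hδ] with J hJ
    rwa [one_div_pow] at hJ
  rw [dist_comm, dist_eq_norm]
  refine lt_of_le_of_lt (le_of_tendsto (hlim.sub_const _).norm ?_) (show ε / 3 + ε / 3 < ε by linarith)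
  -- The mesh `1/n` stays fixed while `J → ∞`, so the bound passes to the limit of the dyadic sums.
  filter_upwards [h2] with J hJ
  exact hX.norm_dyadic_sub_riemann_le hp hφc hn0 (by positivity) (by positivity)
    (hmod _ hJ) (hmod _ hnδ)

end Series

/-! ### Wiener integrals -/

section Wiener

variable {Ω : Type*} [MeasurableSpace Ω] {P : Measure Ω} {H : ℝ} {B : ℝ≥0 → Ω → ℝ}

theorem IsWienerIntegral.congr {φ : ℝ → ℝ} {Z Z' : Ω → ℝ} (h : IsWienerIntegral B P φ Z)
    (hZ : Z =ᵐ[P] Z') : IsWienerIntegral B P φ Z' := by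
  refine ⟨(memLp_congr_ae hZ).1 h.1, h.2.congr fun n => eLpNorm_congr_ae ?_⟩
  filter_upwards [hZ] with ω hω
  rw [hω]

theorem IsFractionalBrownianMotion.isWienerIntegral_iff (hB : IsFractionalBrownianMotion H B P)
    {φ : ℝ → ℝ} {Z : Lp ℝ 2 P} : IsWienerIntegral B P φ Z ↔
      Tendsto (fun n : ℕ => ∑ i ∈ Finset.range n,
        φ (i / n) • (hB.curve ((i + 1 : ℕ) / n) - hB.curve (i / n))) atTop (𝓝 Z) := by
  rw [Lp.tendsto_Lp_iff_tendsto_eLpNorm', IsWienerIntegral, and_iff_right (Lp.memLp Z)]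
  refine tendsto_congr fun n => ?_
  rw [← eLpNorm_neg]
  refine eLpNorm_congr_ae ?_
  have hcoe : ∀ i : ℕ, ((i : ℝ) / n).toNNReal = (i : ℝ≥0) / n := fun i => by
    rw [Real.toNNReal_div (Nat.cast_nonneg i), Real.toNNReal_natCast, Real.toNNReal_natCast]
  have hall : ∀ᵐ ω ∂P, ∀ i : ℕ,
      (φ (i / n) • (hB.curve ((i + 1 : ℕ) / n) - hB.curve (i / n)) : Lp ℝ 2 P) ω =
        φ (i / n) * (B (((i + 1 : ℕ) : ℝ≥0) / n) ω - B ((i : ℝ≥0) / n) ω) := by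
    refine ae_all_iff.2 fun i => ?_
    filter_upwards [Lp.coeFn_smul (φ (i / n)) (hB.curve ((i + 1 : ℕ) / n) - hB.curve (i / n)),
      Lp.coeFn_sub (hB.curve ((i + 1 : ℕ) / n)) (hB.curve (i / n)),
      hB.coeFn_curve ((i + 1 : ℕ) / n), hB.coeFn_curve (i / n)] with ω h1 h2 h3 h4
    rw [h1, Pi.smul_apply, h2, Pi.sub_apply, h3, h4, hcoe, hcoe, smul_eq_mul]
  filter_upwards [hall, Lp.coeFn_finsetSum (Finset.range n) fun i : ℕ =>
    φ (i / n) • (hB.curve ((i + 1 : ℕ) / n) - hB.curve (i / n))] with ω h1 h2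
  rw [Pi.neg_apply, Pi.sub_apply, h2, Finset.sum_apply, neg_sub,
    Finset.sum_congr rfl fun i _ => h1 i]

theorem IsFractionalBrownianMotion.ae_eq_of_isWienerIntegral
    (hB : IsFractionalBrownianMotion H B P) {φ : ℝ → ℝ} {Z Z' : Ω → ℝ}
    (hZ : IsWienerIntegral B P φ Z) (hZ' : IsWienerIntegral B P φ Z') : Z =ᵐ[P] Z' := by
  have h1 := hB.isWienerIntegral_iff.1 (hZ.congr hZ.1.coeFn_toLp.symm)
  have h2 := hB.isWienerIntegral_iff.1 (hZ'.congr hZ'.1.coeFn_toLp.symm)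
  exact (MemLp.toLp_eq_toLp_iff _ _).1 (tendsto_nhds_unique h1 h2)

end Wiener

/-! ### The fractional noise -/

/-- The sets where a given pairing does not vanish are open in a second countable space, so
countably many have the same union. This lets the null sets of the individual test functions be
united. -/
theorem exists_countable_separating (s : ℝ) : ∃ T : Set 𝓓(unitIoo, ℝ), T.Countable ∧
    ∀ u v : Besov s, (∀ φ ∈ T, pairing u φ = pairing v φ) → u = v := by
  obtain ⟨T, hT, hU⟩ := TopologicalSpace.isOpen_iUnion_countable
    (fun φ : 𝓓(unitIoo, ℝ) => {u : Besov s | pairingL φ u ≠ 0})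
    fun φ => isOpen_ne_fun (pairingL φ).continuous continuous_const
  refine ⟨T, hT, fun u v huv => pairing_ext fun φ => ?_⟩
  by_contra hne
  have hmem : u - v ∈ ⋃ φ ∈ T, {u : Besov s | pairingL φ u ≠ 0} := by
    rw [hU]
    refine mem_iUnion.2 ⟨φ, ?_⟩
    change pairingL φ (u - v) ≠ 0
    rw [map_sub]
    exact sub_ne_zero.2 hne
  obtain ⟨φ', hφ', h⟩ := mem_iUnion₂.1 hmem
  refine h ?_
  rw [map_sub]
  exact sub_eq_zero.2 (huv φ' hφ')

section Noise

variable {Ω : Type*} [MeasurableSpace Ω] {P : Measure Ω} {H s : ℝ} {B : ℝ≥0 → Ω → ℝ}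

theorem IsFractionalBrownianMotion.isNoise_haarSeries (hB : IsFractionalBrownianMotion H B P)
    (hH : 1 / 2 < H) (hs : s < 0) (hs1 : -1 < s) (hsH : s < H - 1) :
    IsNoise B P (haarSeries s hB.curve) := by
  refine ⟨Lp.aestronglyMeasurable _, fun φ => ?_⟩
  have h := tendsto_riemann_haarSeries hs hs1 (hB.isFractionalCurve (by linarith))
    (by linarith) (by linarith) φ
  exact (hB.isWienerIntegral_iff.2 h).congr ((pairingL φ).coeFn_compLpL _)

theorem IsFractionalBrownianMotion.isNoise_ae_eq (hB : IsFractionalBrownianMotion H B P)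
    {ξ η : Ω → Besov s} (hξ : IsNoise B P ξ) (hη : IsNoise B P η) : ξ =ᵐ[P] η := by
  obtain ⟨T, hT, hsep⟩ := exists_countable_separating s
  have h : ∀ᵐ ω ∂P, ∀ φ ∈ T, pairing (ξ ω) φ = pairing (η ω) φ :=
    (ae_ball_iff hT).2 fun φ _ => hB.ae_eq_of_isWienerIntegral (hξ.pairing_eq φ) (hη.pairing_eq φ)
  filter_upwards [h] with ω hω
  exact hsep _ _ hω

theorem IsFractionalBrownianMotion.eq_zero_of_ae_eq_zero (hB : IsFractionalBrownianMotion H B P)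
    (hH : 1 / 2 < H) (hH1 : H < 1) (hs : s < 0) (hs1 : -1 < s) (hsH : s < H - 1)
    (L : StrongDual ℝ (Besov s)) (hL : L =ᵐ[P.map (haarSeries s hB.curve)] 0) : L = 0 := by
  refine eq_zero_of_compLpL_haarSeries_eq_zero hs hs1 (hB.isFractionalCurve (by linarith))
    (by linarith) (by linarith) (by linarith) (Lp.ext ?_)
  have h := ae_of_ae_map (Lp.aestronglyMeasurable (haarSeries s hB.curve)).aemeasurable hL
  filter_upwards [L.coeFn_compLpL (haarSeries s hB.curve), h, Lp.coeFn_zero ℝ 2 P] with ω h1 h2 h3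
  rw [h1, h2, h3]
  rfl

variable [IsProbabilityMeasure P]

/-- Finite partial sums lie in the linear span of the process, where laws are centered Gaussian; the
limit is covered by closedness in `L²`. -/
theorem IsFractionalBrownianMotion.map_compLpL_haarSeries (hB : IsFractionalBrownianMotion H B P)
    (hs : s < 0) (hs1 : -1 < s) (hsH : s < H - 1) (L : StrongDual ℝ (Besov s)) :
    ∃ v : ℝ≥0, (P.map (haarSeries s hB.curve)).map L = gaussianReal 0 v := by
  have hsum := hasSum_compLpL_haarSeries hs hs1 (hB.isFractionalCurve (by linarith))
    (by linarith) (by linarith) L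
  have hspan : ∀ F : Finset ℕ, ∑ n ∈ F, L (haarVec s n) • haarCoef n hB.curve ∈
      {f : Lp ℝ 2 P | P.map f = gaussianReal 0 (‖f‖₊ ^ 2)} := fun F =>
    map_eq_gaussianReal_of_mem_span (hB.gaussian.comp_right Real.toNNReal)
      (fun t => hB.centered t.toNNReal) hB.coeFn_curve
      (Submodule.sum_mem _ fun n _ => Submodule.smul_mem _ _
        (haarCoef_mem (fun t => Submodule.subset_span (mem_range_self t)) n))
  have h := isClosed_setOf_map_eq_gaussianReal.mem_of_tendsto hsum (Eventually.of_forall hspan)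
  refine ⟨_, Eq.trans ?_ h⟩
  rw [AEMeasurable.map_map_of_aemeasurable L.continuous.aemeasurable
    (Lp.aestronglyMeasurable _).aemeasurable]
  exact Measure.map_congr (L.coeFn_compLpL _).symm

theorem IsFractionalBrownianMotion.isGaussian_haarSeries (hB : IsFractionalBrownianMotion H B P)
    (hs : s < 0) (hs1 : -1 < s) (hsH : s < H - 1) :
    IsGaussian (P.map (haarSeries s hB.curve)) :=
  isGaussian_of_map_eq_gaussianReal fun L =>
    ⟨0, hB.map_compLpL_haarSeries hs hs1 hsH L⟩

theorem IsFractionalBrownianMotion.integral_haarSeries (hB : IsFractionalBrownianMotion H B P)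
    (hs : s < 0) (hs1 : -1 < s) (hsH : s < H - 1) (L : StrongDual ℝ (Besov s)) :
    ∫ u, L u ∂(P.map (haarSeries s hB.curve)) = 0 := by
  obtain ⟨v, hv⟩ := hB.map_compLpL_haarSeries hs hs1 hsH L
  rw [← integral_id_gaussianReal (μ := 0) (v := v), ← hv,
    integral_map L.continuous.aemeasurable (by fun_prop)]

end Noise

theorem finiteDimensional_haarSpace {s : ℝ} (hs : s ≤ 0) (n : ℕ) :
    FiniteDimensional ℝ (haarSpace s n) := by
  rw [haarSpace_eq_span hs]
  refine FiniteDimensional.span_of_finite ℝ (Set.Finite.image _ ?_)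
  exact (finite_Iio (2 ^ n)).subset fun i hi => Nat.size_le.1 (le_of_eq hi)

end FracNoise

end

/-! ### Conclusion: the properties of the noise and of its law -/

theorem lemmaB1 {Ω : Type*} [MeasurableSpace Ω] (P : Measure Ω) [IsProbabilityMeasure P]
    (H s : ℝ) (hH : 1 / 2 < H) (hH1 : H < 1) (hs : -(1 / 2) < s) (hsH : s < H - 1)
    (B : ℝ≥0 → Ω → ℝ) (hB : FracNoise.IsFractionalBrownianMotion H B P) :
    (∃ ξ : Ω → FracNoise.Besov s, FracNoise.IsNoise B P ξ ∧ MemLp ξ 2 P) ∧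
    ∃ e : SchauderBasis ℝ (FracNoise.Besov s),
      (∀ n, FracNoise.Represents (e n) (FracNoise.haar n)) ∧
      ∃ hF : FracNoise.IsSplitting (FracNoise.haarSpace s),
        ∀ ξ : Ω → FracNoise.Besov s, FracNoise.IsNoise B P ξ →
          MemLp ξ 2 P ∧
          (∃ l, FracNoise.IsDecomposition hF (P.map ξ) l) ∧
          FracNoise.HasAbsContMarginals hF (P.map ξ) ∧
          FracNoise.HasPositivity e hF (P.map ξ) := by
  have hs0 : s < 0 := by linarith
  have hs1 : -1 < s := by linarith
  have hη := hB.isNoise_haarSeries hH hs0 hs1 hsH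
  obtain ⟨e, he⟩ := FracNoise.exists_haar_schauderBasis hs0 hs
  have hF := FracNoise.isSplitting_haarSpace hs0.le e he
  refine ⟨⟨_, hη, Lp.memLp _⟩, e, fun n => ?_, hF, fun ξ hξ => ?_⟩
  · rw [he]
    exact FracNoise.represents_haarVec hs0.le n
  · have hae := hB.isNoise_ae_eq hξ hη
    have hfd := FracNoise.finiteDimensional_haarSpace hs0.le
    have hG := hB.isGaussian_haarSeries hs0 hs1 hsH
    have h0 := hB.integral_haarSeries hs0 hs1 hsH
    have hnd := hB.eq_zero_of_ae_eq_zero hH hH1 hs0 hs1 hsH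
    -- Every version of the noise agrees almost surely with the Haar series, so only the law of the
    -- series has to be treated.
    rw [Measure.map_congr hae]
    exact ⟨(memLp_congr_ae hae).2 (Lp.memLp _), FracNoise.exists_isDecomposition hF _,
      FracNoise.hasAbsContMarginals_of_nondegenerate hF h0 hnd,
      FracNoise.hasPositivity_of_measure_closedBall_pos e hF _ fun x _ hε =>
        FracNoise.measure_closedBall_pos_of_nondegenerate h0 hnd x hε⟩
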